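/- Work in $\mathbb P^3$ over an algebraically closed field $K$, and let $Q=\{F=0\}\subset\mathbb P^3$ be a smooth quadric with a fixed ruling $\mathcal R$. **Definitions.** A *reduced zig-zag* of length $n$ is a union of lines $L_1,\dots,L_n$ such that $L_i$ and $L_{i+1}$ meet in one point for every $i$, and $L_i\cap L_j=\emptyset$ for $|i-j|\ge 2$; for $n=1$ it is a line, for $n=0$ it is empty, and for $n=2$ it is called a *cross*. The *zig-zag* of length $n$ on these lines has the ideal $\bigcap_i I(L_i)\cap\bigcap_i I(L_i\cap L_{i+1})^2$; for $n=2$ it is called a *sundial*. A *scheme of type $Z(m,r,s,q,z)$* is a union of one $m$-fold line (defined by the $m$-th power of the ideal of a line), $r$ lines, $s$ crosses, $q$ points and one reduced zig-zag of length $z$, all pairwise disjoint. A line is *transversal* to $Q$ if it meets $Q$ in exactly two distinct points. Let $m,r,s,q,z,\delta,\ell,\ell_s,\ell_z,t,t_s,t_z\ge 0$ be integers with $\delta\in\{0,1\}$, $\delta\le m$, $\ell_z=\lfloor z/2\rfloor$, $\ell+2t_s+(t_z+1)\le r$, $\ell_s\le s$ and $t\le q$. A *specialization of type $R(\delta,\ell,\ell_s,\ell_z,t,t_s,t_z)$*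 of $Z(m,r,s,q,z)$ is a scheme $Z'$ that is the union of the following pairwise disjoint components: * an $m$-fold line, which belongs to $\mathcal R$ if $\delta=1$ and is transversal to $Q$ if $\delta=0$; * $r-2t_s-(t_z+1)$ lines, of which $\ell$ belong to $\mathcal R$ and the others are transversal to $Q$; * $s$ crosses; in $\ell_s$ of them one line belongs to $\mathcal R$ and the other is transversal to $Q$; in the others both lines are transversal to $Q$ and meet outside $Q$; * a reduced zig-zag $L_1\cup\dots\cup L_z$ in which $L_2,L_4,\dots$ (that is, $\ell_z$ lines) belong to $\mathcal R$ and $L_1,L_3,\dots$ are transversal to $Q$; * $q$ points, $t$ of them on $Q$ and the others not on $Q$; * $t_s$ sundials, whose lines are transversal to $Q$ and whose singular points lie on $Q$; * one (non-reduced) zig-zag of length $t_z+1$, whose lines are transversal to $Q$ and whose $t_z$ singular points lie on $Q$. For a subscheme $Z'$ with homogeneous ideal $I_{Z'}$, the residual scheme $\operatorname{Res}_Q(Z')$ is defined by $I_{Z'}:(F)$, and the trace $\operatorname{Tr}_Q(Z')$ is the subscheme of $Q$ defined by $I_{Z'}+(F)$. **Lemma.** The integer $$p=2r-2\ell-2\ell_z-3\ell_s-2t_s-2t_z+t+4s+z+\gamma,\qquad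 \gamma=\begin{cases}0,& z=0,\\ 1,& z>0,\end{cases}$$ is non-negative, and the following hold. 1. For every specialization $Z'$ of type $R(\delta,\ell,\ell_s,\ell_z,t,t_s,t_z)$, the scheme $\operatorname{Res}_Q(Z')$ is of type $$Z\bigl(m-\delta,\; r-\ell+\ell_s+(z-\ell_z)-2t_s-(t_z+1),\; s-\ell_s+t_s,\; q-t,\; t_z+1\bigr);$$ precisely, it consists of the same fat line with multiplicity $m-\delta$; the lines of $Z'$ that are transversal to $Q$, the transversal lines of the $\ell_s$ crosses with a line in $\mathcal R$, and the lines $L_1,L_3,\dots$; the remaining $s-\ell_s$ crosses and the $t_s$ crosses underlying the sundials; the $q-t$ points not on $Q$; and the reduced zig-zag underlying the zig-zag of length $t_z+1$. This is an equality of homogeneous ideals. 2. For every such $Z'$, one has $\operatorname{Tr}_Q(Z')=D+\Omega$ as subschemes of $Q$, where $D$ is a divisor consisting of $\delta$ lines of multiplicity $m$ and $\ell+\ell_s+\ell_z$ reduced lines, all pairwise disjoint and contained in $\mathcal R$, and $\Omega$ consists of $p$ simple points, $t_s+t_z$ double points and $2-2\delta$ points of multiplicity $m$ on $Q$, all distinct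 and not on $D$. 3. The lines of $D$ and the points of $\Omega$ are general, except that the points in which an uncut cross meets $Q$ are coplanar. That is: choose any $s-\ell_s$ disjoint ordered quadruples among the (numbered) $p$ simple points, and let $Y$ be the space of all choices of $\delta+\ell+\ell_s+\ell_z$ lines of $\mathcal R$ (each given by a point on it), $p$ simple, $t_s+t_z$ double and $2-2\delta$ $m$-fold points on $Q$ for which each of the chosen quadruples consists of coplanar points, no three of which are collinear. Then every nonempty Zariski open subset of $Y$ contains a configuration of lines and points that arises as in 2 from the trace of some specialization $Z'$. In particular, if $\ell_s=s$, then the lines of $D$ and all the points of $\Omega$ are general. -/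

import Mathlib

namespace QuadricReduction

section Basic

variable (K : Type*) [Field K]

/-- The homogeneous coordinate ring `K[x₀, x₁, x₂, x₃]` of `ℙ³`. -/
abbrev Coord := MvPolynomial (Fin 4) K

/-- Points of `ℙ³`. -/
abbrev Pt := Projectivization K (Fin 4 → K)

/-- Lines of `ℙ³`: two-dimensional subspaces of `K⁴`. -/
abbrev Line := {W : Submodule K (Fin 4 → K) // Module.finrank K W = 2}

end Basic

variable {K : Type*} [Field K]

/-- The homogeneous ideal of the linear subvariety of `ℙ³` given by a subspace of `K⁴`. -/
noncomputable def linIdeal (W : Submodule K (Fin 4 → K)) : Ideal (Coord K) :=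
  MvPolynomial.vanishingIdeal K (W : Set (Fin 4 → K))

/-- `F` vanishes on the linear subvariety of `ℙ³` given by `W`. -/
def VanishesOn (F : Coord K) (W : Submodule K (Fin 4 → K)) : Prop :=
  ∀ v ∈ W, MvPolynomial.eval v F = 0

/-- `F` is the equation of a smooth quadric in `ℙ³` (Jacobian criterion). -/
def IsSmoothQuadric (F : Coord K) : Prop :=
  F.IsHomogeneous 2 ∧
    ∀ v : Fin 4 → K, v ≠ 0 → MvPolynomial.eval v F = 0 →
      ∃ i, MvPolynomial.eval v (MvPolynomial.pderiv i F) ≠ 0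

/-- `ℛ` is one of the rulings of the quadric `F = 0`: a family of pairwise disjoint lines on
the quadric that covers the quadric. -/
structure IsRuling (F : Coord K) (ℛ : Set (Line K)) : Prop where
  onQuadric : ∀ L ∈ ℛ, VanishesOn F L.1
  disjoint : ∀ L ∈ ℛ, ∀ L' ∈ ℛ, L ≠ L' → Disjoint L.1 L'.1
  covers : ∀ p : Pt K, VanishesOn F p.submodule → ∃ L ∈ ℛ, p.submodule ≤ L.1

/-- The line `L` meets the quadric `F = 0` in exactly two distinct points. -/
def Transversal (F : Coord K) (L : Line K) : Prop :=
  ¬ VanishesOn F L.1 ∧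
    ∃ p p' : Pt K, p ≠ p' ∧ p.submodule ≤ L.1 ∧ p'.submodule ≤ L.1 ∧
      VanishesOn F p.submodule ∧ VanishesOn F p'.submodule

/-- `L₀, …, L_{n-1}` form a chain: consecutive lines meet in one point, and there are no other
intersections (so the `n - 1` intersection points are distinct). A chain with `n = 2` is a
cross. -/
def IsChain {n : ℕ} (L : Fin n → Line K) : Prop :=
  (∀ i j : Fin n, i.val + 1 = j.val → Module.finrank K ↥((L i).1 ⊓ (L j).1) = 1) ∧
    ∀ i j : Fin n, i.val + 1 < j.val → Disjoint (L i).1 (L j).1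

/-- The ideal of the union of finitely many (reduced) lines; for a chain, the ideal of a reduced
zig-zag. -/
noncomputable def unionIdeal {n : ℕ} (L : Fin n → Line K) : Ideal (Coord K) :=
  ⨅ i, linIdeal (L i).1

/-- The ideal of the zig-zag on a chain of lines: the union of the lines and of the first
infinitesimal neighbourhoods (in `ℙ³`) of the intersection points. For `n = 2` this is a
sundial. -/
noncomputable def zigzagIdeal {n : ℕ} (L : Fin n → Line K) : Ideal (Coord K) :=
  unionIdeal L ⊓
    ⨅ (i : Fin n) (j : Fin n) (_ : i.val + 1 = j.val), linIdeal ((L i).1 ⊓ (L j).1) ^ 2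

/-! ### Schemes of type `Z(m, r, s, q, z)` -/

variable (K) in
/-- A line (to be taken with a multiplicity), `r` lines, `s` pairs of lines, `q` points and
an ordered set of `z` lines. -/
structure Config (r s q z : ℕ) where
  fat : Line K
  line : Fin r → Line K
  cross : Fin s → Fin 2 → Line K
  point : Fin q → Pt K
  zig : Fin z → Line K

/-- Labels for the components of a `Config`. -/
inductive Part (r s q z : ℕ)
  | fat
  | line (i : Fin r)
  | cross (i : Fin s)
  | point (i : Fin q)
  | zig

namespace Config

variable {r s q z : ℕ}

/-- The linear subvarieties that make up a component. -/
def pieces (C : Config K r s q z) : Part r s q z → Set (Submodule K (Fin 4 → K))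
  | .fat => {C.fat.1}
  | .line i => {(C.line i).1}
  | .cross i => Set.range fun j => (C.cross i j).1
  | .point i => {(C.point i).submodule}
  | .zig => Set.range fun j => (C.zig j).1

/-- The pairs are crosses, the last lines are a reduced zig-zag, and the components (fat line,
lines, crosses, points, zig-zag) are pairwise disjoint. -/
structure Proper (C : Config K r s q z) : Prop where
  cross_chain : ∀ i, IsChain (C.cross i)
  zig_chain : IsChain C.zig
  disjoint : ∀ a b : Part r s q z, a ≠ b →
    ∀ U ∈ C.pieces a, ∀ W ∈ C.pieces b, Disjoint U W

/-- The ideal of the scheme: the line `fat` is taken with multiplicity `m`, everything else is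
reduced. -/
noncomputable def ideal (m : ℕ) (C : Config K r s q z) : Ideal (Coord K) :=
  linIdeal C.fat.1 ^ m ⊓ unionIdeal C.line ⊓ (⨅ i, unionIdeal (C.cross i)) ⊓
    (⨅ i, linIdeal (C.point i).submodule) ⊓ unionIdeal C.zig

end Config

/-! ### The specializations `R(δ, ℓ, ℓ_s, ℓ_z, t, t_s, t_z)` -/

variable (K) in
/-- In addition to a `Config`: `u` pairs of lines and `w` further lines, which are to carry
sundials and a non-reduced zig-zag. -/
structure SpecConfig (r s q z u w : ℕ) extends Config K r s q z where
  sundial : Fin u → Fin 2 → Line K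
  zz : Fin w → Line K

/-- Labels for the components of a `SpecConfig`. -/
inductive SpecPart (r s q z u : ℕ)
  | old (a : Part r s q z)
  | sundial (i : Fin u)
  | zz

namespace SpecConfig

variable {r s q z u w : ℕ}

/-- The linear subvarieties that make up a component. -/
def allPieces (Z : SpecConfig K r s q z u w) :
    SpecPart r s q z u → Set (Submodule K (Fin 4 → K))
  | .old a => Z.toConfig.pieces a
  | .sundial i => Set.range fun j => (Z.sundial i j).1
  | .zz => Set.range fun j => (Z.zz j).1

/-- The ideal of the scheme: an `m`-fold line, lines, crosses, points, a reduced zig-zag,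
sundials and a zig-zag. -/
noncomputable def specIdeal (m : ℕ) (Z : SpecConfig K r s q z u w) : Ideal (Coord K) :=
  Z.toConfig.ideal m ⊓ (⨅ i, zigzagIdeal (Z.sundial i)) ⊓ zigzagIdeal Z.zz

/-- `Z` is a specialization of type `R(δ, ℓ, ℓ_s, ⌊z/2⌋, t, t_s, t_z)` with respect to the quadric
`F = 0` and its ruling `ℛ` (`u = t_s`, `w = t_z + 1`, and `r` counts the lines that are not used
for the sundials and the zig-zag). The lines `L₂, L₄, …` of the reduced zig-zag have odd index
because indices start at `0`. -/
structure IsSpecialization (Z : SpecConfig K r s q z u w) (F : Coord K) (ℛ : Set (Line K))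
    (δ l ls t : ℕ) : Prop where
  proper : Z.toConfig.Proper
  sundial_chain : ∀ i, IsChain (Z.sundial i)
  zz_chain : IsChain Z.zz
  disjoint : ∀ a b : SpecPart r s q z u, a ≠ b →
    ∀ U ∈ Z.allPieces a, ∀ W ∈ Z.allPieces b, Disjoint U W
  fat_on : δ = 1 → Z.fat ∈ ℛ
  fat_off : δ = 0 → Transversal F Z.fat
  line_on : ∀ i, i.val < l → Z.line i ∈ ℛ
  line_off : ∀ i, l ≤ i.val → Transversal F (Z.line i)
  cross_off_zero : ∀ i, Transversal F (Z.cross i 0)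
  cross_on : ∀ i, i.val < ls → Z.cross i 1 ∈ ℛ
  cross_off : ∀ i, ls ≤ i.val → Transversal F (Z.cross i 1) ∧
    ¬ VanishesOn F ((Z.cross i 0).1 ⊓ (Z.cross i 1).1)
  zig_on : ∀ i, Odd i.val → Z.zig i ∈ ℛ
  zig_off : ∀ i, Even i.val → Transversal F (Z.zig i)
  point_on : ∀ i, i.val < t → VanishesOn F (Z.point i).submodule
  point_off : ∀ i, t ≤ i.val → ¬ VanishesOn F (Z.point i).submodule
  sundial_off : ∀ i j, Transversal F (Z.sundial i j)
  sundial_node : ∀ i, VanishesOn F ((Z.sundial i 0).1 ⊓ (Z.sundial i 1).1)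
  zz_off : ∀ j, Transversal F (Z.zz j)
  zz_node : ∀ i j : Fin w, i.val + 1 = j.val → VanishesOn F ((Z.zz i).1 ⊓ (Z.zz j).1)

/-- `C` consists of what is left of `Z`: the same fat line; the lines that do not lie on the
quadric, including those left from the cut crosses and from the reduced zig-zag; the crosses that
were not cut and the crosses underlying the sundials; the points that are not on the quadric; the
reduced zig-zag underlying the new zig-zag. -/
structure IsRemainder {r' s' q' : ℕ} (Z : SpecConfig K r s q z u w) (l ls t : ℕ)
    (C : Config K r' s' q' w) : Prop where
  fat : C.fat = Z.fat
  line : Set.range C.line =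
    {L | ∃ i, l ≤ i.val ∧ L = Z.line i} ∪ {L | ∃ i, i.val < ls ∧ L = Z.cross i 0} ∪
      {L | ∃ i, Even i.val ∧ L = Z.zig i}
  cross : Set.range C.cross =
    {X | ∃ i, ls ≤ i.val ∧ X = Z.cross i} ∪ Set.range Z.sundial
  point : Set.range C.point = {p | ∃ i, t ≤ i.val ∧ p = Z.point i}
  zig : C.zig = Z.zz

end SpecConfig

/-! ### Residual scheme and trace -/

/-- The ideal `I_Z : I_Q` of the residual scheme with respect to the divisor `F = 0`. -/
noncomputable def residualIdeal (F : Coord K) (I : Ideal (Coord K)) : Ideal (Coord K) :=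
  Submodule.colon I (Ideal.span {F} : Set (Coord K))

/-- The ideal `I_Q + I_Z`, which defines the trace on the divisor `F = 0`. -/
noncomputable def traceIdeal (F : Coord K) (I : Ideal (Coord K)) : Ideal (Coord K) :=
  Ideal.span {F} ⊔ I

variable (K) in
/-- The irrelevant ideal `(x₀, x₁, x₂, x₃)`. -/
noncomputable def irrelevantIdeal : Ideal (Coord K) :=
  Ideal.span (Set.range MvPolynomial.X)

/-- Two homogeneous ideals define the same closed subscheme of `ℙ³`: they have the same
saturation with respect to the irrelevant ideal. -/
def SameSubscheme (I J : Ideal (Coord K)) : Prop :=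
  ∃ n : ℕ, irrelevantIdeal K ^ n * I ≤ J ∧ irrelevantIdeal K ^ n * J ≤ I

/-! ### Subschemes `D + Ω` of the quadric -/

variable (K) in
/-- `δ` lines (to be taken with a multiplicity), `n` reduced lines, `p` simple points, `e` double
points and `f` multiple points. -/
structure TraceData (δ n p e f : ℕ) where
  fatLine : Fin δ → Line K
  redLine : Fin n → Line K
  simple : Fin p → Pt K
  double : Fin e → Pt K
  multiple : Fin f → Pt K

/-- Labels for the lines and points of a `TraceData`. -/
inductive TracePart (δ n p e f : ℕ)
  | fatLine (i : Fin δ)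
  | redLine (i : Fin n)
  | simple (i : Fin p)
  | double (i : Fin e)
  | multiple (i : Fin f)

namespace TraceData

variable {δ n p e f : ℕ}

/-- The linear subvariety with a given label. -/
def flat (T : TraceData K δ n p e f) : TracePart δ n p e f → Submodule K (Fin 4 → K)
  | .fatLine i => (T.fatLine i).1
  | .redLine i => (T.redLine i).1
  | .simple i => (T.simple i).submodule
  | .double i => (T.double i).submodule
  | .multiple i => (T.multiple i).submodule

/-- All lines belong to the ruling `ℛ`, all points lie on the quadric `F = 0`, and the lines and
points are pairwise disjoint (so the points are distinct and do not lie on the lines). -/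
structure Proper (T : TraceData K δ n p e f) (F : Coord K) (ℛ : Set (Line K)) : Prop where
  fatLine_mem : ∀ i, T.fatLine i ∈ ℛ
  redLine_mem : ∀ i, T.redLine i ∈ ℛ
  onQuadric : ∀ a, VanishesOn F (T.flat a)
  disjoint : ∀ a b, a ≠ b → Disjoint (T.flat a) (T.flat b)

/-- The ideal of the divisor `D = ∑ m·Mᵢ + ∑ Lⱼ` on the quadric. -/
noncomputable def divisorIdeal (F : Coord K) (m : ℕ) (T : TraceData K δ n p e f) :
    Ideal (Coord K) :=
  Ideal.span {F} ⊔ (∏ i, linIdeal (T.fatLine i).1 ^ m) * ∏ i, linIdeal (T.redLine i).1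

/-- The ideal of the `k`-fold point `x` on the quadric. -/
noncomputable def fatPointIdeal (F : Coord K) (k : ℕ) (x : Pt K) : Ideal (Coord K) :=
  Ideal.span {F} ⊔ linIdeal x.submodule ^ k

/-- The ideal of the scheme `Ω` of simple, double and `m`-fold points on the quadric. -/
noncomputable def omegaIdeal (F : Coord K) (m : ℕ) (T : TraceData K δ n p e f) :
    Ideal (Coord K) :=
  (⨅ i, fatPointIdeal F 1 (T.simple i)) ⊓ (⨅ i, fatPointIdeal F 2 (T.double i)) ⊓
    ⨅ i, fatPointIdeal F m (T.multiple i)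

/-- The ideal of the subscheme `D + Ω` of the quadric. -/
noncomputable def sumIdeal (F : Coord K) (m : ℕ) (T : TraceData K δ n p e f) :
    Ideal (Coord K) :=
  Ideal.span {F} ⊔ T.divisorIdeal F m * T.omegaIdeal F m

/-- The vectors `v a` represent points on the lines of `T` and the points of `T`. (A line of a
ruling is determined by a point on it.) -/
def IsRepresentedBy (T : TraceData K δ n p e f)
    (v : TracePart δ n p e f → Fin 4 → K) : Prop :=
  ∀ a, v a ≠ 0 ∧ v a ∈ T.flat a

/-- The parameter space for configurations of ruling lines and points on the quadric in which the
`c` quadruples of simple points selected by `quad` consist of coplanar points, no three of which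
are collinear. -/
def IsParameter {c : ℕ} (F : Coord K) (quad : Fin c × Fin 4 ↪ Fin p)
    (v : TracePart δ n p e f → Fin 4 → K) : Prop :=
  (∀ a, v a ≠ 0 ∧ MvPolynomial.eval (v a) F = 0) ∧
    ∀ j : Fin c,
      ¬ LinearIndependent K (fun i : Fin 4 => v (.simple (quad (j, i)))) ∧
        ∀ i₀ : Fin 4,
          LinearIndependent K (fun i : {i : Fin 4 // i ≠ i₀} => v (.simple (quad (j, i.1))))

end TraceData

end QuadricReduction

open QuadricReduction

/-! Write I(W) for the ideal of a linear subvariety W and B for the polar form of F.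

Residual scheme. Let π be a linear projection onto W. The substitution x ↦ πx + t(x − πx) turns
membership in I(W)^m into divisibility by t^m (`X_pow_dvd_deformation_iff`). Since t is a prime
element, orders of vanishing along W add up in products. Smoothness bounds the order of F along any
nonzero W by one (`IsSmoothQuadric.notMem_sq`). So dividing by F lowers the multiplicity of a line
of the ruling by one and leaves a transversal line as it is. The squared ideals at the nodes of the
sundials and of the zig-zag disappear, because f and F each contribute order one there. This is
`IsSpecialization.mem_residualIdeal_iff`.

Trace. By the Nullstellensatz two ideals have the same saturation once they agree locally at every
nonzero vector (`sameSubscheme_of_locLE`), so the trace can be computed point by point. The local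
input is `Transversal.exists_mul_mem`: at a point x of a transversal line L on the quadric, I(x) is
(F) + I(L) up to a unit. Hence a reduced line cuts out a simple point and an m-fold line an m-fold
point. At a node of two lines L and L′ the product of (F) + I(L) and (F) + I(L′) lies in (F) +
I(L)I(L′), and I(L)I(L′) satisfies all equations of the sundial, which gives a double point. A
transversal line adds nothing where it meets a ruling line of the scheme (`red_locLE`). The number p
is the number of labels in `SimpleIdx`.

Generality. In suitable coordinates F is the determinant of 2 × 2 matrices, its points are the a ⊗
b, and the ruling consists of the lines a ⊗ K² (`exists_normalForm`). A configuration with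
prescribed coplanar quadruples is the image of a vector of free parameters: factors a, b, planes M,
and scalars. A point in the plane M is a multiple of a ⊗ rot(aM) or of rot(Mb) ⊗ b, and at least one
of these charts reaches it, because no three points of the quadruple are collinear
(`vecMul_ne_zero_or_mulVec_ne_zero`). On a vector space over an infinite field, finitely many
polynomial inequalities that can be satisfied one by one can be satisfied together (the filter
`generic`). So the given open condition can be combined with general position (`exists_isGeneral`).
The specialization is then built backwards from its trace (`Construction.config`): every line is the
join of two points of the quadric, a coplanar quadruple gives two lines that meet, and a point off
the quadric is the sum of two vectors on it. -/

namespace QuadricReduction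

variable {K : Type*} [Field K]

/-! ### Powers of the ideal of a linear subspace. -/

section LinearIdeals

open MvPolynomial

theorem mem_linIdeal {W : Submodule K (Fin 4 → K)} {f : Coord K} :
    f ∈ linIdeal W ↔ ∀ v ∈ W, eval v f = 0 := by
  simp [linIdeal, mem_vanishingIdeal_iff, aeval_eq_eval]

theorem linIdeal_anti {U W : Submodule K (Fin 4 → K)} (h : U ≤ W) :
    linIdeal W ≤ linIdeal U := fun _ hf =>
  mem_linIdeal.2 fun v hv => mem_linIdeal.1 hf v (h hv)

/-- The linear form in the coordinate ring given by a linear functional. -/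
noncomputable def linForm (φ : (Fin 4 → K) →ₗ[K] K) : Coord K :=
  ∑ i, C (φ (Pi.single i 1)) * X i

@[simp]
theorem eval_linForm (φ : (Fin 4 → K) →ₗ[K] K) (v : Fin 4 → K) :
    eval v (linForm φ) = φ v := by
  conv_rhs => rw [pi_eq_sum_univ' v]
  simp [linForm, map_sum, mul_comm]

theorem linForm_mem {φ : (Fin 4 → K) →ₗ[K] K} {W : Submodule K (Fin 4 → K)} :
    linForm φ ∈ linIdeal W ↔ ∀ v ∈ W, φ v = 0 := by
  simp [mem_linIdeal]

theorem exists_mem_linIdeal_eval_ne_zero {W : Submodule K (Fin 4 → K)} {v : Fin 4 → K}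
    (hv : v ∉ W) : ∃ g ∈ linIdeal W, eval v g ≠ 0 := by
  obtain ⟨φ, h1, h2⟩ := Submodule.exists_le_ker_of_notMem hv
  exact ⟨linForm φ, linForm_mem.2 fun w hw => by simpa using h2 hw, by simpa using h1⟩

/-- Substitution of a linear endomorphism into a polynomial. -/
noncomputable def linSubst (π : (Fin 4 → K) →ₗ[K] (Fin 4 → K)) : Coord K →ₐ[K] Coord K :=
  aeval fun i => linForm (LinearMap.proj i ∘ₗ π)

theorem eval_linSubst (π : (Fin 4 → K) →ₗ[K] (Fin 4 → K)) (v : Fin 4 → K) (f : Coord K) :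
    eval v (linSubst π f) = eval (π v) f := by
  induction f using MvPolynomial.induction_on with
  | C a => simp [linSubst]
  | add p q hp hq => simp [hp, hq]
  | mul_X p i hp => rw [map_mul, map_mul, hp]; simp [linSubst]

/-- The substitution `x ↦ π x + t (x - π x)`. -/
noncomputable def deformation (π : (Fin 4 → K) →ₗ[K] (Fin 4 → K)) :
    Coord K →ₐ[K] Polynomial (Coord K) :=
  aeval fun i => Polynomial.C (linSubst π (X i)) +
    Polynomial.X * Polynomial.C (X i - linSubst π (X i))

theorem eval_one_deformation (π : (Fin 4 → K) →ₗ[K] (Fin 4 → K)) (f : Coord K) :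
    (deformation π f).eval 1 = f := by
  induction f using MvPolynomial.induction_on with
  | C a => simp [deformation]
  | add p q hp hq => simp [hp, hq]
  | mul_X p i hp => rw [map_mul, Polynomial.eval_mul, hp]; simp [deformation]

theorem eval_zero_deformation (π : (Fin 4 → K) →ₗ[K] (Fin 4 → K)) (f : Coord K) :
    (deformation π f).eval 0 = linSubst π f := by
  induction f using MvPolynomial.induction_on with
  | C a => simp [deformation]
  | add p q hp hq => simp [hp, hq]
  | mul_X p i hp => rw [map_mul, map_mul, Polynomial.eval_mul, hp]; simp [deformation]

theorem exists_projection (W : Submodule K (Fin 4 → K)) :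
    ∃ π : (Fin 4 → K) →ₗ[K] (Fin 4 → K), (∀ v, π v ∈ W) ∧ ∀ v ∈ W, π v = v := by
  obtain ⟨g, hg⟩ := LinearMap.exists_leftInverse_of_injective W.subtype (by simp)
  refine ⟨W.subtype ∘ₗ g, fun v => by simp, fun v hv => ?_⟩
  have := LinearMap.congr_fun hg ⟨v, hv⟩
  simp at this
  simp [this]

section

variable {W : Submodule K (Fin 4 → K)} {π : (Fin 4 → K) →ₗ[K] (Fin 4 → K)}
  (h1 : ∀ v, π v ∈ W) (h2 : ∀ v ∈ W, π v = v)

include h2 in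
theorem sub_linSubst_mem (f : Coord K) : f - linSubst π f ∈ linIdeal W := by
  rw [mem_linIdeal]
  intro v hv
  simp [eval_linSubst, h2 v hv]

-- The Rees algebra is closed under sums and products, so only the coordinates matter. For these the
-- coefficient of t is a linear form that vanishes on W.
include h2 in
theorem deformation_mem_reesAlgebra (f : Coord K) :
    deformation π f ∈ reesAlgebra (linIdeal W) := by
  induction f using MvPolynomial.induction_on with
  | C a =>
    have : deformation π (C a) = algebraMap (Coord K) _ (C a) := by
      simp [deformation]
    rw [this]
    exact Subalgebra.algebraMap_mem _ _
  | add p q hp hq =>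
    rw [map_add]
    exact Subalgebra.add_mem _ hp hq
  | mul_X p i hp =>
    rw [map_mul]
    refine Subalgebra.mul_mem _ hp ?_
    simp only [deformation, aeval_X]
    refine Subalgebra.add_mem _ (Subalgebra.algebraMap_mem _ _) ?_
    rw [mul_comm, ← pow_one (Polynomial.X (R := Coord K)), Polynomial.C_mul_X_pow_eq_monomial]
    rw [mem_reesAlgebra_iff]
    intro k
    rw [Polynomial.coeff_monomial]
    split_ifs with h
    · rw [← h, pow_one]
      exact sub_linSubst_mem h2 _
    · exact zero_mem _

variable [Infinite K]

-- The constant term is f ∘ π, and the image of π is W. Over an infinite field it is zero as a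
-- polynomial if it is zero as a function.
include h1 h2 in
theorem X_dvd_deformation_iff (f : Coord K) :
    Polynomial.X ∣ deformation π f ↔ f ∈ linIdeal W := by
  rw [Polynomial.X_dvd_iff, Polynomial.coeff_zero_eq_eval_zero, eval_zero_deformation,
    mem_linIdeal]
  constructor
  · intro h v hv
    have := eval_linSubst π v f
    rw [h, h2 v hv] at this
    simpa using this.symm
  · intro h
    refine MvPolynomial.funext fun v => ?_
    rw [eval_linSubst, h _ (h1 v), map_zero]

-- At t = 1 the deformation is f, so f is the sum of the coefficients, and the k-th coefficient lies
-- in the k-th power of the ideal. Conversely, the deformation maps the ideal into (t), hence its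
-- m-th power into (t^m).
include h1 h2 in
theorem X_pow_dvd_deformation_iff (m : ℕ) (f : Coord K) :
    Polynomial.X ^ m ∣ deformation π f ↔ f ∈ linIdeal W ^ m := by
  constructor
  · intro h
    rw [← eval_one_deformation π f, Polynomial.eval_eq_sum_range]
    refine Ideal.sum_mem _ fun k _ => ?_
    rw [one_pow, mul_one]
    rcases lt_or_ge k m with hk | hk
    · rw [Polynomial.X_pow_dvd_iff.1 h k hk]
      exact zero_mem _
    · exact Ideal.pow_le_pow_right hk
        ((mem_reesAlgebra_iff _ _).1 (deformation_mem_reesAlgebra h2 f) k)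
  · intro h
    have hle : (linIdeal W).map (deformation π) ≤ Ideal.span {Polynomial.X} := by
      rw [Ideal.map_le_iff_le_comap]
      intro g hg
      rw [Ideal.mem_comap, Ideal.mem_span_singleton]
      exact (X_dvd_deformation_iff h1 h2 g).2 hg
    have := Ideal.mem_map_of_mem (deformation π) h
    rw [Ideal.map_pow] at this
    have := Ideal.pow_right_mono hle m this
    rwa [Ideal.span_singleton_pow, Ideal.mem_span_singleton] at this

end

/-- As t is prime, a factor that t does not divide has no influence on divisibility by t^m. -/
theorem mul_mem_linIdeal_pow_iff [Infinite K] {W : Submodule K (Fin 4 → K)} {F : Coord K}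
    (hF : F ∉ linIdeal W) (m : ℕ) (f : Coord K) :
    f * F ∈ linIdeal W ^ m ↔ f ∈ linIdeal W ^ m := by
  refine ⟨fun h => ?_, fun h => Ideal.mul_mem_right _ _ h⟩
  obtain ⟨π, h1, h2⟩ := exists_projection W
  rw [← X_pow_dvd_deformation_iff h1 h2] at h ⊢
  rw [mul_comm, map_mul] at h
  exact Polynomial.prime_X.pow_dvd_of_dvd_mul_left m
    (mt (X_dvd_deformation_iff h1 h2 F).1 hF) h

theorem mul_mem_linIdeal_pow_succ_iff [Infinite K] {W : Submodule K (Fin 4 → K)} {F : Coord K}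
    (hF : F ∈ linIdeal W) (hF2 : F ∉ linIdeal W ^ 2) (m : ℕ) (f : Coord K) :
    f * F ∈ linIdeal W ^ (m + 1) ↔ f ∈ linIdeal W ^ m := by
  refine ⟨fun h => ?_, fun h => ?_⟩
  · obtain ⟨π, h1, h2⟩ := exists_projection W
    -- Here g is the deformation of F divided by t. It is not divisible by t, because F has order
    -- exactly one along W.
    obtain ⟨g, hg⟩ := (X_dvd_deformation_iff h1 h2 F).2 hF
    rw [← X_pow_dvd_deformation_iff h1 h2] at h hF2 ⊢
    rw [mul_comm, map_mul, hg, mul_assoc, pow_succ', mul_dvd_mul_iff_left Polynomial.X_ne_zero]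
      at h
    refine Polynomial.prime_X.pow_dvd_of_dvd_mul_left m (fun hX => hF2 ?_) h
    rw [hg, pow_two]
    exact mul_dvd_mul_left _ hX
  · rw [pow_succ]
    exact Ideal.mul_mem_mul h hF

/-- Modulo the linear forms that vanish on W every f is congruent to f ∘ π: this holds for
coordinates and is compatible with sums and products. For f in the ideal of W, f ∘ π is zero. -/
theorem linIdeal_le_span_linForm [Infinite K] (W : Submodule K (Fin 4 → K)) :
    linIdeal W ≤ Ideal.span {g | ∃ φ : (Fin 4 → K) →ₗ[K] K, (∀ v ∈ W, φ v = 0) ∧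
      g = linForm φ} := by
  obtain ⟨π, h1, h2⟩ := exists_projection W
  have key : ∀ f : Coord K, f - linSubst π f ∈ Ideal.span {g | ∃ φ : (Fin 4 → K) →ₗ[K] K,
      (∀ v ∈ W, φ v = 0) ∧ g = linForm φ} := by
    intro f
    induction f using MvPolynomial.induction_on with
    | C a => simp [linSubst]
    | add p q hp hq =>
      have := Ideal.add_mem _ hp hq
      convert this using 1
      rw [map_add]; ring
    | mul_X p i hp =>
      have hX : X i - linSubst π (X i) ∈ Ideal.span {g | ∃ φ : (Fin 4 → K) →ₗ[K] K,
          (∀ v ∈ W, φ v = 0) ∧ g = linForm φ} := by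
        refine Ideal.subset_span ⟨LinearMap.proj i - LinearMap.proj i ∘ₗ π, fun v hv => ?_, ?_⟩
        · simp [h2 v hv]
        · refine MvPolynomial.funext fun v => ?_
          simp [eval_linSubst]
      have := Ideal.add_mem _ (Ideal.mul_mem_right (X i) _ hp)
        (Ideal.mul_mem_left _ (linSubst π p) hX)
      convert this using 1
      rw [map_mul]; ring
  intro f hf
  have h0 : linSubst π f = 0 := MvPolynomial.funext fun v => by
    rw [eval_linSubst, mem_linIdeal.1 hf _ (h1 v), map_zero]
  have := key f
  rwa [h0, sub_zero] at this

theorem eval_pderiv_eq_zero_of_mem_sq {W : Submodule K (Fin 4 → K)} {F : Coord K}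
    (hF : F ∈ linIdeal W ^ 2) {v : Fin 4 → K} (hv : v ∈ W) (i : Fin 4) :
    eval v (pderiv i F) = 0 := by
  rw [pow_two] at hF
  refine Submodule.mul_induction_on hF (fun a ha b hb => ?_) fun x y hx hy => by
    rw [map_add, map_add, hx, hy, add_zero]
  simp [mem_linIdeal.1 ha v hv, mem_linIdeal.1 hb v hv]

end LinearIdeals

/-! ### Local containment of ideals and saturation. -/

section Local

open MvPolynomial

/-- Locally at `v`, the ideal `I` is contained in the ideal `J`. -/
def LocLE (v : Fin 4 → K) (I J : Ideal (Coord K)) : Prop :=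
  ∀ f ∈ I, ∃ g, eval v g ≠ 0 ∧ g * f ∈ J

theorem LocLE.of_le {v : Fin 4 → K} {I J : Ideal (Coord K)} (h : I ≤ J) : LocLE v I J :=
  fun f hf => ⟨1, by simp, by simpa using h hf⟩

theorem LocLE.trans {v : Fin 4 → K} {I J H : Ideal (Coord K)} (h : LocLE v I J)
    (h' : LocLE v J H) : LocLE v I H := fun f hf => by
  obtain ⟨g, hg, hgf⟩ := h f hf
  obtain ⟨g', hg', hgf'⟩ := h' _ hgf
  exact ⟨g' * g, by simp [hg, hg'], by rwa [mul_assoc]⟩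

theorem LocLE.sup {v : Fin 4 → K} {I J H : Ideal (Coord K)} (h : LocLE v I H)
    (h' : LocLE v J H) : LocLE v (I ⊔ J) H := fun f hf => by
  obtain ⟨a, ha, b, hb, rfl⟩ := Submodule.mem_sup.1 hf
  obtain ⟨g, hg, hgf⟩ := h a ha
  obtain ⟨g', hg', hgf'⟩ := h' b hb
  refine ⟨g' * g, by simp [hg, hg'], ?_⟩
  have := H.add_mem (H.mul_mem_left g' hgf) (H.mul_mem_left g hgf')
  convert this using 1
  ring

theorem LocLE.of_eval_ne_zero {v : Fin 4 → K} {I J : Ideal (Coord K)} {g : Coord K}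
    (hg : g ∈ J) (h : eval v g ≠ 0) : LocLE v I J :=
  fun _ _ => ⟨g, h, J.mul_mem_right _ hg⟩

/-- For each v ≠ 0 the product of the denominators for a finite set of generators of I lies in the
colon ideal of J by I and does not vanish at v. So the colon ideal has no zero except possibly the
origin, and its radical contains the irrelevant ideal by the Nullstellensatz. -/
theorem exists_irrelevantIdeal_pow_mul_le [IsAlgClosed K] {I J : Ideal (Coord K)}
    (h : ∀ v : Fin 4 → K, v ≠ 0 → LocLE v I J) : ∃ n, irrelevantIdeal K ^ n * I ≤ J := by
  have hfg : I.FG := IsNoetherian.noetherian I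
  obtain ⟨S, hS⟩ := hfg
  have hcol : irrelevantIdeal K ≤ (Submodule.colon J (I : Set (Coord K))).radical := by
    rw [← vanishingIdeal_zeroLocus_eq_radical (K := K), irrelevantIdeal, Ideal.span_le]
    rintro _ ⟨i, rfl⟩
    rw [SetLike.mem_coe, mem_vanishingIdeal_iff]
    intro v hv
    by_cases hv0 : v = 0
    · simp [hv0]
    exfalso
    classical
    choose! g hg hgf using fun f (hf : f ∈ I) => h v hv0 f hf
    have hSI : ∀ f ∈ S, f ∈ I := fun f hf => hS ▸ Submodule.subset_span hf
    have hmem : ∏ f ∈ S, g f ∈ Submodule.colon J (I : Set (Coord K)) := by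
      rw [← hS, Submodule.colon_span, Submodule.mem_colon]
      intro f hf
      rw [smul_eq_mul, ← Finset.mul_prod_erase S g hf, mul_comm (g f), mul_assoc]
      exact J.mul_mem_left _ (hgf f (hSI f hf))
    have := hv _ hmem
    rw [map_prod, Finset.prod_eq_zero_iff] at this
    obtain ⟨f, hf, hf0⟩ := this
    exact hg f (hSI f hf) (by simpa using hf0)
  obtain ⟨n, hn⟩ := Ideal.exists_pow_le_of_le_radical_of_fg hcol
    (IsNoetherian.noetherian (irrelevantIdeal K))
  refine ⟨n, Ideal.mul_le.2 fun a ha b hb => ?_⟩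
  exact Submodule.mem_colon.1 (hn ha) b hb

theorem sameSubscheme_of_locLE [IsAlgClosed K] {I J : Ideal (Coord K)}
    (h : ∀ v : Fin 4 → K, v ≠ 0 → LocLE v I J ∧ LocLE v J I) : SameSubscheme I J := by
  obtain ⟨n, hn⟩ := exists_irrelevantIdeal_pow_mul_le fun v hv => (h v hv).1
  obtain ⟨n', hn'⟩ := exists_irrelevantIdeal_pow_mul_le fun v hv => (h v hv).2
  refine ⟨n + n', le_trans ?_ hn, le_trans ?_ hn'⟩
  · exact Ideal.mul_mono_left (Ideal.pow_le_pow_right (by omega))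
  · exact Ideal.mul_mono_left (Ideal.pow_le_pow_right (by omega))

end Local

end QuadricReduction

namespace QuadricReduction

variable {K : Type*} [Field K]

/-! ### The polar form, and transversal lines. -/

section Quadric

open MvPolynomial

/-- Identities that are linear in F then need to be checked for products of two coordinates only. -/
theorem mem_span_X_mul_X {F : Coord K} (hF : F.IsHomogeneous 2) :
    F ∈ Submodule.span K {G : Coord K | ∃ i j, G = X i * X j} := by
  rw [F.as_sum]
  refine Submodule.sum_mem _ fun d hd => ?_
  have hdeg : d.degree = 2 := by
    by_contra hne
    exact (mem_support_iff.1 hd) (hF.coeff_eq_zero hne)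
  have hd0 : d ≠ 0 := by
    rintro rfl
    simp at hdeg
  obtain ⟨i, hi⟩ := Finsupp.ne_iff.1 hd0
  have hi' : Finsupp.single i 1 ≤ d := by
    rw [Finsupp.single_le_iff]
    exact Nat.one_le_iff_ne_zero.2 hi
  obtain ⟨e, rfl⟩ := exists_add_of_le hi'
  have he : e.degree = 1 := by
    rw [map_add, Finsupp.degree_single] at hdeg
    omega
  have he' : e ∈ Set.range fun a : Fin 4 => Finsupp.single a 1 := by
    rw [Finsupp.range_single_one]
    exact he
  obtain ⟨j, rfl⟩ := he'
  have : monomial (Finsupp.single i 1 + Finsupp.single j 1)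
      (coeff (Finsupp.single i 1 + Finsupp.single j 1) F) =
      (coeff (Finsupp.single i 1 + Finsupp.single j 1) F) • (X i * X j : Coord K) := by
    rw [X, X, monomial_mul, smul_monomial]
    simp
  rw [this]
  exact Submodule.smul_mem _ _ (Submodule.subset_span ⟨i, j, rfl⟩)

/-- The differential of `F` at `v`, i.e. the linear functional `B(v, ·)` where `B` is the
polar form of `F`. -/
noncomputable def polarForm (F : Coord K) (v : Fin 4 → K) : (Fin 4 → K) →ₗ[K] K :=
  ∑ i, eval v (pderiv i F) • LinearMap.proj i

theorem polarForm_apply (F : Coord K) (v w : Fin 4 → K) :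
    polarForm F v w = ∑ i, eval v (pderiv i F) * w i := by
  simp [polarForm]

/-- This expansion avoids division by two, so characteristic two needs no separate treatment. -/
theorem eval_add_eq {F : Coord K} (hF : F.IsHomogeneous 2) (v w : Fin 4 → K) :
    eval (v + w) F = eval v F + polarForm F v w + eval w F := by
  rw [polarForm_apply]
  have h := mem_span_X_mul_X hF
  clear hF
  induction h using Submodule.span_induction with
  | mem x h =>
    obtain ⟨i, j, rfl⟩ := h
    simp [pderiv_X, Pi.single_apply, Finset.sum_add_distrib, add_mul, apply_ite (eval v)]
    ring
  | zero => simp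
  | add x y hx hy h1 h2 =>
    simp only [map_add, h1, h2, add_mul, Finset.sum_add_distrib]
    ring
  | smul a x hx h =>
    simp only [smul_eval, h, mul_add, Derivation.map_smul, Finset.mul_sum, mul_assoc]

theorem eval_smul_eq {F : Coord K} (hF : F.IsHomogeneous 2) (c : K) (v : Fin 4 → K) :
    eval (c • v) F = c ^ 2 * eval v F := by
  have h := mem_span_X_mul_X hF
  clear hF
  induction h using Submodule.span_induction with
  | mem x h =>
    obtain ⟨i, j, rfl⟩ := h
    simp
    ring
  | zero => simp
  | add x y hx hy h1 h2 => simp only [map_add, h1, h2, mul_add]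
  | smul a x hx h =>
    simp only [smul_eval, h]
    ring

theorem polarForm_comm {F : Coord K} (hF : F.IsHomogeneous 2) (v w : Fin 4 → K) :
    polarForm F v w = polarForm F w v := by
  have h1 := eval_add_eq hF v w
  have h2 := eval_add_eq hF w v
  rw [add_comm w v, h1] at h2
  linear_combination h2

theorem eval_add_smul_eq {F : Coord K} (hF : F.IsHomogeneous 2) (a b : K) (v w : Fin 4 → K) :
    eval (a • v + b • w) F = a ^ 2 * eval v F + a * b * polarForm F v w + b ^ 2 * eval w F := by
  rw [eval_add_eq hF, eval_smul_eq hF, eval_smul_eq hF, map_smul, polarForm_comm hF, map_smul,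
    polarForm_comm hF w v, smul_eq_mul, smul_eq_mul]
  ring

theorem polarForm_self {F : Coord K} (hF : F.IsHomogeneous 2) {v : Fin 4 → K}
    (hv : eval v F = 0) : polarForm F v v = 0 := by
  have h := eval_add_eq hF v v
  rw [← two_smul K v, eval_smul_eq hF, hv] at h
  linear_combination -h

theorem IsSmoothQuadric.exists_polarForm_ne_zero {F : Coord K} (hF : IsSmoothQuadric F)
    {v : Fin 4 → K} (hv0 : v ≠ 0) (hv : eval v F = 0) : ∃ w, polarForm F v w ≠ 0 := by
  obtain ⟨i, hi⟩ := hF.2 v hv0 hv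
  refine ⟨Pi.single i 1, ?_⟩
  rw [polarForm_apply]
  simpa [Pi.single_apply] using hi

theorem vanishesOn_iff_mem {F : Coord K} {W : Submodule K (Fin 4 → K)} :
    VanishesOn F W ↔ F ∈ linIdeal W := mem_linIdeal.symm

theorem VanishesOn.mono {F : Coord K} {U W : Submodule K (Fin 4 → K)} (h : VanishesOn F W)
    (hle : U ≤ W) : VanishesOn F U := fun v hv => h v (hle hv)

/-- By the product rule all partial derivatives of an element of the square vanish on W, against the
Jacobian criterion. -/
theorem IsSmoothQuadric.notMem_sq {F : Coord K} (hF : IsSmoothQuadric F)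
    {W : Submodule K (Fin 4 → K)} (hW : W ≠ ⊥) : F ∉ linIdeal W ^ 2 := by
  intro h
  obtain ⟨v, hv, hv0⟩ := W.ne_bot_iff.1 hW
  obtain ⟨i, hi⟩ := hF.2 v hv0 (mem_linIdeal.1 (Ideal.pow_le_self two_ne_zero h) v hv)
  exact hi (eval_pderiv_eq_zero_of_mem_sq h hv i)

theorem Line.ne_bot (L : Line K) : L.1 ≠ ⊥ := by
  intro h
  have := L.2
  rw [h, finrank_bot] at this
  omega

theorem Pt.finrank_eq (p : Pt K) : Module.finrank K p.submodule = 1 :=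
  p.finrank_submodule

theorem Pt.ne_bot (p : Pt K) : p.submodule ≠ ⊥ := by
  intro h
  have := p.finrank_submodule
  rw [h, finrank_bot] at this
  omega

theorem Pt.rep_mem (p : Pt K) : p.rep ∈ p.submodule := by
  rw [Projectivization.submodule_eq]
  exact Submodule.mem_span_singleton_self _

theorem Pt.submodule_le_iff {p : Pt K} {W : Submodule K (Fin 4 → K)} {v : Fin 4 → K}
    (hv : v ≠ 0) (hvp : v ∈ p.submodule) : p.submodule ≤ W ↔ v ∈ W := by
  refine ⟨fun h => h hvp, fun h => ?_⟩
  have : K ∙ v = p.submodule := by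
    refine Submodule.eq_of_le_of_finrank_eq ((Submodule.span_singleton_le_iff_mem _ _).2 hvp) ?_
    rw [finrank_span_singleton hv, p.finrank_submodule]
  rw [← this]
  exact (Submodule.span_singleton_le_iff_mem _ _).2 h

theorem Pt.eq_of_le {p p' : Pt K} (h : p.submodule ≤ p'.submodule) : p = p' := by
  apply Projectivization.submodule_injective
  exact Submodule.eq_of_le_of_finrank_eq h (by rw [Pt.finrank_eq, Pt.finrank_eq])

theorem Pt.eq_of_mem {p p' : Pt K} {v : Fin 4 → K} (hv : v ≠ 0) (h : v ∈ p.submodule)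
    (h' : v ∈ p'.submodule) : p = p' :=
  Pt.eq_of_le ((Pt.submodule_le_iff hv h).2 h')

theorem Pt.eq_submodule_of_le {p : Pt K} {W : Submodule K (Fin 4 → K)}
    (hW : Module.finrank K W = 1) (h : p.submodule ≤ W) : p.submodule = W :=
  Submodule.eq_of_le_of_finrank_eq h (by rw [Pt.finrank_eq, hW])

theorem Pt.exists_of_finrank_eq_one {W : Submodule K (Fin 4 → K)}
    (hW : Module.finrank K W = 1) : ∃ p : Pt K, p.submodule = W := by
  obtain ⟨v, hv, hv0⟩ := W.ne_bot_iff.1 (by rintro rfl; simp at hW)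
  refine ⟨.mk K v hv0, Submodule.eq_of_le_of_finrank_eq ?_ (by rw [Pt.finrank_eq, hW])⟩
  rw [Projectivization.submodule_mk]
  exact (Submodule.span_singleton_le_iff_mem _ _).2 hv

theorem Pt.disjoint_iff {p : Pt K} {W : Submodule K (Fin 4 → K)} :
    Disjoint p.submodule W ↔ ¬ p.submodule ≤ W := by
  refine ⟨fun h h' => p.ne_bot ?_, fun h => ?_⟩
  · exact disjoint_self.1 (h.mono_right h')
  · rw [Submodule.disjoint_def]
    intro v hv hvW
    by_contra hv0
    exact h ((Pt.submodule_le_iff hv0 hv).2 hvW)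

theorem Pt.vanishesOn_iff {F : Coord K} (hF : F.IsHomogeneous 2) {p : Pt K} {v : Fin 4 → K}
    (hv : v ≠ 0) (hvp : v ∈ p.submodule) : VanishesOn F p.submodule ↔ eval v F = 0 := by
  refine ⟨fun h => h v hvp, fun h w hw => ?_⟩
  have := (Pt.submodule_le_iff (W := K ∙ v) hv hvp).2 (Submodule.mem_span_singleton_self v) hw
  obtain ⟨c, rfl⟩ := Submodule.mem_span_singleton.1 this
  rw [eval_smul_eq hF, h, mul_zero]

theorem Line.eq_of_le {L L' : Line K} (h : L.1 ≤ L'.1) : L = L' :=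
  Subtype.ext (Submodule.eq_of_le_of_finrank_eq h (by rw [L.2, L'.2]))

theorem Line.span_pair_eq {L : Line K} {v w : Fin 4 → K} (hv : v ∈ L.1) (hw : w ∈ L.1)
    (h : LinearIndependent K ![v, w]) : Submodule.span K {v, w} = L.1 := by
  refine Submodule.eq_of_le_of_finrank_eq (Submodule.span_le.2 ?_) ?_
  · rintro x (rfl | rfl) <;> assumption
  · have := finrank_span_eq_card h
    rw [Matrix.range_cons_cons_empty, Fintype.card_fin] at this
    rw [this, L.2]

theorem Pt.linearIndependent_pair {p p' : Pt K} (h : p ≠ p') {v w : Fin 4 → K} (hv : v ≠ 0)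
    (hvp : v ∈ p.submodule) (hw : w ≠ 0) (hwp : w ∈ p'.submodule) :
    LinearIndependent K ![v, w] := by
  rw [LinearIndependent.pair_iff' hv]
  rintro a rfl
  exact h (Pt.eq_of_mem hw (p.submodule.smul_mem a hvp) hwp)

/-- If two points of `L` lie on the quadric and their polar form is nonzero, then `L` meets
the quadric in these points only. -/
theorem Line.eq_or_eq_of_polarForm_ne_zero {F : Coord K} (hF : F.IsHomogeneous 2) {L : Line K}
    {v w : Fin 4 → K} (hv : v ∈ L.1) (hw : w ∈ L.1) (hFv : eval v F = 0) (hFw : eval w F = 0)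
    (h : LinearIndependent K ![v, w]) (hB : polarForm F v w ≠ 0) {u : Fin 4 → K} (hu : u ∈ L.1)
    (hFu : eval u F = 0) : (∃ a : K, u = a • v) ∨ ∃ a : K, u = a • w := by
  rw [← Line.span_pair_eq hv hw h, Submodule.mem_span_pair] at hu
  obtain ⟨a, b, rfl⟩ := hu
  rw [eval_add_smul_eq hF, hFv, hFw] at hFu
  have : a * b = 0 := by
    have : a * b * polarForm F v w = 0 := by linear_combination hFu
    simpa [hB] using this
  rcases mul_eq_zero.1 this with rfl | rfl
  · exact Or.inr ⟨b, by simp⟩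
  · exact Or.inl ⟨a, by simp⟩

/-- In coordinates a, b along v and w, the restriction of F to L is a b B(v, w). -/
theorem Transversal.polarForm_ne_zero {F : Coord K} (hF : F.IsHomogeneous 2) {L : Line K}
    (hL : ¬ VanishesOn F L.1) {v w : Fin 4 → K} (hv : v ∈ L.1) (hw : w ∈ L.1)
    (hFv : eval v F = 0) (hFw : eval w F = 0) (h : LinearIndependent K ![v, w]) :
    polarForm F v w ≠ 0 := by
  intro h0
  apply hL
  intro u hu
  rw [← Line.span_pair_eq hv hw h, Submodule.mem_span_pair] at hu
  obtain ⟨a, b, rfl⟩ := hu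
  rw [eval_add_smul_eq hF, hFv, hFw, h0]
  ring

theorem Transversal.eq_or_eq {F : Coord K} (hF : F.IsHomogeneous 2) {L : Line K}
    (hL : Transversal F L) {p p' p'' : Pt K} (hne : p ≠ p') (hp : p.submodule ≤ L.1)
    (hp' : p'.submodule ≤ L.1) (hp'' : p''.submodule ≤ L.1) (hFp : VanishesOn F p.submodule)
    (hFp' : VanishesOn F p'.submodule) (hFp'' : VanishesOn F p''.submodule) :
    p'' = p ∨ p'' = p' := by
  have hind := Pt.linearIndependent_pair hne p.rep_nonzero p.rep_mem p'.rep_nonzero p'.rep_mem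
  have hB := Transversal.polarForm_ne_zero hF hL.1 (hp p.rep_mem) (hp' p'.rep_mem)
    (hFp _ p.rep_mem) (hFp' _ p'.rep_mem) hind
  rcases Line.eq_or_eq_of_polarForm_ne_zero hF (hp p.rep_mem) (hp' p'.rep_mem)
    (hFp _ p.rep_mem) (hFp' _ p'.rep_mem) hind hB (hp'' p''.rep_mem) (hFp'' _ p''.rep_mem)
    with ⟨a, ha⟩ | ⟨a, ha⟩
  · exact Or.inl (Pt.eq_of_mem p''.rep_nonzero p''.rep_mem
      (ha ▸ p.submodule.smul_mem a p.rep_mem))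
  · exact Or.inr (Pt.eq_of_mem p''.rep_nonzero p''.rep_mem
      (ha ▸ p'.submodule.smul_mem a p'.rep_mem))

/-- A transversal line meets the quadric in a second point. -/
theorem Transversal.exists_other {F : Coord K} {L : Line K}
    (hL : Transversal F L) (p : Pt K) : ∃ p' : Pt K, p' ≠ p ∧ p'.submodule ≤ L.1 ∧
      VanishesOn F p'.submodule := by
  obtain ⟨-, x, y, hxy, hx, hy, hFx, hFy⟩ := hL
  by_cases h : x = p
  · exact ⟨y, h ▸ hxy.symm, hy, hFy⟩
  · exact ⟨x, h, hx, hFx⟩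

theorem exists_linear_eq_one_eq_zero {v w : Fin 4 → K} (h : LinearIndependent K ![v, w]) :
    ∃ φ : (Fin 4 → K) →ₗ[K] K, φ v = 1 ∧ φ w = 0 := by
  have hvw : v ∉ K ∙ w := by
    intro hmem
    obtain ⟨c, hc⟩ := Submodule.mem_span_singleton.1 hmem
    have := LinearIndependent.pair_iff.1 h 1 (-c) (by simp [hc])
    simp at this
  obtain ⟨φ, h1, h2⟩ := Submodule.exists_le_ker_of_notMem hvw
  refine ⟨(φ v)⁻¹ • φ, by simp [h1], ?_⟩
  have := h2 (Submodule.mem_span_singleton_self w)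
  simp only [LinearMap.mem_ker] at this
  simp [this]

/-- Locally at a point `p` of a transversal line `L` on the quadric, the ideal of `p` is
generated by the equation of the quadric and the ideal of `L`. -/
theorem Transversal.exists_mul_mem [Infinite K] {F : Coord K} (hF : F.IsHomogeneous 2)
    {L : Line K} (hL : Transversal F L) {p : Pt K} (hp : p.submodule ≤ L.1)
    (hFp : VanishesOn F p.submodule) {v : Fin 4 → K} (hv : v ≠ 0) (hvp : v ∈ p.submodule) :
    ∃ α : Coord K, eval v α ≠ 0 ∧ ∀ f ∈ linIdeal p.submodule,
      α * f ∈ Ideal.span {F} ⊔ linIdeal L.1 := by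
  obtain ⟨p', hne, hp', hFp'⟩ := hL.exists_other p
  set w := p'.rep
  have hind := Pt.linearIndependent_pair hne.symm hv hvp p'.rep_nonzero p'.rep_mem
  have hB := Transversal.polarForm_ne_zero hF hL.1 (hp hvp) (hp' p'.rep_mem)
    (hFp _ hvp) (hFp' _ p'.rep_mem) hind
  -- The denominator is a linear form that does not vanish at p but vanishes at the second point of
  -- L on the quadric.
  obtain ⟨φ, h1, h2⟩ := exists_linear_eq_one_eq_zero hind
  refine ⟨linForm φ, by simp [h1], fun f hf => ?_⟩
  have h := linIdeal_le_span_linForm _ hf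
  clear hf
  induction h using Submodule.span_induction with
  | mem x h =>
    obtain ⟨χ, hχ, rfl⟩ := h
    rw [Submodule.mem_sup]
    -- On L, with coordinates a, b along v and w, one has φ = a, χ = b χ(w) and F = a b B(v, w).
    -- Subtracting this multiple of F therefore leaves a form that vanishes on L.
    refine ⟨C (χ w / polarForm F v w) * F,
      Ideal.mul_mem_left _ _ (Ideal.subset_span rfl),
      linForm φ * linForm χ - C (χ w / polarForm F v w) * F, ?_, by ring⟩
    rw [mem_linIdeal]
    intro u hu
    rw [← Line.span_pair_eq (hp hvp) (hp' p'.rep_mem) hind, Submodule.mem_span_pair] at hu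
    obtain ⟨a, b, rfl⟩ := hu
    have h3 : χ v = 0 := hχ v hvp
    have h4 : eval v F = 0 := hFp v hvp
    have h5 : eval w F = 0 := hFp' _ p'.rep_mem
    have h6 : φ w = 0 := h2
    have e1 : eval (a • v + b • w) F = a * b * polarForm F v w := by
      rw [eval_add_smul_eq hF, h4, h5]; ring
    change eval (a • v + b • w) _ = 0
    simp only [map_sub, map_mul, eval_linForm, map_add, map_smul, smul_eq_mul, h1, h3, h6, eval_C,
      e1]
    have hB' : polarForm F v w ≠ 0 := hB
    field_simp
    ring
  | zero => simp
  | add x y _ _ hx hy =>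
    rw [mul_add]
    exact Ideal.add_mem _ hx hy
  | smul a x _ hx =>
    rw [smul_eq_mul, mul_left_comm]
    exact Ideal.mul_mem_left _ _ hx

end Quadric

end QuadricReduction

namespace QuadricReduction

variable {K : Type*} [Field K]

/-! ### Bijections for counting indices. -/

section Counting

/-- The elements of `Fin n` below `l`. -/
def finLtEquiv {n l : ℕ} (h : l ≤ n) : {i : Fin n // i.val < l} ≃ Fin l where
  toFun i := ⟨i.1.1, i.2⟩
  invFun i := ⟨⟨i.1, by omega⟩, i.2⟩
  left_inv _ := rfl
  right_inv _ := rfl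

/-- The elements of `Fin n` that are at least `l`. -/
def finGeEquiv (n l : ℕ) : {i : Fin n // l ≤ i.val} ≃ Fin (n - l) where
  toFun i := ⟨i.1.1 - l, by omega⟩
  invFun i := ⟨⟨i.1 + l, by omega⟩, by simp⟩
  left_inv i := by ext; simp; omega
  right_inv i := by ext; simp

/-- The odd elements of `Fin n`. -/
def finOddEquiv (n : ℕ) : {i : Fin n // Odd i.val} ≃ Fin (n / 2) where
  toFun i := ⟨i.1.1 / 2, by obtain ⟨⟨i, hi⟩, k, hk⟩ := i; simp at hk ⊢; omega⟩
  invFun i := ⟨⟨2 * i.1 + 1, by omega⟩, by simp⟩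
  left_inv i := by obtain ⟨⟨i, hi⟩, k, hk⟩ := i; ext; simp at hk ⊢; omega
  right_inv i := by ext; simp; omega

/-- The even elements of `Fin n`. -/
def finEvenEquiv (n : ℕ) : {i : Fin n // Even i.val} ≃ Fin (n - n / 2) where
  toFun i := ⟨i.1.1 / 2, by obtain ⟨⟨i, hi⟩, k, hk⟩ := i; simp at hk ⊢; omega⟩
  invFun i := ⟨⟨2 * i.1, by omega⟩, by simp⟩
  left_inv i := by obtain ⟨⟨i, hi⟩, k, hk⟩ := i; ext; simp at hk ⊢; omega
  right_inv i := by ext; simp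

end Counting

/-! ### Lines and nodes of a specialization, sorted by their position relative to the quadric. -/

namespace SpecConfig

variable {r s q z u w : ℕ}

/-- `L` is one of the lines of the component `a` that do not lie on the quadric. -/
def OffAt (Z : SpecConfig K r s q z u w) (l ls : ℕ) : SpecPart r s q z u → Line K → Prop
  | .old .fat, _ => False
  | .old (.line i), L => l ≤ i.val ∧ L = Z.line i
  | .old (.cross i), L => L = Z.cross i 0 ∨ (ls ≤ i.val ∧ L = Z.cross i 1)
  | .old (.point _), _ => False
  | .old .zig, L => ∃ j, Even j.val ∧ L = Z.zig j
  | .sundial i, L => ∃ j, L = Z.sundial i j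
  | .zz, L => ∃ j, L = Z.zz j

/-- `L` is one of the reduced lines of the component `a` that belong to the ruling. -/
def RedAt (Z : SpecConfig K r s q z u w) (l ls : ℕ) : SpecPart r s q z u → Line K → Prop
  | .old .fat, _ => False
  | .old (.line i), L => i.val < l ∧ L = Z.line i
  | .old (.cross i), L => i.val < ls ∧ L = Z.cross i 1
  | .old (.point _), _ => False
  | .old .zig, L => ∃ j, Odd j.val ∧ L = Z.zig j
  | .sundial _, _ => False
  | .zz, _ => False

/-- `p` is a singular point of the component `a`, which is a sundial or a zig-zag. -/
def NodeAt (Z : SpecConfig K r s q z u w) : SpecPart r s q z u → Pt K → Prop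
  | .old _, _ => False
  | .sundial i, p => p.submodule ≤ (Z.sundial i 0).1 ⊓ (Z.sundial i 1).1
  | .zz, p => ∃ i j : Fin w, i.val + 1 = j.val ∧ p.submodule ≤ (Z.zz i).1 ⊓ (Z.zz j).1

section Basic

variable {Z : SpecConfig K r s q z u w} {l ls : ℕ}

theorem OffAt.mem_allPieces {a : SpecPart r s q z u} {L : Line K} (h : Z.OffAt l ls a L) :
    L.1 ∈ Z.allPieces a := by
  match a, h with
  | .old (.line i), h => exact congrArg _ h.2
  | .old (.cross i), .inl h => exact ⟨0, h ▸ rfl⟩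
  | .old (.cross i), .inr h => exact ⟨1, h.2 ▸ rfl⟩
  | .old .zig, ⟨j, _, h⟩ => exact ⟨j, h ▸ rfl⟩
  | .sundial i, ⟨j, h⟩ => exact ⟨j, h ▸ rfl⟩
  | .zz, ⟨j, h⟩ => exact ⟨j, h ▸ rfl⟩

theorem RedAt.mem_allPieces {a : SpecPart r s q z u} {L : Line K} (h : Z.RedAt l ls a L) :
    L.1 ∈ Z.allPieces a := by
  match a, h with
  | .old (.line i), h => exact congrArg _ h.2
  | .old (.cross i), h => exact ⟨1, h.2 ▸ rfl⟩
  | .old .zig, ⟨j, _, h⟩ => exact ⟨j, h ▸ rfl⟩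

theorem NodeAt.exists_mem_allPieces {a : SpecPart r s q z u} {p : Pt K} (h : Z.NodeAt a p) :
    ∃ U ∈ Z.allPieces a, p.submodule ≤ U := by
  match a, h with
  | .sundial i, h => exact ⟨_, ⟨0, rfl⟩, h.trans inf_le_left⟩
  | .zz, ⟨i, _, _, h⟩ => exact ⟨_, ⟨i, rfl⟩, h.trans inf_le_left⟩

/-- A point on two components would be a nonzero subspace in two disjoint ones. Every local question
at a point thereby concerns a single component. -/
theorem IsSpecialization.owner_unique {F : Coord K} {ℛ : Set (Line K)} {δ t : ℕ}
    (hZ : Z.IsSpecialization F ℛ δ l ls t) {a b : SpecPart r s q z u}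
    {U W : Submodule K (Fin 4 → K)} (hU : U ∈ Z.allPieces a) (hW : W ∈ Z.allPieces b) {p : Pt K}
    (hpU : p.submodule ≤ U) (hpW : p.submodule ≤ W) : a = b := by
  by_contra hab
  exact p.ne_bot (disjoint_self.1 ((hZ.disjoint a b hab U hU W hW).mono hpU hpW))

variable {F : Coord K} {ℛ : Set (Line K)} {δ t : ℕ}

theorem IsSpecialization.transversal_of_offAt (hZ : Z.IsSpecialization F ℛ δ l ls t)
    {a : SpecPart r s q z u} {L : Line K} (h : Z.OffAt l ls a L) : Transversal F L := by
  match a, h with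
  | .old (.line i), h => exact h.2 ▸ hZ.line_off i h.1
  | .old (.cross i), .inl h => exact h ▸ hZ.cross_off_zero i
  | .old (.cross i), .inr h => exact h.2 ▸ (hZ.cross_off i h.1).1
  | .old .zig, ⟨j, hj, h⟩ => exact h ▸ hZ.zig_off j hj
  | .sundial i, ⟨j, h⟩ => exact h ▸ hZ.sundial_off i j
  | .zz, ⟨j, h⟩ => exact h ▸ hZ.zz_off j

theorem IsSpecialization.mem_ruling_of_redAt (hZ : Z.IsSpecialization F ℛ δ l ls t)
    {a : SpecPart r s q z u} {L : Line K} (h : Z.RedAt l ls a L) : L ∈ ℛ := by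
  match a, h with
  | .old (.line i), h => exact h.2 ▸ hZ.line_on i h.1
  | .old (.cross i), h => exact h.2 ▸ hZ.cross_on i h.1
  | .old .zig, ⟨j, hj, h⟩ => exact h ▸ hZ.zig_on j hj

theorem IsSpecialization.vanishesOn_of_nodeAt (hZ : Z.IsSpecialization F ℛ δ l ls t)
    {a : SpecPart r s q z u} {p : Pt K} (h : Z.NodeAt a p) : VanishesOn F p.submodule := by
  match a, h with
  | .sundial i, h => exact (hZ.sundial_node i).mono h
  | .zz, ⟨i, j, hij, h⟩ => exact (hZ.zz_node i j hij).mono h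

/-- Lines of a chain whose indices differ by two or more are disjoint, so no third line of the chain
passes through a node. -/
theorem IsSpecialization.exists_offAt_of_nodeAt (hZ : Z.IsSpecialization F ℛ δ l ls t)
    {a : SpecPart r s q z u} {p : Pt K} (h : Z.NodeAt a p) : ∃ L L', Z.OffAt l ls a L ∧
      Z.OffAt l ls a L' ∧ p.submodule ≤ L.1 ∧ p.submodule ≤ L'.1 ∧
      ∀ L'', Z.OffAt l ls a L'' → p.submodule ≤ L''.1 → L'' = L ∨ L'' = L' := by
  match a, h with
  | .sundial i, h =>
    refine ⟨_, _, ⟨0, rfl⟩, ⟨1, rfl⟩, h.trans inf_le_left, h.trans inf_le_right, ?_⟩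
    rintro _ ⟨j, rfl⟩ _
    fin_cases j
    · exact Or.inl rfl
    · exact Or.inr rfl
  | .zz, ⟨i, j, hij, h⟩ =>
    refine ⟨_, _, ⟨i, rfl⟩, ⟨j, rfl⟩, h.trans inf_le_left, h.trans inf_le_right, ?_⟩
    rintro _ ⟨k, rfl⟩ hk
    have hd : ∀ i j : Fin w, p.submodule ≤ (Z.zz i).1 → p.submodule ≤ (Z.zz j).1 →
        ¬ i.val + 1 < j.val := fun i j hi hj hlt =>
      p.ne_bot (disjoint_self.1 ((hZ.zz_chain.2 i j hlt).mono hi hj))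
    have h1 := hd i k (h.trans inf_le_left) hk
    have h2 := hd j k (h.trans inf_le_right) hk
    have h3 := hd k i hk (h.trans inf_le_left)
    have h4 := hd k j hk (h.trans inf_le_right)
    have : k = i ∨ k = j := by
      rw [Fin.ext_iff, Fin.ext_iff]
      omega
    rcases this with rfl | rfl
    · exact Or.inl rfl
    · exact Or.inr rfl

theorem not_redAt_of_nodeAt {a : SpecPart r s q z u} {p : Pt K} (h : Z.NodeAt a p) (L : Line K) :
    ¬ Z.RedAt l ls a L := by
  match a, h with
  | .sundial i, _ => exact id
  | .zz, _ => exact id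

/-- A component with a line in the ruling has at most one other line (a simple line or a cut cross),
or is the reduced zig-zag. There the other lines have even indices, which differ by at least two, so
they are disjoint. -/
theorem IsSpecialization.offAt_unique_of_redAt (hZ : Z.IsSpecialization F ℛ δ l ls t)
    {a : SpecPart r s q z u} {p : Pt K} {M L L' : Line K} (hM : Z.RedAt l ls a M)
    (hL : Z.OffAt l ls a L) (hL' : Z.OffAt l ls a L') (hp : p.submodule ≤ L.1)
    (hp' : p.submodule ≤ L'.1) : L = L' := by
  match a, hM with
  | .old (.line i), hM => rw [hL.2, hL'.2]
  | .old (.cross i), hM =>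
    rcases hL with hL | hL
    · rcases hL' with hL' | hL'
      · rw [hL, hL']
      · exact absurd hM.1 (not_lt.2 hL'.1)
    · exact absurd hM.1 (not_lt.2 hL.1)
  | .old .zig, hM =>
    obtain ⟨i, hi, rfl⟩ := hL
    obtain ⟨j, hj, rfl⟩ := hL'
    by_contra hne
    have hij : i.val ≠ j.val := fun h => hne (by rw [Fin.ext h])
    have hd : ∀ i j : Fin z, p.submodule ≤ (Z.zig i).1 → p.submodule ≤ (Z.zig j).1 →
        ¬ i.val + 1 < j.val := fun i j hi hj hlt =>
      p.ne_bot (disjoint_self.1 ((hZ.proper.zig_chain.2 i j hlt).mono hi hj))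
    have h1 := hd i j hp hp'
    have h2 := hd j i hp' hp
    grind

/-- The lines of an uncut cross meet off the quadric, the even lines of the reduced zig-zag are
disjoint, and in a sundial or in the new zig-zag two lines meet only in nodes. -/
theorem IsSpecialization.offAt_unique (hZ : Z.IsSpecialization F ℛ δ l ls t)
    {a : SpecPart r s q z u} {p : Pt K} (hFp : VanishesOn F p.submodule) {L L' : Line K}
    (hn : ¬ Z.NodeAt a p)
    (hL : Z.OffAt l ls a L) (hL' : Z.OffAt l ls a L') (hp : p.submodule ≤ L.1)
    (hp' : p.submodule ≤ L'.1) : L = L' := by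
  match a, hL with
  | .old (.line i), hL => rw [hL.2, hL'.2]
  | .old (.cross i), hL =>
    have hc : ls ≤ i.val → p.submodule ≤ (Z.cross i 0).1 → p.submodule ≤ (Z.cross i 1).1 →
        False := fun hi h0 h1 => by
      refine (hZ.cross_off i hi).2 ?_
      rw [← Pt.eq_submodule_of_le ((hZ.proper.cross_chain i).1 0 1 rfl) (le_inf h0 h1)]
      exact hFp
    rcases hL with rfl | ⟨hi, rfl⟩ <;> rcases hL' with rfl | ⟨hi', rfl⟩
    · rfl
    · exact (hc hi' hp hp').elim
    · exact (hc hi hp' hp).elim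
    · rfl
  | .old .zig, ⟨i, hi, hL⟩ =>
    subst hL
    obtain ⟨j, hj, rfl⟩ := hL'
    by_contra hne
    have hij : i.val ≠ j.val := fun h => hne (by rw [Fin.ext h])
    have hd : ∀ i j : Fin z, p.submodule ≤ (Z.zig i).1 → p.submodule ≤ (Z.zig j).1 →
        ¬ i.val + 1 < j.val := fun i j hi hj hlt =>
      p.ne_bot (disjoint_self.1 ((hZ.proper.zig_chain.2 i j hlt).mono hi hj))
    have h1 := hd i j hp hp'
    have h2 := hd j i hp' hp
    grind
  | .sundial i, ⟨j, hL⟩ =>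
    subst hL
    obtain ⟨j', rfl⟩ := hL'
    by_contra hne
    apply hn
    fin_cases j <;> fin_cases j'
    · exact absurd rfl hne
    · exact le_inf hp hp'
    · exact le_inf hp' hp
    · exact absurd rfl hne
  | .zz, ⟨i, hL⟩ =>
    subst hL
    obtain ⟨j, rfl⟩ := hL'
    by_contra hne
    have hij : i.val ≠ j.val := fun h => hne (by rw [Fin.ext h])
    have hd : ∀ i j : Fin w, p.submodule ≤ (Z.zz i).1 → p.submodule ≤ (Z.zz j).1 →
        ¬ i.val + 1 < j.val := fun i j hi hj hlt =>
      p.ne_bot (disjoint_self.1 ((hZ.zz_chain.2 i j hlt).mono hi hj))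
    have h1 := hd i j hp hp'
    have h2 := hd j i hp' hp
    rcases lt_or_gt_of_ne hij with h | h
    · exact hn ⟨i, j, by omega, le_inf hp hp'⟩
    · exact hn ⟨j, i, by omega, le_inf hp' hp⟩

/-- The equations are regrouped by position relative to the quadric, which is what residual scheme
and trace depend on. Each node is one point by the chain condition, so the ideals of intersections
become ideals of points. -/
theorem IsSpecialization.mem_specIdeal_iff (hZ : Z.IsSpecialization F ℛ δ l ls t) {m : ℕ}
    {f : Coord K} : f ∈ Z.specIdeal m ↔ f ∈ linIdeal Z.fat.1 ^ m ∧
      (∀ a L, Z.OffAt l ls a L → f ∈ linIdeal L.1) ∧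
      (∀ a L, Z.RedAt l ls a L → f ∈ linIdeal L.1) ∧
      (∀ i, f ∈ linIdeal (Z.point i).submodule) ∧
      ∀ a p, Z.NodeAt a p → f ∈ linIdeal p.submodule ^ 2 := by
  simp only [specIdeal, Config.ideal, zigzagIdeal, unionIdeal, Ideal.mem_inf, Ideal.mem_iInf]
  constructor
  · rintro ⟨⟨⟨⟨⟨⟨h1, h2⟩, h3⟩, h4⟩, h5⟩, h6⟩, h7, h8⟩
    refine ⟨h1, fun a L h => ?_, fun a L h => ?_, h4, fun a p h => ?_⟩
    · match a, h with
      | .old (.line i), h => exact h.2 ▸ h2 i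
      | .old (.cross i), .inl h => exact h ▸ h3 i 0
      | .old (.cross i), .inr h => exact h.2 ▸ h3 i 1
      | .old .zig, ⟨j, _, h⟩ => exact h ▸ h5 j
      | .sundial i, ⟨j, h⟩ => exact h ▸ (h6 i).1 j
      | .zz, ⟨j, h⟩ => exact h ▸ h7 j
    · match a, h with
      | .old (.line i), h => exact h.2 ▸ h2 i
      | .old (.cross i), h => exact h.2 ▸ h3 i 1
      | .old .zig, ⟨j, _, h⟩ => exact h ▸ h5 j
    · match a, h with
      | .sundial i, h =>
        rw [Pt.eq_submodule_of_le ((hZ.sundial_chain i).1 0 1 rfl) h]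
        exact (h6 i).2 0 1 rfl
      | .zz, ⟨i, j, hij, h⟩ =>
        rw [Pt.eq_submodule_of_le (hZ.zz_chain.1 i j hij) h]
        exact h8 i j hij
  · rintro ⟨h1, h2, h3, h4, h5⟩
    refine ⟨⟨⟨⟨⟨⟨h1, fun i => ?_⟩, fun i j => ?_⟩, h4⟩, fun i => ?_⟩,
      fun i => ⟨fun j => h2 (.sundial i) _ ⟨j, rfl⟩, fun j j' hj => ?_⟩⟩,
      fun j => h2 .zz _ ⟨j, rfl⟩, fun i j hij => ?_⟩
    · rcases lt_or_ge i.val l with h | h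
      · exact h3 (.old (.line i)) _ ⟨h, rfl⟩
      · exact h2 (.old (.line i)) _ ⟨h, rfl⟩
    · fin_cases j
      · exact h2 (.old (.cross i)) _ (.inl rfl)
      · rcases lt_or_ge i.val ls with h | h
        · exact h3 (.old (.cross i)) _ ⟨h, rfl⟩
        · exact h2 (.old (.cross i)) _ (.inr ⟨h, rfl⟩)
    · rcases Nat.even_or_odd i.val with h | h
      · exact h2 (.old .zig) _ ⟨i, h, rfl⟩
      · exact h3 (.old .zig) _ ⟨i, h, rfl⟩
    · obtain ⟨p, hp⟩ := Pt.exists_of_finrank_eq_one ((hZ.sundial_chain i).1 j j' hj)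
      rw [← hp]
      refine h5 (.sundial i) p ?_
      have hj0 : j = 0 := by ext; simp; omega
      have hj1 : j' = 1 := by ext; simp; omega
      subst hj0 hj1
      exact hp.le
    · obtain ⟨p, hp⟩ := Pt.exists_of_finrank_eq_one (hZ.zz_chain.1 i j hij)
      rw [← hp]
      exact h5 .zz p ⟨i, j, hij, hp.le⟩

end Basic

/-! ### The residual scheme. -/

section Residual

variable {Z : SpecConfig K r s q z u w} {l ls t δ : ℕ} {F : Coord K} {ℛ : Set (Line K)}

/-- The order of F is zero along transversal lines and points off the quadric, and exactly one along
lines of the ruling, so the conditions on f F translate component by component. -/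
theorem IsSpecialization.mem_residualIdeal_iff [Infinite K]
    (hZ : Z.IsSpecialization F ℛ δ l ls t) (hF : IsSmoothQuadric F) (hℛ : IsRuling F ℛ)
    (hδ : δ = 0 ∨ δ = 1) {m : ℕ} (hδm : δ ≤ m) {f : Coord K} :
    f ∈ residualIdeal F (Z.specIdeal m) ↔ f ∈ linIdeal Z.fat.1 ^ (m - δ) ∧
      (∀ a L, Z.OffAt l ls a L → f ∈ linIdeal L.1) ∧
      ∀ i, t ≤ i.val → f ∈ linIdeal (Z.point i).submodule := by
  rw [residualIdeal, Ideal.mem_colon_span_singleton, hZ.mem_specIdeal_iff]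
  have hfat : f * F ∈ linIdeal Z.fat.1 ^ m ↔ f ∈ linIdeal Z.fat.1 ^ (m - δ) := by
    rcases hδ with rfl | rfl
    · exact mul_mem_linIdeal_pow_iff (mt vanishesOn_iff_mem.2 (hZ.fat_off rfl).1) _ _
    · obtain ⟨m, rfl⟩ := Nat.exists_eq_add_of_le' hδm
      exact mul_mem_linIdeal_pow_succ_iff
        (vanishesOn_iff_mem.1 (hℛ.onQuadric _ (hZ.fat_on rfl))) (hF.notMem_sq Z.fat.ne_bot) _ _
  have hone : ∀ {W : Submodule K (Fin 4 → K)}, ¬ VanishesOn F W →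
      (f * F ∈ linIdeal W ↔ f ∈ linIdeal W) := fun {W} hW => by
    simpa using mul_mem_linIdeal_pow_iff (mt vanishesOn_iff_mem.2 hW) 1 f
  rw [hfat]
  refine and_congr_right fun _ => ⟨?_, ?_⟩
  · rintro ⟨h1, h2, h3, h4⟩
    exact ⟨fun a L h => (hone (hZ.transversal_of_offAt h).1).1 (h1 a L h),
      fun i hi => (hone (hZ.point_off i hi)).1 (h3 i)⟩
  · rintro ⟨h1, h2⟩
    refine ⟨fun a L h => Ideal.mul_mem_right _ _ (h1 a L h), fun a L h =>
      Ideal.mul_mem_left _ _ (vanishesOn_iff_mem.1 (hℛ.onQuadric _ (hZ.mem_ruling_of_redAt h))),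
      fun i => ?_, fun a p h => ?_⟩
    · rcases lt_or_ge i.val t with h | h
      · exact Ideal.mul_mem_left _ _ (vanishesOn_iff_mem.1 (hZ.point_on i h))
      · exact Ideal.mul_mem_right _ _ (h2 i h)
    -- At a node f vanishes because it vanishes on a line through it, and F vanishes because the
    -- node is on the quadric. So the squared ideal imposes nothing new.
    · obtain ⟨L, -, hL, -, hp, -⟩ := hZ.exists_offAt_of_nodeAt h
      rw [pow_two]
      exact Ideal.mul_mem_mul (linIdeal_anti hp (h1 a L hL))
        (vanishesOn_iff_mem.1 (hZ.vanishesOn_of_nodeAt h))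

/-- The lines that are left of `Z`. -/
def remainderLine (Z : SpecConfig K r s q z u w) {l ls : ℕ} :
    {i : Fin r // l ≤ i.val} ⊕ {i : Fin s // i.val < ls} ⊕ {i : Fin z // Even i.val} → Line K
  | .inl i => Z.line i.1
  | .inr (.inl i) => Z.cross i.1 0
  | .inr (.inr i) => Z.zig i.1

/-- The crosses that are left of `Z`. -/
def remainderCross (Z : SpecConfig K r s q z u w) {ls : ℕ} :
    {i : Fin s // ls ≤ i.val} ⊕ Fin u → Fin 2 → Line K
  | .inl i => Z.cross i.1
  | .inr i => Z.sundial i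

variable {r' s' q' : ℕ}
  (eL : Fin r' ≃ {i : Fin r // l ≤ i.val} ⊕ {i : Fin s // i.val < ls} ⊕ {i : Fin z // Even i.val})
  (eC : Fin s' ≃ {i : Fin s // ls ≤ i.val} ⊕ Fin u) (eP : Fin q' ≃ {i : Fin q // t ≤ i.val})

/-- The configuration of the lines, crosses and points that are left of `Z`. -/
def remainder (Z : SpecConfig K r s q z u w) : Config K r' s' q' w where
  fat := Z.fat
  line i := Z.remainderLine (eL i)
  cross i := Z.remainderCross (eC i)
  point i := Z.point (eP i).1
  zig := Z.zz

theorem isRemainder_remainder : Z.IsRemainder l ls t (remainder eL eC eP Z) where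
  fat := rfl
  line := by
    change Set.range (Z.remainderLine ∘ eL) = _
    rw [eL.surjective.range_comp]
    ext L
    simp [remainderLine, eq_comm, or_assoc]
  cross := by
    change Set.range (Z.remainderCross ∘ eC) = _
    rw [eC.surjective.range_comp]
    ext L
    simp [remainderCross, eq_comm]
  point := by
    change Set.range ((fun i : {i : Fin q // t ≤ i.val} => Z.point i) ∘ eP) = _
    rw [eP.surjective.range_comp]
    ext L
    simp [eq_comm]
  zig := rfl

/-- The component of `Z` that contains a given component of the remainder. -/
def remainderOwner : Part r' s' q' w → SpecPart r s q z u
  | .fat => .old .fat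
  | .line i =>
    match eL i with
    | .inl i => .old (.line i.1)
    | .inr (.inl i) => .old (.cross i.1)
    | .inr (.inr _) => .old .zig
  | .cross i =>
    match eC i with
    | .inl i => .old (.cross i.1)
    | .inr i => .sundial i
  | .point i => .old (.point (eP i).1)
  | .zig => .zz

theorem pieces_remainder_subset (a : Part r' s' q' w) :
    (remainder eL eC eP Z).pieces a ⊆ Z.allPieces (remainderOwner eL eC eP a) := by
  match a with
  | .fat => exact subset_rfl
  | .line i =>
    rcases h : eL i with x | x | x <;>
      simp [Config.pieces, remainder, remainderOwner, h, remainderLine, allPieces]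
  | .cross i =>
    rcases h : eC i with x | x <;>
      simp [Config.pieces, remainder, remainderOwner, h, remainderCross, allPieces]
  | .point i => exact subset_rfl
  | .zig => exact subset_rfl

/-- A cut cross leaves a single line and an uncut cross stays in one piece. Only the reduced zig-zag
falls apart into several components. -/
theorem remainderOwner_eq {a b : Part r' s' q' w} (hab : a ≠ b)
    (h : remainderOwner eL eC eP a = remainderOwner eL eC eP b) :
    ∃ i j x y, a = .line i ∧ b = .line j ∧ eL i = .inr (.inr x) ∧ eL j = .inr (.inr y) := by
  match a, b with
  | .fat, .fat => exact absurd rfl hab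
  | .fat, .line j => rcases h' : eL j with x | x | x <;> simp [remainderOwner, h'] at h
  | .fat, .cross j => rcases h' : eC j with x | x <;> simp [remainderOwner, h'] at h
  | .line i, .fat => rcases h' : eL i with x | x | x <;> simp [remainderOwner, h'] at h
  | .line i, .line j =>
    have hij : eL i ≠ eL j := fun h => hab (by rw [eL.injective h])
    rcases hi : eL i with x | x | x <;> rcases hj : eL j with y | y | y <;>
      simp [remainderOwner, hi, hj, Subtype.ext_iff] at h hij
    · exact absurd h hij
    · exact absurd h hij
    · exact ⟨i, j, x, y, rfl, rfl, hi, hj⟩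
  | .line i, .cross j =>
    rcases hi : eL i with x | x | x <;> rcases hj : eC j with y | y <;>
      simp [remainderOwner, hi, hj, Fin.ext_iff] at h
    have := x.2
    have := y.2
    omega
  | .line i, .point j => rcases h' : eL i with x | x | x <;> simp [remainderOwner, h'] at h
  | .line i, .zig => rcases h' : eL i with x | x | x <;> simp [remainderOwner, h'] at h
  | .cross i, .fat => rcases h' : eC i with x | x <;> simp [remainderOwner, h'] at h
  | .cross i, .line j =>
    rcases hi : eL j with x | x | x <;> rcases hj : eC i with y | y <;>
      simp [remainderOwner, hi, hj, Fin.ext_iff] at h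
    have := x.2
    have := y.2
    omega
  | .cross i, .cross j =>
    have hij : eC i ≠ eC j := fun h => hab (by rw [eC.injective h])
    rcases hi : eC i with x | x <;> rcases hj : eC j with y | y <;>
      simp [remainderOwner, hi, hj, Subtype.ext_iff] at h hij
    · exact absurd h hij
    · exact absurd h hij
  | .cross i, .point j => rcases h' : eC i with x | x <;> simp [remainderOwner, h'] at h
  | .cross i, .zig => rcases h' : eC i with x | x <;> simp [remainderOwner, h'] at h
  | .point i, .line j => rcases h' : eL j with x | x | x <;> simp [remainderOwner, h'] at h
  | .point i, .cross j => rcases h' : eC j with x | x <;> simp [remainderOwner, h'] at h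
  | .point i, .point j =>
    simp only [remainderOwner, SpecPart.old.injEq, Part.point.injEq] at h
    exact absurd (congrArg _ (eP.injective (Subtype.ext h))) hab
  | .zig, .line j => rcases h' : eL j with x | x | x <;> simp [remainderOwner, h'] at h
  | .zig, .cross j => rcases h' : eC j with x | x <;> simp [remainderOwner, h'] at h
  | .zig, .zig => exact absurd rfl hab

theorem IsSpecialization.proper_remainder (hZ : Z.IsSpecialization F ℛ δ l ls t) :
    (remainder eL eC eP Z).Proper where
  cross_chain i := by
    rcases h : eC i with x | x <;> simp only [remainder, remainderCross, h]
    · exact hZ.proper.cross_chain x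
    · exact hZ.sundial_chain x
  zig_chain := hZ.zz_chain
  disjoint a b hab U hU W hW := by
    by_cases ho : remainderOwner eL eC eP a = remainderOwner eL eC eP b
    · obtain ⟨i, j, x, y, rfl, rfl, hi, hj⟩ := remainderOwner_eq eL eC eP hab ho
      have hij : eL i ≠ eL j := fun h => hab (by rw [eL.injective h])
      simp only [Config.pieces, remainder, Set.mem_singleton_iff, hi, hj, remainderLine] at hU hW
      subst hU hW
      simp only [hi, hj, ne_eq, Sum.inr.injEq, Subtype.ext_iff, Fin.ext_iff] at hij
      have hx := x.2
      have hy := y.2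
      -- Distinct even indices differ by at least two, so the lines left of the zig-zag are
      -- disjoint.
      rcases lt_or_gt_of_ne hij with h | h
      · exact hZ.proper.zig_chain.2 _ _ (by grind)
      · exact (hZ.proper.zig_chain.2 _ _ (by grind)).symm
    · exact hZ.disjoint _ _ ho U (pieces_remainder_subset eL eC eP a hU) W
        (pieces_remainder_subset eL eC eP b hW)

theorem mem_ideal_remainder_iff {m : ℕ} {f : Coord K} :
    f ∈ (remainder eL eC eP Z).ideal m ↔ f ∈ linIdeal Z.fat.1 ^ m ∧
      (∀ a L, Z.OffAt l ls a L → f ∈ linIdeal L.1) ∧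
      ∀ i, t ≤ i.val → f ∈ linIdeal (Z.point i).submodule := by
  have h : f ∈ (remainder eL eC eP Z).ideal m ↔ (((f ∈ linIdeal Z.fat.1 ^ m ∧
      (∀ i : Fin r, l ≤ i.val → f ∈ linIdeal (Z.line i).1) ∧
      (∀ i : Fin s, i.val < ls → f ∈ linIdeal (Z.cross i 0).1) ∧
      (∀ i : Fin z, Even i.val → f ∈ linIdeal (Z.zig i).1)) ∧
      (∀ i : Fin s, ls ≤ i.val → ∀ j, f ∈ linIdeal (Z.cross i j).1) ∧
      ∀ i j, f ∈ linIdeal (Z.sundial i j).1) ∧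
      (∀ i : Fin q, t ≤ i.val → f ∈ linIdeal (Z.point i).submodule)) ∧
      ∀ i, f ∈ linIdeal (Z.zz i).1 := by
    simp only [Config.ideal, unionIdeal, Ideal.mem_inf, Ideal.mem_iInf, remainder,
      eL.forall_congr_left, eC.forall_congr_left, eP.forall_congr_left, Equiv.apply_symm_apply,
      Sum.forall, Subtype.forall, remainderLine, remainderCross]
  rw [h]
  constructor
  · rintro ⟨⟨⟨⟨h1, h2, h3, h4⟩, h5, h6⟩, h7⟩, h8⟩
    refine ⟨h1, fun a L h => ?_, h7⟩
    match a, h with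
    | .old (.line i), h => exact h.2 ▸ h2 i h.1
    | .old (.cross i), .inl h =>
      subst h
      rcases lt_or_ge i.val ls with h | h
      · exact h3 i h
      · exact h5 i h 0
    | .old (.cross i), .inr h => exact h.2 ▸ h5 i h.1 1
    | .old .zig, ⟨j, hj, h⟩ => exact h ▸ h4 j hj
    | .sundial i, ⟨j, h⟩ => exact h ▸ h6 i j
    | .zz, ⟨j, h⟩ => exact h ▸ h8 j
  · rintro ⟨h1, h2, h3⟩
    refine ⟨⟨⟨⟨h1, fun i hi => h2 (.old (.line i)) _ ⟨hi, rfl⟩,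
      fun i hi => h2 (.old (.cross i)) _ (.inl rfl), fun i hi => h2 (.old .zig) _ ⟨i, hi, rfl⟩⟩,
      fun i hi j => ?_, fun i j => h2 (.sundial i) _ ⟨j, rfl⟩⟩, h3⟩,
      fun i => h2 .zz _ ⟨i, rfl⟩⟩
    fin_cases j
    · exact h2 (.old (.cross i)) _ (.inl rfl)
    · exact h2 (.old (.cross i)) _ (.inr ⟨hi, rfl⟩)

theorem IsSpecialization.exists_residual [Infinite K]
    (hZ : Z.IsSpecialization F ℛ δ l ls t) (hF : IsSmoothQuadric F) (hℛ : IsRuling F ℛ)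
    (hδ : δ = 0 ∨ δ = 1) {m : ℕ} (hδm : δ ≤ m) (hls : ls ≤ s) (hr : r' = r - l + ls + (z - z / 2))
    (hs : s' = s - ls + u) (hq : q' = q - t) :
    ∃ C : Config K r' s' q' w, C.Proper ∧ Z.IsRemainder l ls t C ∧
      residualIdeal F (Z.specIdeal m) = C.ideal (m - δ) := by
  subst hr hs hq
  let eL : Fin (r - l + ls + (z - z / 2)) ≃
      {i : Fin r // l ≤ i.val} ⊕ {i : Fin s // i.val < ls} ⊕ {i : Fin z // Even i.val} :=
    (((finGeEquiv r l).sumCongr ((finLtEquiv hls).sumCongr (finEvenEquiv z))).trans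
      ((Equiv.sumAssoc _ _ _).symm.trans
      ((finSumFinEquiv.sumCongr (Equiv.refl _)).trans finSumFinEquiv))).symm
  let eC : Fin (s - ls + u) ≃ {i : Fin s // ls ≤ i.val} ⊕ Fin u :=
    (((finGeEquiv s ls).sumCongr (Equiv.refl _)).trans finSumFinEquiv).symm
  let eP : Fin (q - t) ≃ {i : Fin q // t ≤ i.val} := (finGeEquiv q t).symm
  refine ⟨remainder eL eC eP Z, hZ.proper_remainder eL eC eP, isRemainder_remainder eL eC eP, ?_⟩
  ext f
  rw [hZ.mem_residualIdeal_iff hF hℛ hδ hδm, mem_ideal_remainder_iff]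

end Residual

end SpecConfig

end QuadricReduction

namespace QuadricReduction

variable {K : Type*} [Field K]

/-! ### Rules for local containment. -/

section Local

open MvPolynomial

theorem LocLE.mono {v : Fin 4 → K} {I I' J J' : Ideal (Coord K)} (h : LocLE v I J) (hI : I' ≤ I)
    (hJ : J ≤ J') : LocLE v I' J' := fun f hf => by
  obtain ⟨g, hg, hgf⟩ := h f (hI hf)
  exact ⟨g, hg, hJ hgf⟩

theorem LocLE.mul {v : Fin 4 → K} {I I' J J' : Ideal (Coord K)} (h : LocLE v I J)
    (h' : LocLE v I' J') : LocLE v (I * I') (J * J') := fun f hf => by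
  refine Submodule.mul_induction_on hf (fun a ha b hb => ?_) fun x y hx hy => ?_
  · obtain ⟨g, hg, hga⟩ := h a ha
    obtain ⟨g', hg', hgb⟩ := h' b hb
    refine ⟨g * g', by simp [hg, hg'], ?_⟩
    rw [mul_mul_mul_comm]
    exact Ideal.mul_mem_mul hga hgb
  · obtain ⟨g, hg, hgx⟩ := hx
    obtain ⟨g', hg', hgy⟩ := hy
    refine ⟨g * g', by simp [hg, hg'], ?_⟩
    have := (J * J').add_mem ((J * J').mul_mem_left g' hgx) ((J * J').mul_mem_left g hgy)
    convert this using 1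
    ring

theorem LocLE.inf {v : Fin 4 → K} {I J J' : Ideal (Coord K)} (h : LocLE v I J)
    (h' : LocLE v I J') : LocLE v I (J ⊓ J') := fun f hf => by
  obtain ⟨g, hg, hgf⟩ := h f hf
  obtain ⟨g', hg', hgf'⟩ := h' f hf
  refine ⟨g * g', by simp [hg, hg'], ?_, ?_⟩
  · rw [mul_right_comm]
    exact J.mul_mem_right _ hgf
  · rw [mul_assoc]
    exact J'.mul_mem_left _ hgf'

theorem LocLE.iInf {v : Fin 4 → K} {ι : Type*} [Finite ι] {I : Ideal (Coord K)}
    {J : ι → Ideal (Coord K)} (h : ∀ i, LocLE v I (J i)) : LocLE v I (⨅ i, J i) := by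
  have := Fintype.ofFinite ι
  intro f hf
  choose g hg hgf using fun i => h i f hf
  refine ⟨∏ i, g i, ?_, ?_⟩
  · rw [map_prod]
    exact Finset.prod_ne_zero_iff.2 fun i _ => hg i
  · rw [Ideal.mem_iInf]
    intro i
    exact Ideal.mem_of_dvd _ (mul_dvd_mul_right (Finset.dvd_prod_of_mem _ (Finset.mem_univ i)) f)
      (hgf i)

theorem LocLE.finsetProd {v : Fin 4 → K} {ι : Type*} {s : Finset ι} {J : ι → Ideal (Coord K)}
    (h : ∀ i ∈ s, LocLE v ⊤ (J i)) : LocLE v ⊤ (∏ i ∈ s, J i) := by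
  classical
  induction s using Finset.induction_on with
  | empty => exact LocLE.of_le (by simp)
  | insert i s hi ih =>
    rw [Finset.prod_insert hi]
    have := (h i (Finset.mem_insert_self i s)).mul
      (ih fun j hj => h j (Finset.mem_insert_of_mem hj))
    rwa [Ideal.top_mul] at this

theorem LocLE.prod_of_ne {v : Fin 4 → K} {ι : Type*} [Fintype ι] {I : Ideal (Coord K)}
    {J : ι → Ideal (Coord K)} (i : ι) (hi : LocLE v I (J i))
    (h : ∀ j, j ≠ i → LocLE v ⊤ (J j)) : LocLE v I (∏ i, J i) := by
  classical
  rw [← Finset.mul_prod_erase _ _ (Finset.mem_univ i)]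
  have := hi.mul (LocLE.finsetProd (s := Finset.univ.erase i) fun j hj =>
    h j (Finset.ne_of_mem_erase hj))
  rwa [Ideal.mul_top] at this

theorem LocLE.top_linIdeal_pow {v : Fin 4 → K} {W : Submodule K (Fin 4 → K)} (h : v ∉ W) (n : ℕ) :
    LocLE v ⊤ (linIdeal W ^ n) := by
  obtain ⟨g, hg, hgv⟩ := exists_mem_linIdeal_eval_ne_zero h
  exact LocLE.of_eval_ne_zero (Ideal.pow_mem_pow hg n) (by simp [hgv])

theorem LocLE.top_linIdeal {v : Fin 4 → K} {W : Submodule K (Fin 4 → K)} (h : v ∉ W) :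
    LocLE v ⊤ (linIdeal W) := by
  simpa using LocLE.top_linIdeal_pow h 1

end Local

/-! ### Local structure of the subscheme D + Ω. -/

namespace TraceData

variable {δ n p e f : ℕ}

/-- The ideal that defines `D + Ω` on the quadric near the line or point with a given label. -/
noncomputable def localIdeal (m : ℕ) (T : TraceData K δ n p e f) :
    TracePart δ n p e f → Ideal (Coord K)
  | .fatLine i => linIdeal (T.fatLine i).1 ^ m
  | .redLine i => linIdeal (T.redLine i).1
  | .simple i => linIdeal (T.simple i).submodule
  | .double i => linIdeal (T.double i).submodule ^ 2
  | .multiple i => linIdeal (T.multiple i).submodule ^ m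

theorem sumIdeal_le (F : Coord K) (m : ℕ) (T : TraceData K δ n p e f)
    (a : TracePart δ n p e f) : T.sumIdeal F m ≤ Ideal.span {F} ⊔ T.localIdeal m a := by
  rw [sumIdeal]
  refine sup_le le_sup_left ?_
  have h1 : ∀ {J : Ideal (Coord K)}, (∏ i, linIdeal (T.fatLine i).1 ^ m) *
      ∏ i, linIdeal (T.redLine i).1 ≤ J →
      T.divisorIdeal F m * T.omegaIdeal F m ≤ Ideal.span {F} ⊔ J := fun h =>
    Ideal.mul_le_left.trans (sup_le_sup_left h _)
  have h2 : ∀ {J : Ideal (Coord K)}, T.omegaIdeal F m ≤ J →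
      T.divisorIdeal F m * T.omegaIdeal F m ≤ J := fun h => Ideal.mul_le_right.trans h
  match a with
  | .fatLine i =>
    exact h1 (Ideal.mul_le_left.trans (Ideal.le_of_dvd
      (Finset.dvd_prod_of_mem (fun i => linIdeal (T.fatLine i).1 ^ m) (Finset.mem_univ i))))
  | .redLine i =>
    exact h1 (Ideal.mul_le_right.trans (Ideal.le_of_dvd
      (Finset.dvd_prod_of_mem (fun i => linIdeal (T.redLine i).1) (Finset.mem_univ i))))
  | .simple i =>
    refine h2 (inf_le_left.trans (inf_le_left.trans ((iInf_le _ i).trans_eq ?_)))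
    rw [fatPointIdeal, pow_one, localIdeal]
  | .double i => exact h2 (inf_le_left.trans (inf_le_right.trans (iInf_le _ i)))
  | .multiple i => exact h2 (inf_le_right.trans (iInf_le _ i))

theorem top_locLE_divisorIdeal {F : Coord K} (m : ℕ) {T : TraceData K δ n p e f} {v : Fin 4 → K}
    (h1 : ∀ i, v ∉ (T.fatLine i).1) (h2 : ∀ i, v ∉ (T.redLine i).1) :
    LocLE v ⊤ (T.divisorIdeal F m) := by
  have := (LocLE.finsetProd (s := Finset.univ) fun i _ => LocLE.top_linIdeal_pow (h1 i) m).mul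
    (LocLE.finsetProd (s := Finset.univ) fun i _ => LocLE.top_linIdeal (h2 i))
  exact this.mono (by rw [Ideal.top_mul]) le_sup_right

theorem top_locLE_fatPointIdeal {F : Coord K} (k : ℕ) {x : Pt K} {v : Fin 4 → K}
    (h : v ∉ x.submodule) : LocLE v ⊤ (fatPointIdeal F k x) :=
  (LocLE.top_linIdeal_pow h k).mono le_rfl le_sup_right

theorem top_locLE_sumIdeal {F : Coord K} (m : ℕ) {T : TraceData K δ n p e f} {v : Fin 4 → K}
    (h : ∀ a, v ∉ T.flat a) : LocLE v ⊤ (T.sumIdeal F m) := by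
  have h1 := top_locLE_divisorIdeal (F := F) m (fun i => h (.fatLine i)) fun i => h (.redLine i)
  have h2 : LocLE v ⊤ (T.omegaIdeal F m) :=
    ((LocLE.iInf fun i => top_locLE_fatPointIdeal 1 (h (.simple i))).inf
      (LocLE.iInf fun i => top_locLE_fatPointIdeal 2 (h (.double i)))).inf
      (LocLE.iInf fun i => top_locLE_fatPointIdeal m (h (.multiple i)))
  exact (h1.mul h2).mono (by rw [Ideal.top_mul]) le_sup_right

/-- The lines and points are pairwise disjoint, so every factor of D and of Ω with a label other
than `a` contains a polynomial that does not vanish at v, and is locally the unit ideal. -/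
theorem locLE_sumIdeal {F : Coord K} {ℛ : Set (Line K)} (m : ℕ) {T : TraceData K δ n p e f}
    (hT : T.Proper F ℛ) {v : Fin 4 → K} (hv : v ≠ 0) {a : TracePart δ n p e f}
    (ha : v ∈ T.flat a) : LocLE v (Ideal.span {F} ⊔ T.localIdeal m a) (T.sumIdeal F m) := by
  have hb : ∀ b, b ≠ a → v ∉ T.flat b := fun b hba hvb =>
    hv (Submodule.disjoint_def.1 (hT.disjoint b a hba) v hvb ha)
  have hline : (∀ i, a ≠ .simple i) → (∀ i, a ≠ .double i) → (∀ i, a ≠ .multiple i) →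
      LocLE v ⊤ (T.omegaIdeal F m) := fun h1 h2 h3 =>
    ((LocLE.iInf fun i => top_locLE_fatPointIdeal 1 (hb (.simple i) (h1 i).symm)).inf
      (LocLE.iInf fun i => top_locLE_fatPointIdeal 2 (hb (.double i) (h2 i).symm))).inf
      (LocLE.iInf fun i => top_locLE_fatPointIdeal m (hb (.multiple i) (h3 i).symm))
  refine LocLE.sup (LocLE.of_le le_sup_left) ?_
  match a with
  | .fatLine i =>
    have h1 : LocLE v (T.localIdeal m (.fatLine i)) ((∏ i, linIdeal (T.fatLine i).1 ^ m) *
        ∏ i, linIdeal (T.redLine i).1) := by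
      have := (LocLE.prod_of_ne (J := fun i => linIdeal (T.fatLine i).1 ^ m) i (LocLE.of_le le_rfl)
        fun j hj => LocLE.top_linIdeal_pow (hb (.fatLine j) (by simpa using hj)) m).mul
        (LocLE.finsetProd (s := Finset.univ) fun j _ =>
          LocLE.top_linIdeal (hb (.redLine j) (by simp)))
      rwa [Ideal.mul_top] at this
    exact ((h1.mono le_rfl le_sup_right).mul (hline (by simp) (by simp) (by simp))).mono
      (by rw [Ideal.mul_top]) le_sup_right
  | .redLine i =>
    have h1 : LocLE v (T.localIdeal m (.redLine i)) ((∏ i, linIdeal (T.fatLine i).1 ^ m) *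
        ∏ i, linIdeal (T.redLine i).1) := by
      have := (LocLE.finsetProd (s := Finset.univ) fun j _ =>
          LocLE.top_linIdeal_pow (hb (.fatLine j) (by simp)) m).mul
        (LocLE.prod_of_ne (J := fun i => linIdeal (T.redLine i).1) i (LocLE.of_le le_rfl)
        fun j hj => LocLE.top_linIdeal (hb (.redLine j) (by simpa using hj)))
      rwa [Ideal.top_mul] at this
    exact ((h1.mono le_rfl le_sup_right).mul (hline (by simp) (by simp) (by simp))).mono
      (by rw [Ideal.mul_top]) le_sup_right
  | .simple i =>
    have h1 := top_locLE_divisorIdeal (F := F) m (fun j => hb (.fatLine j) (by simp))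
      fun j => hb (.redLine j) (by simp)
    have h2 : LocLE v (T.localIdeal m (.simple i)) (T.omegaIdeal F m) := by
      refine ((LocLE.iInf fun j => ?_).inf (LocLE.iInf fun j =>
        (top_locLE_fatPointIdeal 2 (hb (.double j) (by simp))).mono le_top le_rfl)).inf
        (LocLE.iInf fun j =>
        (top_locLE_fatPointIdeal m (hb (.multiple j) (by simp))).mono le_top le_rfl)
      by_cases hj : j = i
      · subst hj
        exact LocLE.of_le (by rw [fatPointIdeal, pow_one]; exact le_sup_right)
      · exact (top_locLE_fatPointIdeal 1 (hb (.simple j) (by simpa using hj))).mono le_top le_rfl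
    exact (h1.mul h2).mono (by rw [Ideal.top_mul]) le_sup_right
  | .double i =>
    have h1 := top_locLE_divisorIdeal (F := F) m (fun j => hb (.fatLine j) (by simp))
      fun j => hb (.redLine j) (by simp)
    have h2 : LocLE v (T.localIdeal m (.double i)) (T.omegaIdeal F m) := by
      refine ((LocLE.iInf fun j =>
        (top_locLE_fatPointIdeal 1 (hb (.simple j) (by simp))).mono le_top le_rfl).inf
        (LocLE.iInf fun j => ?_)).inf (LocLE.iInf fun j =>
        (top_locLE_fatPointIdeal m (hb (.multiple j) (by simp))).mono le_top le_rfl)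
      by_cases hj : j = i
      · subst hj
        exact LocLE.of_le le_sup_right
      · exact (top_locLE_fatPointIdeal 2 (hb (.double j) (by simpa using hj))).mono le_top le_rfl
    exact (h1.mul h2).mono (by rw [Ideal.top_mul]) le_sup_right
  | .multiple i =>
    have h1 := top_locLE_divisorIdeal (F := F) m (fun j => hb (.fatLine j) (by simp))
      fun j => hb (.redLine j) (by simp)
    have h2 : LocLE v (T.localIdeal m (.multiple i)) (T.omegaIdeal F m) := by
      refine ((LocLE.iInf fun j =>
        (top_locLE_fatPointIdeal 1 (hb (.simple j) (by simp))).mono le_top le_rfl).inf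
        (LocLE.iInf fun j => (top_locLE_fatPointIdeal 2 (hb (.double j) (by simp))).mono le_top
        le_rfl)).inf (LocLE.iInf fun j => ?_)
      by_cases hj : j = i
      · subst hj
        exact LocLE.of_le le_sup_right
      · exact (top_locLE_fatPointIdeal m (hb (.multiple j) (by simpa using hj))).mono le_top le_rfl
    exact (h1.mul h2).mono (by rw [Ideal.top_mul]) le_sup_right

end TraceData

/-! ### The lines and points in which the quadric meets a specialization. -/

namespace SpecConfig

variable {r s q z u w : ℕ}

/-- The reduced points of the trace: the points on the quadric that lie on a line or point of `Z`
but not on a line of the ruling that belongs to `Z`, and are not singular points of a sundial or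
of the zig-zag. -/
def IsSimpleTracePoint (Z : SpecConfig K r s q z u w) (F : Coord K) (l ls t : ℕ) (p : Pt K) :
    Prop :=
  VanishesOn F p.submodule ∧ (∀ a L, Z.RedAt l ls a L → ¬ p.submodule ≤ L.1) ∧
    (∀ a, ¬ Z.NodeAt a p) ∧
    ((∃ a L, Z.OffAt l ls a L ∧ p.submodule ≤ L.1) ∨ ∃ i, i.val < t ∧ p = Z.point i)

/-- The lines and points of `T` are the lines and points in which the quadric meets `Z`. -/
structure IsTrace {δ n p e f : ℕ} (Z : SpecConfig K r s q z u w) (F : Coord K) (l ls t : ℕ)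
    (T : TraceData K δ n p e f) : Prop where
  fatLine : ∀ i, T.fatLine i = Z.fat
  redLine : ∀ L, L ∈ Set.range T.redLine ↔ ∃ a, Z.RedAt l ls a L
  simple : ∀ x, x ∈ Set.range T.simple ↔ Z.IsSimpleTracePoint F l ls t x
  double : ∀ x, x ∈ Set.range T.double ↔ ∃ a, Z.NodeAt a x
  multiple : ∀ x, x ∈ Set.range T.multiple ↔
    δ = 0 ∧ x.submodule ≤ Z.fat.1 ∧ VanishesOn F x.submodule
  redLine_inj : Function.Injective T.redLine
  simple_inj : Function.Injective T.simple
  double_inj : Function.Injective T.double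
  multiple_inj : Function.Injective T.multiple

section Trace

variable {Z : SpecConfig K r s q z u w} {l ls t δ : ℕ} {F : Coord K} {ℛ : Set (Line K)}

theorem IsSpecialization.not_le_fat (hZ : Z.IsSpecialization F ℛ δ l ls t)
    {a : SpecPart r s q z u} (ha : a ≠ .old .fat) {U : Submodule K (Fin 4 → K)}
    (hU : U ∈ Z.allPieces a) {x : Pt K} (hx : x.submodule ≤ U) : ¬ x.submodule ≤ Z.fat.1 :=
  fun h => ha (hZ.owner_unique hU (b := .old .fat) (by rfl) hx h)

theorem RedAt.ne_fat {a : SpecPart r s q z u} {L : Line K} (h : Z.RedAt l ls a L) :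
    a ≠ .old .fat := by rintro rfl; exact h

theorem OffAt.ne_fat {a : SpecPart r s q z u} {L : Line K} (h : Z.OffAt l ls a L) :
    a ≠ .old .fat := by rintro rfl; exact h

theorem NodeAt.ne_fat {a : SpecPart r s q z u} {x : Pt K} (h : Z.NodeAt a x) :
    a ≠ .old .fat := by rintro rfl; exact h

theorem IsSpecialization.not_le_fat_of_simple (hZ : Z.IsSpecialization F ℛ δ l ls t) {x : Pt K}
    (hx : Z.IsSimpleTracePoint F l ls t x) : ¬ x.submodule ≤ Z.fat.1 := by
  rcases hx.2.2.2 with ⟨a, L, hL, hxL⟩ | ⟨i, -, rfl⟩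
  · exact hZ.not_le_fat hL.ne_fat hL.mem_allPieces hxL
  · exact hZ.not_le_fat (a := .old (.point i)) (by simp) rfl le_rfl

theorem IsSpecialization.not_nodeAt_of_redAt (hZ : Z.IsSpecialization F ℛ δ l ls t) {x : Pt K}
    {a b : SpecPart r s q z u} {M : Line K} (hM : Z.RedAt l ls a M) (hx : x.submodule ≤ M.1) :
    ¬ Z.NodeAt b x := fun h => by
  obtain ⟨U, hU, hxU⟩ := h.exists_mem_allPieces
  obtain rfl := hZ.owner_unique hU hM.mem_allPieces hxU hx
  exact not_redAt_of_nodeAt h _ hM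

variable {n p e f : ℕ} {T : TraceData K δ n p e f}

/-- Lines and points from different components of Z are disjoint. Within one component the
definition of the simple trace points excludes ruling lines and nodes, and no component has both a
ruling line and a node. -/
theorem IsTrace.proper (hT : Z.IsTrace F l ls t T) (hZ : Z.IsSpecialization F ℛ δ l ls t)
    (hℛ : IsRuling F ℛ) (hδ : δ = 0 ∨ δ = 1) : T.Proper F ℛ := by
  have hfat : ∀ i, T.fatLine i ∈ ℛ := fun i => by
    rw [hT.fatLine]
    exact hZ.fat_on (by have := i.2; omega)
  have hred : ∀ i, ∃ a, Z.RedAt l ls a (T.redLine i) := fun i => (hT.redLine _).1 ⟨i, rfl⟩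
  have hsim : ∀ i, Z.IsSimpleTracePoint F l ls t (T.simple i) := fun i => (hT.simple _).1 ⟨i, rfl⟩
  have hdou : ∀ i, ∃ a, Z.NodeAt a (T.double i) := fun i => (hT.double _).1 ⟨i, rfl⟩
  have hmul : ∀ i, δ = 0 ∧ (T.multiple i).submodule ≤ Z.fat.1 ∧
      VanishesOn F (T.multiple i).submodule := fun i => (hT.multiple _).1 ⟨i, rfl⟩
  have hred' : ∀ i, T.redLine i ∈ ℛ := fun i => (hred i).elim fun a h => hZ.mem_ruling_of_redAt h
  -- the pairs of labels are treated in one order only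
  have key : ∀ a b : TracePart δ n p e f, a ≠ b → Disjoint (T.flat a) (T.flat b) ∨
      Disjoint (T.flat b) (T.flat a) := by
    have hfr : ∀ i j, Disjoint (T.fatLine i).1 (T.redLine j).1 := fun i j => by
      obtain ⟨a, ha⟩ := hred j
      rw [hT.fatLine]
      exact hZ.disjoint (.old .fat) a ha.ne_fat.symm _ rfl _ ha.mem_allPieces
    have hsf : ∀ i j, Disjoint (T.simple i).submodule (T.fatLine j).1 := fun i j => by
      rw [hT.fatLine, Pt.disjoint_iff]
      exact hZ.not_le_fat_of_simple (hsim i)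
    have hdf : ∀ i j, Disjoint (T.double i).submodule (T.fatLine j).1 := fun i j => by
      rw [hT.fatLine, Pt.disjoint_iff]
      obtain ⟨a, ha⟩ := hdou i
      obtain ⟨U, hU, hxU⟩ := ha.exists_mem_allPieces
      exact hZ.not_le_fat ha.ne_fat hU hxU
    -- A fat line in the ruling requires δ > 0, multiple points require δ = 0.
    have hmf : ∀ (i : Fin f) (j : Fin δ), False := fun i j => by
      have := (hmul i).1
      have := j.2
      omega
    have hsr : ∀ i j, Disjoint (T.simple i).submodule (T.redLine j).1 := fun i j => by
      rw [Pt.disjoint_iff]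
      obtain ⟨a, ha⟩ := hred j
      exact (hsim i).2.1 a _ ha
    have hdr : ∀ i j, Disjoint (T.double i).submodule (T.redLine j).1 := fun i j => by
      rw [Pt.disjoint_iff]
      obtain ⟨a, ha⟩ := hred j
      obtain ⟨b, hb⟩ := hdou i
      exact fun h => hZ.not_nodeAt_of_redAt ha h hb
    have hmr : ∀ i j, Disjoint (T.multiple i).submodule (T.redLine j).1 := fun i j => by
      rw [Pt.disjoint_iff]
      obtain ⟨a, ha⟩ := hred j
      exact fun h => hZ.not_le_fat ha.ne_fat ha.mem_allPieces h (hmul i).2.1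
    have hsd : ∀ i j, Disjoint (T.simple i).submodule (T.double j).submodule := fun i j => by
      rw [Pt.disjoint_iff]
      intro h
      obtain ⟨b, hb⟩ := hdou j
      rw [← Pt.eq_of_le h] at hb
      exact (hsim i).2.2.1 b hb
    have hsm : ∀ i j, Disjoint (T.simple i).submodule (T.multiple j).submodule := fun i j => by
      rw [Pt.disjoint_iff]
      exact fun h => hZ.not_le_fat_of_simple (hsim i) (h.trans (hmul j).2.1)
    have hdm : ∀ i j, Disjoint (T.double i).submodule (T.multiple j).submodule := fun i j => by
      rw [Pt.disjoint_iff]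
      obtain ⟨a, ha⟩ := hdou i
      obtain ⟨U, hU, hxU⟩ := ha.exists_mem_allPieces
      exact fun h => hZ.not_le_fat ha.ne_fat hU hxU (h.trans (hmul j).2.1)
    intro a b hab
    match a, b with
    | .fatLine i, .fatLine j =>
      -- Since δ ≤ 1 there is at most one fat line.
      exfalso
      apply hab
      congr 1
      ext
      have := i.2
      have := j.2
      omega
    | .fatLine i, .redLine j => exact .inl (hfr i j)
    | .fatLine i, .simple j => exact .inr (hsf j i)
    | .fatLine i, .double j => exact .inr (hdf j i)
    | .fatLine i, .multiple j => exact (hmf j i).elim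
    | .redLine i, .fatLine j => exact .inr (hfr j i)
    | .redLine i, .redLine j =>
      exact .inl (hℛ.disjoint _ (hred' i) _ (hred' j)
        (hT.redLine_inj.ne fun h => hab (by rw [h])))
    | .redLine i, .simple j => exact .inr (hsr j i)
    | .redLine i, .double j => exact .inr (hdr j i)
    | .redLine i, .multiple j => exact .inr (hmr j i)
    | .simple i, .fatLine j => exact .inl (hsf i j)
    | .simple i, .redLine j => exact .inl (hsr i j)
    | .simple i, .simple j =>
      exact .inl (Pt.disjoint_iff.2 fun h => hab (by rw [hT.simple_inj (Pt.eq_of_le h)]))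
    | .simple i, .double j => exact .inl (hsd i j)
    | .simple i, .multiple j => exact .inl (hsm i j)
    | .double i, .fatLine j => exact .inl (hdf i j)
    | .double i, .redLine j => exact .inl (hdr i j)
    | .double i, .simple j => exact .inr (hsd j i)
    | .double i, .double j =>
      exact .inl (Pt.disjoint_iff.2 fun h => hab (by rw [hT.double_inj (Pt.eq_of_le h)]))
    | .double i, .multiple j => exact .inl (hdm i j)
    | .multiple i, .fatLine j => exact (hmf i j).elim
    | .multiple i, .redLine j => exact .inl (hmr i j)
    | .multiple i, .simple j => exact .inr (hsm j i)
    | .multiple i, .double j => exact .inr (hdm j i)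
    | .multiple i, .multiple j =>
      exact .inl (Pt.disjoint_iff.2 fun h => hab (by rw [hT.multiple_inj (Pt.eq_of_le h)]))
  refine ⟨hfat, hred', fun a => ?_, fun a b hab => (key a b hab).elim id fun h => h.symm⟩
  match a with
  | .fatLine i => exact hℛ.onQuadric _ (hfat i)
  | .redLine i => exact hℛ.onQuadric _ (hred' i)
  | .simple i => exact (hsim i).1
  | .double i => exact (hdou i).elim fun a h => hZ.vanishesOn_of_nodeAt h
  | .multiple i => exact (hmul i).2.2

end Trace

/-! ### Removing the components that miss a point. -/

section Local

open MvPolynomial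

variable {Z : SpecConfig K r s q z u w} {l ls t δ : ℕ} {F : Coord K} {ℛ : Set (Line K)}

instance : Finite (Part r s q z) :=
  Finite.of_injective (β := Option (Fin r) ⊕ Option (Fin s) ⊕ Fin q)
    (fun a => match a with
      | .fat => .inl none
      | .line i => .inl (some i)
      | .cross i => .inr (.inl (some i))
      | .point i => .inr (.inr i)
      | .zig => .inr (.inl none))
    (by intro a b h; cases a <;> cases b <;> simp_all)

instance : Finite (SpecPart r s q z u) :=
  Finite.of_injective (β := Part r s q z ⊕ Option (Fin u))
    (fun a => match a with
      | .old a => .inl a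
      | .sundial i => .inr (some i)
      | .zz => .inr none)
    (by intro a b h; cases a <;> cases b <;> simp_all)

theorem finite_allPieces (a : SpecPart r s q z u) : (Z.allPieces a).Finite := by
  match a with
  | .old .fat => exact Set.finite_singleton _
  | .old (.line i) => exact Set.finite_singleton _
  | .old (.cross i) => exact Set.finite_range _
  | .old (.point i) => exact Set.finite_singleton _
  | .old .zig => exact Set.finite_range _
  | .sundial i => exact Set.finite_range _
  | .zz => exact Set.finite_range _

/-- Multiplication by g fulfils all conditions along subspaces that miss v, and g is a unit at v. -/
theorem _root_.QuadricReduction.exists_separator {𝒲 : Set (Submodule K (Fin 4 → K))}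
    (h𝒲 : 𝒲.Finite) (v : Fin 4 → K) (N : ℕ) :
    ∃ g : Coord K, eval v g ≠ 0 ∧ ∀ W ∈ 𝒲, v ∉ W → g ∈ linIdeal W ^ N := by
  classical
  have : Finite 𝒲 := h𝒲
  have hloc : LocLE v ⊤ (⨅ W : 𝒲, if v ∈ W.1 then ⊤ else linIdeal W.1 ^ N) := by
    refine LocLE.iInf fun W => ?_
    split_ifs with h
    · exact LocLE.of_le le_rfl
    · exact LocLE.top_linIdeal_pow h N
  obtain ⟨g, hg, hg'⟩ := hloc 1 trivial
  refine ⟨g, hg, fun W hW hv => ?_⟩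
  rw [mul_one, Ideal.mem_iInf] at hg'
  simpa [hv] using hg' ⟨W, hW⟩

theorem IsSpecialization.exists_mul_mem_specIdeal (hZ : Z.IsSpecialization F ℛ δ l ls t) (m : ℕ)
    (v : Fin 4 → K) : ∃ g : Coord K, eval v g ≠ 0 ∧ ∀ f,
      (v ∈ Z.fat.1 → f ∈ linIdeal Z.fat.1 ^ m) →
      (∀ a L, Z.OffAt l ls a L → v ∈ L.1 → f ∈ linIdeal L.1) →
      (∀ a L, Z.RedAt l ls a L → v ∈ L.1 → f ∈ linIdeal L.1) →
      (∀ i, v ∈ (Z.point i).submodule → f ∈ linIdeal (Z.point i).submodule) →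
      (∀ a p, Z.NodeAt a p → v ∈ p.submodule → f ∈ linIdeal p.submodule ^ 2) →
      g * f ∈ Z.specIdeal m := by
  set P : Set (Submodule K (Fin 4 → K)) := ⋃ a, Z.allPieces a
  have hP : P.Finite := Set.finite_iUnion finite_allPieces
  have hmem : ∀ {a U}, U ∈ Z.allPieces a → U ∈ P ∪ Set.image2 (· ⊓ ·) P P := fun {a} U h =>
    Or.inl (Set.mem_iUnion.2 ⟨a, h⟩)
  -- The exponent m + 2 covers all multiplicities that occur: m, 1 and 2. Nodes are not pieces but
  -- intersections of two pieces, so the pairwise intersections are separated as well.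
  obtain ⟨g, hg, hg'⟩ := exists_separator (hP.union (hP.image2 (· ⊓ ·) hP)) v (m + 2)
  have hg1 : ∀ {W}, W ∈ P ∪ Set.image2 (· ⊓ ·) P P → v ∉ W → g ∈ linIdeal W := fun h h' =>
    Ideal.pow_le_self (by omega) (hg' _ h h')
  have hnode : ∀ {a p}, Z.NodeAt a p → p.submodule ∈ P ∪ Set.image2 (· ⊓ ·) P P := by
    intro a p h
    match a, h with
    | .sundial i, h =>
      refine Or.inr ⟨(Z.sundial i 0).1, Set.mem_iUnion.2 ⟨.sundial i, 0, rfl⟩, (Z.sundial i 1).1,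
        Set.mem_iUnion.2 ⟨.sundial i, 1, rfl⟩, ?_⟩
      exact (Pt.eq_submodule_of_le ((hZ.sundial_chain i).1 0 1 rfl) h).symm
    | .zz, ⟨i, j, hij, h⟩ =>
      refine Or.inr ⟨(Z.zz i).1, Set.mem_iUnion.2 ⟨.zz, i, rfl⟩, (Z.zz j).1,
        Set.mem_iUnion.2 ⟨.zz, j, rfl⟩, ?_⟩
      exact (Pt.eq_submodule_of_le (hZ.zz_chain.1 i j hij) h).symm
  refine ⟨g, hg, fun f h1 h2 h3 h4 h5 => ?_⟩
  rw [hZ.mem_specIdeal_iff]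
  refine ⟨?_, fun a L h => ?_, fun a L h => ?_, fun i => ?_, fun a p h => ?_⟩
  · by_cases hv : v ∈ Z.fat.1
    · exact Ideal.mul_mem_left _ _ (h1 hv)
    · exact Ideal.mul_mem_right _ _ (Ideal.pow_le_pow_right (by omega)
        (hg' _ (hmem (a := .old .fat) rfl) hv))
  · by_cases hv : v ∈ L.1
    · exact Ideal.mul_mem_left _ _ (h2 a L h hv)
    · exact Ideal.mul_mem_right _ _ (hg1 (hmem h.mem_allPieces) hv)
  · by_cases hv : v ∈ L.1
    · exact Ideal.mul_mem_left _ _ (h3 a L h hv)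
    · exact Ideal.mul_mem_right _ _ (hg1 (hmem h.mem_allPieces) hv)
  · by_cases hv : v ∈ (Z.point i).submodule
    · exact Ideal.mul_mem_left _ _ (h4 i hv)
    · exact Ideal.mul_mem_right _ _ (hg1 (hmem (a := .old (.point i)) rfl) hv)
  · by_cases hv : v ∈ p.submodule
    · exact Ideal.mul_mem_left _ _ (h5 a p h hv)
    · exact Ideal.mul_mem_right _ _ (Ideal.pow_le_pow_right (by omega) (hg' _ (hnode h) hv))

end Local

end SpecConfig

end QuadricReduction

namespace QuadricReduction

variable {K : Type*} [Field K]

namespace SpecConfig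

open MvPolynomial

variable {r s q z u w : ℕ}

/-! ### Comparison of the trace with D + Ω at each point. -/

section LocalTrace

variable {Z : SpecConfig K r s q z u w} {l ls t δ : ℕ} {F : Coord K} {ℛ : Set (Line K)}
  {n p e f : ℕ} {T : TraceData K δ n p e f}

theorem IsTrace.traceIdeal_le (hT : Z.IsTrace F l ls t T) (hZ : Z.IsSpecialization F ℛ δ l ls t)
    (m : ℕ) (a : TracePart δ n p e f) :
    traceIdeal F (Z.specIdeal m) ≤ Ideal.span {F} ⊔ T.localIdeal m a := by
  refine sup_le_sup_left (fun g hg => ?_) _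
  rw [hZ.mem_specIdeal_iff] at hg
  obtain ⟨h1, h2, h3, h4, h5⟩ := hg
  match a with
  | .fatLine i =>
    rw [TraceData.localIdeal, hT.fatLine]
    exact h1
  | .redLine i =>
    obtain ⟨a, ha⟩ := (hT.redLine _).1 ⟨i, rfl⟩
    exact h3 a _ ha
  | .simple i =>
    obtain ⟨-, -, -, ⟨a, L, hL, hx⟩ | ⟨j, -, hj⟩⟩ := (hT.simple _).1 ⟨i, rfl⟩
    · exact linIdeal_anti hx (h2 a L hL)
    · rw [TraceData.localIdeal, hj]
      exact h4 j
  | .double i =>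
    obtain ⟨a, ha⟩ := (hT.double _).1 ⟨i, rfl⟩
    exact h5 a _ ha
  | .multiple i =>
    obtain ⟨-, hx, -⟩ := (hT.multiple _).1 ⟨i, rfl⟩
    exact Ideal.pow_right_mono (linIdeal_anti hx) m h1

theorem exists_add_of_mem_span_sup {F g : Coord K} {J : Ideal (Coord K)}
    (hg : g ∈ Ideal.span {F} ⊔ J) : ∃ h, ∃ k ∈ J, g = h * F + k := by
  obtain ⟨x, hx, k, hk, rfl⟩ := Submodule.mem_sup.1 hg
  obtain ⟨h, rfl⟩ := Ideal.mem_span_singleton'.1 hx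
  exact ⟨h, k, hk, rfl⟩

theorem mul_mem_of_add {F g f h k : Coord K} {I : Ideal (Coord K)} (hf : f = h * F + k)
    (hk : g * k ∈ I) : g * f ∈ Ideal.span {F} ⊔ I := by
  rw [hf, mul_add, ← mul_assoc]
  exact Submodule.add_mem_sup (Ideal.mul_mem_left _ _ (Ideal.mem_span_singleton_self F)) hk

theorem IsSpecialization.linIdeal_fat_locLE (hZ : Z.IsSpecialization F ℛ δ l ls t) (m : ℕ)
    {x : Pt K} (hx : x.submodule ≤ Z.fat.1) {v : Fin 4 → K} (hv : v ≠ 0) (hvx : v ∈ x.submodule) :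
    LocLE v (linIdeal Z.fat.1 ^ m) (Z.specIdeal m) := by
  intro f hf
  obtain ⟨g, hg, hg'⟩ := hZ.exists_mul_mem_specIdeal m v
  have hle : ∀ W : Submodule K (Fin 4 → K), v ∈ W → x.submodule ≤ W := fun W =>
    (Pt.submodule_le_iff hv hvx).2
  refine ⟨g, hg, hg' f (fun _ => hf) (fun a L hL h => ?_) (fun a L hL h => ?_) (fun i h => ?_)
    fun a y hy h => ?_⟩
  · exact absurd hx (hZ.not_le_fat hL.ne_fat hL.mem_allPieces (hle _ h))
  · exact absurd hx (hZ.not_le_fat hL.ne_fat hL.mem_allPieces (hle _ h))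
  · exact absurd hx (hZ.not_le_fat (a := .old (.point i)) (by simp) rfl (hle _ h))
  · obtain ⟨U, hU, hyU⟩ := hy.exists_mem_allPieces
    exact absurd hx (hZ.not_le_fat hy.ne_fat hU ((hle _ h).trans hyU))

variable [Infinite K]

/-- Near x the ideal of x is (F) + I(L) with L the fat line, and the m-th power of this sum is
contained in (F) + I(L)^m. -/
theorem IsSpecialization.multiple_locLE (hZ : Z.IsSpecialization F ℛ δ l ls t)
    (hF : F.IsHomogeneous 2) (hδ : δ = 0) (m : ℕ)
    {x : Pt K} (hx : x.submodule ≤ Z.fat.1) (hFx : VanishesOn F x.submodule) {v : Fin 4 → K}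
    (hv : v ≠ 0) (hvx : v ∈ x.submodule) :
    LocLE v (linIdeal x.submodule ^ m) (traceIdeal F (Z.specIdeal m)) := by
  have h1 : LocLE v (linIdeal x.submodule) (Ideal.span {F} ⊔ linIdeal Z.fat.1) := by
    obtain ⟨α, hα, hα'⟩ := (hZ.fat_off hδ).exists_mul_mem hF hx hFx hv hvx
    exact fun f hf => ⟨α, hα, hα' f hf⟩
  have h2 : LocLE v (linIdeal x.submodule ^ m) ((Ideal.span {F} ⊔ linIdeal Z.fat.1) ^ m) := by
    clear hZ
    induction m with
    | zero => exact LocLE.of_le (by simp)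
    | succ m ih =>
      rw [pow_succ, pow_succ]
      exact ih.mul h1
  refine h2.trans ((LocLE.of_le (J := Ideal.span {F} ⊔ linIdeal Z.fat.1 ^ m) ?_).trans
    (LocLE.sup (LocLE.of_le le_sup_left)
      ((hZ.linIdeal_fat_locLE m hx hv hvx).mono le_rfl le_sup_right)))
  clear h1 h2
  induction m with
  | zero => simp
  | succ m ih =>
    rw [pow_succ, pow_succ]
    refine (Ideal.mul_mono_left ih).trans ?_
    rw [Ideal.sup_mul, Ideal.mul_sup (linIdeal Z.fat.1 ^ m)]
    refine sup_le (Ideal.mul_le_left.trans le_sup_left) (sup_le ?_ le_sup_right)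
    exact Ideal.mul_le_right.trans le_sup_left

/-- Suppose a transversal line L of Z meets M in x. For f vanishing on M a multiple α f is h F + k
with k vanishing on L. As F vanishes on M, so does k, which therefore satisfies the equations of
both lines. So L does not thicken the trace along M. -/
theorem IsSpecialization.red_locLE (hZ : Z.IsSpecialization F ℛ δ l ls t)
    (hF : F.IsHomogeneous 2) (hℛ : IsRuling F ℛ) (m : ℕ) {a : SpecPart r s q z u} {M : Line K}
    (hM : Z.RedAt l ls a M) {x : Pt K} (hx : x.submodule ≤ M.1) {v : Fin 4 → K}
    (hv : v ≠ 0) (hvx : v ∈ x.submodule) :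
    LocLE v (linIdeal M.1) (traceIdeal F (Z.specIdeal m)) := by
  intro f hf
  have hMR := hZ.mem_ruling_of_redAt hM
  have hFM := hℛ.onQuadric M hMR
  obtain ⟨g, hg, hg'⟩ := hZ.exists_mul_mem_specIdeal m v
  have hle : ∀ W : Submodule K (Fin 4 → K), v ∈ W → x.submodule ≤ W := fun W =>
    (Pt.submodule_le_iff hv hvx).2
  have hone : ∀ b L, Z.RedAt l ls b L → v ∈ L.1 → L = M := fun b L hL hvL => by
    by_contra hne
    exact x.ne_bot (disjoint_self.1 ((hℛ.disjoint L (hZ.mem_ruling_of_redAt hL) M hMR hne).mono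
      (hle _ hvL) hx))
  have hown : ∀ {b U}, U ∈ Z.allPieces b → v ∈ U → b = a := fun hU hvU =>
    hZ.owner_unique hU hM.mem_allPieces (hle _ hvU) hx
  have hmem : ∀ k ∈ linIdeal M.1, (∀ b L, Z.OffAt l ls b L → v ∈ L.1 → k ∈ linIdeal L.1) →
      g * k ∈ Z.specIdeal m := fun k hk hk' => by
    refine hg' k (fun h => ?_) hk' (fun b L hL h => by rwa [hone b L hL h]) (fun i h => ?_)
      fun b y hy h => ?_
    · exact absurd (hle _ h) (hZ.not_le_fat hM.ne_fat hM.mem_allPieces hx)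
    · have := hown (b := .old (.point i)) rfl h
      subst this
      exact hM.elim
    · rw [← Pt.eq_of_mem hv hvx h] at hy
      exact absurd hy (hZ.not_nodeAt_of_redAt hM hx)
  by_cases hoff : ∃ L, Z.OffAt l ls a L ∧ v ∈ L.1
  · obtain ⟨L, hL, hvL⟩ := hoff
    obtain ⟨α, hα, hα'⟩ := (hZ.transversal_of_offAt hL).exists_mul_mem hF (hle _ hvL)
      (hFM.mono hx) hv hvx
    obtain ⟨h, k, hk, hαf⟩ := exists_add_of_mem_span_sup (hα' f (linIdeal_anti hx hf))
    refine ⟨g * α, by simp [hg, hα], ?_⟩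
    rw [mul_assoc]
    refine mul_mem_of_add hαf (hmem k ?_ fun b L' hL' hvL' => ?_)
    · have : k = α * f - h * F := by rw [hαf]; ring
      rw [this]
      exact Ideal.sub_mem _ (Ideal.mul_mem_left _ _ hf)
        (Ideal.mul_mem_left _ _ (vanishesOn_iff_mem.1 hFM))
    · obtain rfl := hown hL'.mem_allPieces hvL'
      rwa [hZ.offAt_unique_of_redAt hM hL' hL (hle _ hvL') (hle _ hvL)]
  · push Not at hoff
    refine ⟨g, hg, Ideal.mem_sup_right (hmem f hf fun b L hL hvL => ?_)⟩
    obtain rfl := hown hL.mem_allPieces hvL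
    exact absurd hvL (hoff L hL)

/-- With L and L′ the lines through the node, I(x)² is locally contained in the product of (F) +
I(L) and (F) + I(L′), hence in (F) + I(L)I(L′). The product I(L)I(L′) lies in I(L), in I(L′) and in
I(x)², and near x these are all the equations of Z. -/
theorem IsSpecialization.node_locLE (hZ : Z.IsSpecialization F ℛ δ l ls t)
    (hF : F.IsHomogeneous 2) (m : ℕ) {a : SpecPart r s q z u} {x : Pt K}
    (hx : Z.NodeAt a x) {v : Fin 4 → K} (hv : v ≠ 0) (hvx : v ∈ x.submodule) :
    LocLE v (linIdeal x.submodule ^ 2) (traceIdeal F (Z.specIdeal m)) := by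
  obtain ⟨L, L', hL, hL', hxL, hxL', huniq⟩ := hZ.exists_offAt_of_nodeAt hx
  have hFx := hZ.vanishesOn_of_nodeAt hx
  obtain ⟨U, hU, hxU⟩ := hx.exists_mem_allPieces
  have hle : ∀ W : Submodule K (Fin 4 → K), v ∈ W → x.submodule ≤ W := fun W =>
    (Pt.submodule_le_iff hv hvx).2
  have hown : ∀ {b U}, U ∈ Z.allPieces b → v ∈ U → b = a := fun hU' hvU =>
    hZ.owner_unique hU' hU (hle _ hvU) hxU
  have h1 : ∀ {L}, Z.OffAt l ls a L → x.submodule ≤ L.1 →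
      LocLE v (linIdeal x.submodule) (Ideal.span {F} ⊔ linIdeal L.1) := fun {L} hL hxL => by
    obtain ⟨α, hα, hα'⟩ := (hZ.transversal_of_offAt hL).exists_mul_mem hF hxL hFx hv hvx
    exact fun f hf => ⟨α, hα, hα' f hf⟩
  have h2 : LocLE v (linIdeal L.1 * linIdeal L'.1) (Z.specIdeal m) := by
    intro f hf
    obtain ⟨g, hg, hg'⟩ := hZ.exists_mul_mem_specIdeal m v
    refine ⟨g, hg, hg' f (fun h => ?_) (fun b M hM h => ?_) (fun b M hM h => ?_) (fun i h => ?_)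
      fun b y hy h => ?_⟩
    · exact absurd (hle _ h) (hZ.not_le_fat hx.ne_fat hU hxU)
    · obtain rfl := hown hM.mem_allPieces h
      rcases huniq M hM (hle _ h) with rfl | rfl
      · exact Ideal.mul_le_left hf
      · exact Ideal.mul_le_right hf
    · obtain rfl := hown hM.mem_allPieces h
      exact absurd hM (not_redAt_of_nodeAt hx M)
    · have := hown (b := .old (.point i)) rfl h
      subst this
      exact hx.elim
    · rw [← Pt.eq_of_mem hv hvx h, pow_two]
      exact Ideal.mul_mono (linIdeal_anti hxL) (linIdeal_anti hxL') hf
  rw [pow_two]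
  refine ((h1 hL hxL).mul (h1 hL' hxL')).trans ((LocLE.of_le
    (J := Ideal.span {F} ⊔ linIdeal L.1 * linIdeal L'.1) ?_).trans
    (LocLE.sup (LocLE.of_le le_sup_left) (h2.mono le_rfl le_sup_right)))
  rw [Ideal.sup_mul, Ideal.mul_sup (linIdeal L.1)]
  exact sup_le (Ideal.mul_le_left.trans le_sup_left)
    (sup_le (Ideal.mul_le_right.trans le_sup_left) le_sup_right)

/-- At most one transversal line L of Z passes through x. If there is one, I(x) is locally (F) +
I(L). Otherwise x is an isolated point of Z. -/
theorem IsSpecialization.simple_locLE (hZ : Z.IsSpecialization F ℛ δ l ls t)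
    (hF : F.IsHomogeneous 2) (m : ℕ) {x : Pt K}
    (hx : Z.IsSimpleTracePoint F l ls t x) {v : Fin 4 → K} (hv : v ≠ 0) (hvx : v ∈ x.submodule) :
    LocLE v (linIdeal x.submodule) (traceIdeal F (Z.specIdeal m)) := by
  intro f hf
  have hle : ∀ W : Submodule K (Fin 4 → K), v ∈ W → x.submodule ≤ W := fun W =>
    (Pt.submodule_le_iff hv hvx).2
  obtain ⟨g, hg, hg'⟩ := hZ.exists_mul_mem_specIdeal m v
  have hmem : ∀ k ∈ linIdeal x.submodule,
      (∀ b L, Z.OffAt l ls b L → v ∈ L.1 → k ∈ linIdeal L.1) →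
      g * k ∈ Z.specIdeal m := fun k hk hk' => by
    refine hg' k (fun h => ?_) hk' (fun b L hL h => ?_) (fun i h => ?_) fun b y hy h => ?_
    · exact absurd (hle _ h) (hZ.not_le_fat_of_simple hx)
    · exact absurd (hle _ h) (hx.2.1 b L hL)
    · rwa [← Pt.eq_of_mem hv hvx h]
    · rw [← Pt.eq_of_mem hv hvx h] at hy
      exact absurd hy (hx.2.2.1 b)
  by_cases hoff : ∃ b L, Z.OffAt l ls b L ∧ v ∈ L.1
  · obtain ⟨a, L, hL, hvL⟩ := hoff
    obtain ⟨α, hα, hα'⟩ := (hZ.transversal_of_offAt hL).exists_mul_mem hF (hle _ hvL)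
      hx.1 hv hvx
    obtain ⟨h, k, hk, hαf⟩ := exists_add_of_mem_span_sup (hα' f hf)
    refine ⟨g * α, by simp [hg, hα], ?_⟩
    rw [mul_assoc]
    refine mul_mem_of_add hαf (hmem k (linIdeal_anti (hle _ hvL) hk) fun b L' hL' hvL' => ?_)
    obtain rfl := hZ.owner_unique hL.mem_allPieces hL'.mem_allPieces (hle _ hvL) (hle _ hvL')
    rwa [hZ.offAt_unique hx.1 (hx.2.2.1 _) hL' hL (hle _ hvL') (hle _ hvL)]
  · push Not at hoff
    exact ⟨g, hg, Ideal.mem_sup_right (hmem f hf fun b L hL hvL => absurd hvL (hoff b L hL))⟩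

theorem IsTrace.locLE_traceIdeal (hT : Z.IsTrace F l ls t T)
    (hZ : Z.IsSpecialization F ℛ δ l ls t) (hF : F.IsHomogeneous 2) (hℛ : IsRuling F ℛ)
    (m : ℕ) {a : TracePart δ n p e f} {x : Pt K} (hx : x.submodule ≤ T.flat a) {v : Fin 4 → K}
    (hv : v ≠ 0) (hvx : v ∈ x.submodule) :
    LocLE v (Ideal.span {F} ⊔ T.localIdeal m a) (traceIdeal F (Z.specIdeal m)) := by
  refine LocLE.sup (LocLE.of_le le_sup_left) ?_
  match a, hx with
  | .fatLine i, hx =>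
    simp only [TraceData.localIdeal, TraceData.flat, hT.fatLine] at hx ⊢
    exact (hZ.linIdeal_fat_locLE m hx hv hvx).mono le_rfl le_sup_right
  | .redLine i, hx =>
    obtain ⟨a, ha⟩ := (hT.redLine _).1 ⟨i, rfl⟩
    exact hZ.red_locLE hF hℛ m ha hx hv hvx
  | .simple i, hx => exact hZ.simple_locLE hF m ((hT.simple _).1 ⟨i, rfl⟩) hv (hx hvx)
  | .double i, hx =>
    obtain ⟨a, ha⟩ := (hT.double _).1 ⟨i, rfl⟩
    exact hZ.node_locLE hF m ha hv (hx hvx)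
  | .multiple i, hx =>
    obtain ⟨hδ, h1, h2⟩ := (hT.multiple _).1 ⟨i, rfl⟩
    exact hZ.multiple_locLE hF hδ m h1 h2 hv (hx hvx)

-- A component of Z through a point of the quadric makes this point a simple trace point, a node, a
-- multiple point, or a point of a ruling line of D. Outside all of these the separator itself lies
-- in the ideal of Z.
omit [Infinite K] in
theorem IsTrace.top_locLE_traceIdeal (hT : Z.IsTrace F l ls t T)
    (hZ : Z.IsSpecialization F ℛ δ l ls t) (hδ : δ = 0 ∨ δ = 1) (m : ℕ) {x : Pt K}
    (hFx : VanishesOn F x.submodule) {v : Fin 4 → K}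
    (hv : v ≠ 0) (hvx : v ∈ x.submodule) (h : ∀ a, v ∉ T.flat a) :
    LocLE v ⊤ (traceIdeal F (Z.specIdeal m)) := by
  have hle : ∀ W : Submodule K (Fin 4 → K), v ∈ W → x.submodule ≤ W := fun W =>
    (Pt.submodule_le_iff hv hvx).2
  intro f _
  obtain ⟨g, hg, hg'⟩ := hZ.exists_mul_mem_specIdeal m v
  have hred : ∀ b L, Z.RedAt l ls b L → v ∉ L.1 := fun b L hL hvL => by
    obtain ⟨i, hi⟩ := (hT.redLine _).2 ⟨b, hL⟩
    exact h (.redLine i) (by rw [TraceData.flat, hi]; exact hvL)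
  have hnode : ∀ b y, Z.NodeAt b y → v ∉ y.submodule := fun b y hy hvy => by
    obtain ⟨i, hi⟩ := (hT.double _).2 ⟨b, hy⟩
    exact h (.double i) (by rw [TraceData.flat, hi]; exact hvy)
  have hsimple : ¬ Z.IsSimpleTracePoint F l ls t x := fun hx => by
    obtain ⟨i, hi⟩ := (hT.simple _).2 hx
    exact h (.simple i) (by rw [TraceData.flat, hi]; exact hvx)
  have hs : ∀ {P : Prop}, ((∃ a L, Z.OffAt l ls a L ∧ x.submodule ≤ L.1) ∨
      ∃ i, i.val < t ∧ x = Z.point i) → P := fun h =>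
    absurd ⟨hFx, fun b L hL hxL => hred b L hL (hxL hvx), fun b hb => hnode b x hb hvx, h⟩ hsimple
  refine ⟨g, hg, Ideal.mem_sup_right (hg' f (fun h' => ?_) (fun b L hL h' => ?_)
    (fun b L hL h' => absurd h' (hred b L hL)) (fun i h' => ?_)
    fun b y hy h' => absurd h' (hnode b y hy))⟩
  · exfalso
    rcases hδ with rfl | rfl
    · obtain ⟨i, hi⟩ := (hT.multiple x).2 ⟨rfl, hle _ h', hFx⟩
      exact h (.multiple i) (by rw [TraceData.flat, hi]; exact hvx)
    · exact h (.fatLine 0) (by rw [TraceData.flat, hT.fatLine]; exact h')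
  · exact hs (.inl ⟨b, L, hL, hle _ h'⟩)
  · have hx := Pt.eq_of_mem hv hvx h'
    refine hs (.inr ⟨i, ?_, hx⟩)
    by_contra hi
    exact hZ.point_off i (not_lt.1 hi) (hx ▸ hFx)

-- At a vector on a labelled line or point both ideals are locally (F) plus the local ideal of the
-- label. At the other vectors of the quadric both are locally the unit ideal, and off the quadric F
-- is a unit in both.
omit [Infinite K] in
theorem IsTrace.sameSubscheme [IsAlgClosed K] (hT : Z.IsTrace F l ls t T)
    (hZ : Z.IsSpecialization F ℛ δ l ls t) (hF : F.IsHomogeneous 2) (hℛ : IsRuling F ℛ)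
    (hδ : δ = 0 ∨ δ = 1) (m : ℕ) :
    SameSubscheme (traceIdeal F (Z.specIdeal m)) (T.sumIdeal F m) := by
  have : Infinite K := IsAlgClosed.instInfinite
  have hTp := hT.proper hZ hℛ hδ
  refine sameSubscheme_of_locLE fun v hv => ?_
  set x : Pt K := .mk K v hv
  have hvx : v ∈ x.submodule := by
    rw [Projectivization.submodule_mk]
    exact Submodule.mem_span_singleton_self v
  by_cases hFv : eval v F = 0
  · have hFx := (Pt.vanishesOn_iff hF hv hvx).2 hFv
    by_cases h : ∃ a, v ∈ T.flat a
    · obtain ⟨a, ha⟩ := h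
      exact ⟨(LocLE.of_le (hT.traceIdeal_le hZ m a)).trans (T.locLE_sumIdeal m hTp hv ha),
        (LocLE.of_le (T.sumIdeal_le F m a)).trans
          (hT.locLE_traceIdeal hZ hF hℛ m ((Pt.submodule_le_iff hv hvx).2 ha) hv hvx)⟩
    · push Not at h
      exact ⟨(TraceData.top_locLE_sumIdeal m h).mono le_top le_rfl,
        (hT.top_locLE_traceIdeal hZ hδ m hFx hv hvx h).mono le_top le_rfl⟩
  · exact ⟨LocLE.of_eval_ne_zero (Ideal.mem_sup_left (Ideal.mem_span_singleton_self F)) hFv,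
      LocLE.of_eval_ne_zero (Ideal.mem_sup_left (Ideal.mem_span_singleton_self F)) hFv⟩

end LocalTrace

end SpecConfig

end QuadricReduction

/-! ### Enumeration of the simple points of the trace. -/

namespace QuadricReduction

variable {K : Type*} [Field K]

/-- Labels for the reduced points of the trace of a specialization. -/
inductive SimpleIdx (r s q z u l ls t : ℕ)
  | line (i : Fin r) (h : l ≤ i.val) (ε : Fin 2)
  | cut (i : Fin s) (h : i.val < ls)
  | uncut (i : Fin s) (h : ls ≤ i.val) (j ε : Fin 2)
  | point (i : Fin q) (h : i.val < t)
  | zigStart (h : 0 < z)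
  | zigEnd (h : Odd z)
  | sundial (i : Fin u) (j : Fin 2)
  | zz (ε : Fin 2)

/-- Labels for the reduced lines of the trace of a specialization. -/
inductive RedIdx (r s z l ls : ℕ)
  | line (i : Fin r) (h : i.val < l)
  | cut (i : Fin s) (h : i.val < ls)
  | zig (i : Fin z) (h : Odd i.val)

section Counting

variable {r s q z u l ls t : ℕ}

/-- The labels of the reduced points as a sum of standard types. -/
def SimpleIdx.equivSum : SimpleIdx r s q z u l ls t ≃
    ({i : Fin r // l ≤ i.val} × Fin 2) ⊕ {i : Fin s // i.val < ls} ⊕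
      ({i : Fin s // ls ≤ i.val} × Fin 2 × Fin 2) ⊕ {i : Fin q // i.val < t} ⊕
        Fin (min z 1) ⊕ Fin (z % 2) ⊕ (Fin u × Fin 2) ⊕ Fin 2 where
  toFun
    | .line i h ε => .inl (⟨i, h⟩, ε)
    | .cut i h => .inr (.inl ⟨i, h⟩)
    | .uncut i h j ε => .inr (.inr (.inl (⟨i, h⟩, j, ε)))
    | .point i h => .inr (.inr (.inr (.inl ⟨i, h⟩)))
    | .zigStart h => .inr (.inr (.inr (.inr (.inl ⟨0, by omega⟩))))
    | .zigEnd h => .inr (.inr (.inr (.inr (.inr (.inl ⟨0, by rw [Nat.odd_iff.1 h]; omega⟩)))))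
    | .sundial i j => .inr (.inr (.inr (.inr (.inr (.inr (.inl (i, j)))))))
    | .zz ε => .inr (.inr (.inr (.inr (.inr (.inr (.inr ε))))))
  invFun
    | .inl (i, ε) => .line i.1 i.2 ε
    | .inr (.inl i) => .cut i.1 i.2
    | .inr (.inr (.inl (i, j, ε))) => .uncut i.1 i.2 j ε
    | .inr (.inr (.inr (.inl i))) => .point i.1 i.2
    | .inr (.inr (.inr (.inr (.inl i)))) => .zigStart (by have := i.2; omega)
    | .inr (.inr (.inr (.inr (.inr (.inl i))))) =>
      .zigEnd (Nat.odd_iff.2 (by have := i.2; omega))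
    | .inr (.inr (.inr (.inr (.inr (.inr (.inl (i, j))))))) => .sundial i j
    | .inr (.inr (.inr (.inr (.inr (.inr (.inr ε)))))) => .zz ε
  left_inv x := by cases x <;> rfl
  right_inv x := by
    rcases x with x | x | x | x | x | x | x | x
    · rfl
    · rfl
    · rfl
    · rfl
    · simp only [Sum.inr.injEq, Sum.inl.injEq]
      ext
      have := x.2
      simp only
      omega
    · simp only [Sum.inr.injEq, Sum.inl.injEq]
      ext
      have := x.2
      simp only
      omega
    · rfl
    · rfl

/-- In the count, `min z 1` stands for γ, the free end of the first line of the reduced zig-zag, and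
`z % 2` for the end of the last line, which is free only if that line is transversal. -/
theorem SimpleIdx.exists_equiv {p : ℕ} (hls : ls ≤ s) (ht : t ≤ q)
    (hp : p = (r - l) * 2 + (ls + ((s - ls) * 4 + (t + (min z 1 + (z % 2 + (u * 2 + 2))))))) :
    Nonempty (SimpleIdx r s q z u l ls t ≃ Fin p) := by
  have e := (SimpleIdx.equivSum (r := r) (s := s) (q := q) (z := z) (u := u) (l := l) (ls := ls)
    (t := t)).trans ((((finGeEquiv r l).prodCongr (.refl _)).sumCongr
    ((finLtEquiv hls).sumCongr (((finGeEquiv s ls).prodCongr (.refl _)).sumCongr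
    ((finLtEquiv ht).sumCongr (.refl _))))))
  refine ⟨e.trans (Fintype.equivFinOfCardEq ?_)⟩
  simp only [Fintype.card_sum, Fintype.card_prod, Fintype.card_fin]
  omega

/-- The labels of the reduced lines as a sum of standard types. -/
def RedIdx.equivSum : RedIdx r s z l ls ≃
    {i : Fin r // i.val < l} ⊕ {i : Fin s // i.val < ls} ⊕ {i : Fin z // Odd i.val} where
  toFun
    | .line i h => .inl ⟨i, h⟩
    | .cut i h => .inr (.inl ⟨i, h⟩)
    | .zig i h => .inr (.inr ⟨i, h⟩)
  invFun
    | .inl i => .line i.1 i.2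
    | .inr (.inl i) => .cut i.1 i.2
    | .inr (.inr i) => .zig i.1 i.2
  left_inv x := by cases x <;> rfl
  right_inv x := by rcases x with x | x | x <;> rfl

theorem RedIdx.exists_equiv {n : ℕ} (hl : l ≤ r) (hls : ls ≤ s) (hn : n = l + ls + z / 2) :
    Nonempty (RedIdx r s z l ls ≃ Fin n) := by
  have e := (RedIdx.equivSum (r := r) (s := s) (z := z) (l := l) (ls := ls)).trans
    ((finLtEquiv hl).sumCongr ((finLtEquiv hls).sumCongr (finOddEquiv z)))
  refine ⟨e.trans (Fintype.equivFinOfCardEq ?_)⟩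
  simp only [Fintype.card_sum, Fintype.card_fin]
  omega

end Counting

namespace SpecConfig

variable {r s q z u k : ℕ} {l ls t δ : ℕ}

/-- The component that contains the point with a given label. -/
def _root_.QuadricReduction.SimpleIdx.owner : SimpleIdx r s q z u l ls t → SpecPart r s q z u
  | .line i _ _ => .old (.line i)
  | .cut i _ => .old (.cross i)
  | .uncut i _ _ _ => .old (.cross i)
  | .point i _ => .old (.point i)
  | .zigStart _ => .old .zig
  | .zigEnd _ => .old .zig
  | .sundial i _ => .sundial i
  | .zz _ => .zz

/-- The component that contains the line with a given label. -/
def _root_.QuadricReduction.RedIdx.owner : RedIdx r s z l ls → SpecPart r s q z u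
  | .line i _ => .old (.line i)
  | .cut i _ => .old (.cross i)
  | .zig _ _ => .old .zig

/-- The reduced lines of `Z` that belong to the ruling. -/
def redLine {w : ℕ} (Z : SpecConfig K r s q z u w) : RedIdx r s z l ls → Line K
  | .line i _ => Z.line i
  | .cut i _ => Z.cross i 1
  | .zig i _ => Z.zig i

/-- The points `g` are the points of the quadric on the lines and points of `Z`, except for those
on lines of the ruling and for the singular points of the sundials and the zig-zag. -/
structure IsSimpleEnum (Z : SpecConfig K r s q z u (k + 1)) (F : Coord K)
    (g : SimpleIdx r s q z u l ls t → Pt K) : Prop where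
  onQuadric : ∀ x, VanishesOn F (g x).submodule
  line : ∀ i h ε, (g (.line i h ε)).submodule ≤ (Z.line i).1
  line_ne : ∀ i h, g (.line i h 0) ≠ g (.line i h 1)
  cut : ∀ i h, (g (.cut i h)).submodule ≤ (Z.cross i 0).1
  cut_not : ∀ i h, ¬ (g (.cut i h)).submodule ≤ (Z.cross i 1).1
  uncut : ∀ i h j ε, (g (.uncut i h j ε)).submodule ≤ (Z.cross i j).1
  uncut_ne : ∀ i h j, g (.uncut i h j 0) ≠ g (.uncut i h j 1)
  point : ∀ i h, g (.point i h) = Z.point i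
  zigStart : ∀ h : 0 < z, (g (.zigStart h)).submodule ≤ (Z.zig ⟨0, h⟩).1
  zigStart_not : ∀ h j, Odd j.val → ¬ (g (.zigStart h)).submodule ≤ (Z.zig j).1
  zigEnd : ∀ h j, j.val + 1 = z → (g (.zigEnd h)).submodule ≤ (Z.zig j).1
  zigEnd_not : ∀ h j, Odd j.val → ¬ (g (.zigEnd h)).submodule ≤ (Z.zig j).1
  zig_ne : ∀ h h', g (.zigStart h) ≠ g (.zigEnd h')
  sundial : ∀ i j, (g (.sundial i j)).submodule ≤ (Z.sundial i j).1
  sundial_not : ∀ i j j', j ≠ j' → ¬ (g (.sundial i j)).submodule ≤ (Z.sundial i j').1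
  zz_zero : (g (.zz 0)).submodule ≤ (Z.zz 0).1
  zz_one : (g (.zz 1)).submodule ≤ (Z.zz (Fin.last k)).1
  zz_not : ∀ ε, ¬ Z.NodeAt .zz (g (.zz ε))
  zz_ne : g (.zz 0) ≠ g (.zz 1)

section Enum

variable {Z : SpecConfig K r s q z u (k + 1)} {F : Coord K} {ℛ : Set (Line K)}
  {g : SimpleIdx r s q z u l ls t → Pt K}

theorem IsSimpleEnum.exists_le (hg : Z.IsSimpleEnum F g) (x : SimpleIdx r s q z u l ls t) :
    ∃ U ∈ Z.allPieces x.owner, (g x).submodule ≤ U := by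
  match x with
  | .line i h ε => exact ⟨_, rfl, hg.line i h ε⟩
  | .cut i h => exact ⟨_, ⟨0, rfl⟩, hg.cut i h⟩
  | .uncut i h j ε => exact ⟨_, ⟨j, rfl⟩, hg.uncut i h j ε⟩
  | .point i h => exact ⟨_, rfl, (hg.point i h ▸ le_rfl)⟩
  | .zigStart h => exact ⟨_, ⟨⟨0, h⟩, rfl⟩, hg.zigStart h⟩
  | .zigEnd h =>
    have := h.pos
    exact ⟨_, ⟨⟨z - 1, by omega⟩, rfl⟩, hg.zigEnd h _ (by simp; omega)⟩
  | .sundial i j => exact ⟨_, ⟨j, rfl⟩, hg.sundial i j⟩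
  | .zz ε =>
    fin_cases ε
    · exact ⟨_, ⟨0, rfl⟩, hg.zz_zero⟩
    · exact ⟨_, ⟨_, rfl⟩, hg.zz_one⟩

theorem _root_.QuadricReduction.eq_of_fin_two_of_ne {α : Type*} {f : Fin 2 → α} (h : f 0 ≠ f 1)
    {i j : Fin 2} (hij : f i = f j) : i = j := by
  fin_cases i <;> fin_cases j <;> simp_all

variable (hZ : Z.IsSpecialization F ℛ δ l ls t)

-- Equal points lie on the same component, so only labels with the same owner have to be compared.
include hZ in
theorem IsSimpleEnum.injective (hg : Z.IsSimpleEnum F g) : Function.Injective g := by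
  have hw : ∀ {p : Pt K} {U W : Submodule K (Fin 4 → K)}, Disjoint U W → p.submodule ≤ U →
      ¬ p.submodule ≤ W := fun h h1 h2 => Pt.ne_bot _ (disjoint_self.1 (h.mono h1 h2))
  intro x y hxy
  obtain ⟨U, hU, hxU⟩ := hg.exists_le x
  obtain ⟨W, hW, hyW⟩ := hg.exists_le y
  have ho : x.owner = y.owner := hZ.owner_unique hU hW (p := g x) hxU (hxy ▸ hyW)
  cases x with
  | line i h ε =>
    cases y <;> simp only [SimpleIdx.owner, SpecPart.old.injEq, Part.line.injEq, reduceCtorEq] at ho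
    subst ho
    rw [eq_of_fin_two_of_ne (f := fun ε => g (.line i h ε)) (hg.line_ne i h) hxy]
  | cut i h =>
    cases y <;> simp only [SimpleIdx.owner, SpecPart.old.injEq, Part.cross.injEq, reduceCtorEq] at ho
    · subst ho; rfl
    · omega
  | uncut i h j ε =>
    cases y <;> simp only [SimpleIdx.owner, SpecPart.old.injEq, Part.cross.injEq, reduceCtorEq] at ho
    · omega
    · rename_i i' h' j' ε'
      subst ho
      -- Otherwise the point is the node of an uncut cross, which is not on the quadric.
      have hj : j = j' := by
        by_contra hne
        refine (hZ.cross_off i h).2 ?_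
        have hle : (g (.uncut i h j ε)).submodule ≤ (Z.cross i 0).1 ⊓ (Z.cross i 1).1 := by
          have h1 := hg.uncut i h j ε
          have h2 := hg.uncut i h' j' ε'
          rw [← hxy] at h2
          fin_cases j <;> fin_cases j'
          · exact absurd rfl hne
          · exact le_inf h1 h2
          · exact le_inf h2 h1
          · exact absurd rfl hne
        rw [← Pt.eq_submodule_of_le ((hZ.proper.cross_chain i).1 0 1 rfl) hle]
        exact hg.onQuadric _
      subst hj
      rw [eq_of_fin_two_of_ne (f := fun ε => g (.uncut i h j ε)) (hg.uncut_ne i h j) hxy]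
  | point i h =>
    cases y <;> simp only [SimpleIdx.owner, SpecPart.old.injEq, Part.point.injEq, reduceCtorEq] at ho
    subst ho; rfl
  | zigStart h =>
    cases y <;> simp only [SimpleIdx.owner, SpecPart.old.injEq, reduceCtorEq] at ho
    · rfl
    · exact absurd hxy (hg.zig_ne _ _)
  | zigEnd h =>
    cases y <;> simp only [SimpleIdx.owner, SpecPart.old.injEq, reduceCtorEq] at ho
    · exact absurd hxy.symm (hg.zig_ne _ _)
    · rfl
  | sundial i j =>
    cases y <;> simp only [SimpleIdx.owner, SpecPart.sundial.injEq, reduceCtorEq] at ho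
    rename_i j'
    subst ho
    by_contra hne
    refine hg.sundial_not i j j' (fun h => hne (by rw [h])) ?_
    rw [hxy]
    exact hg.sundial i j'
  | zz ε =>
    cases y <;> simp only [SimpleIdx.owner, reduceCtorEq] at ho
    rw [eq_of_fin_two_of_ne (f := fun ε => g (.zz ε)) hg.zz_ne hxy]

include hZ in
theorem IsSimpleEnum.isSimpleTracePoint (hg : Z.IsSimpleEnum F g)
    (x : SimpleIdx r s q z u l ls t) : Z.IsSimpleTracePoint F l ls t (g x) := by
  obtain ⟨U, hU, hxU⟩ := hg.exists_le x
  refine ⟨hg.onQuadric x, fun a L hL h => ?_, fun a ha => ?_, ?_⟩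
  · obtain rfl := hZ.owner_unique hL.mem_allPieces hU h hxU
    match x, hL with
    | .line i h _, hL => exact absurd hL.1 (not_lt.2 h)
    | .cut i h', hL => exact hg.cut_not i h' (hL.2 ▸ h)
    | .uncut i h _ _, hL => exact absurd hL.1 (not_lt.2 h)
    | .zigStart h', ⟨j, hj, hL⟩ => exact hg.zigStart_not h' j hj (hL ▸ h)
    | .zigEnd h', ⟨j, hj, hL⟩ => exact hg.zigEnd_not h' j hj (hL ▸ h)
  · obtain ⟨W, hW, hxW⟩ := ha.exists_mem_allPieces
    obtain rfl := hZ.owner_unique hW hU hxW hxU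
    match x, ha with
    | .sundial i 0, ha => exact hg.sundial_not i 0 1 (by simp) (ha.trans inf_le_right)
    | .sundial i 1, ha => exact hg.sundial_not i 1 0 (by simp) (ha.trans inf_le_left)
    | .zz ε, ha => exact hg.zz_not ε ha
  · match x with
    | .line i h ε => exact .inl ⟨.old (.line i), _, ⟨h, rfl⟩, hg.line i h ε⟩
    | .cut i h => exact .inl ⟨.old (.cross i), _, .inl rfl, hg.cut i h⟩
    | .uncut i h 0 ε => exact .inl ⟨.old (.cross i), _, .inl rfl, hg.uncut i h 0 ε⟩
    | .uncut i h 1 ε => exact .inl ⟨.old (.cross i), _, .inr ⟨h, rfl⟩, hg.uncut i h 1 ε⟩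
    | .point i h => exact .inr ⟨i, h, hg.point i h⟩
    | .zigStart h => exact .inl ⟨.old .zig, _, ⟨⟨0, h⟩, by simp, rfl⟩, hg.zigStart h⟩
    | .zigEnd h =>
      have := h.pos
      exact .inl ⟨.old .zig, _, ⟨⟨z - 1, by omega⟩, Nat.Odd.sub_odd h odd_one, rfl⟩,
        hg.zigEnd h _ (by simp; omega)⟩
    | .sundial i j => exact .inl ⟨.sundial i, _, ⟨j, rfl⟩, hg.sundial i j⟩
    | .zz 0 => exact .inl ⟨.zz, _, ⟨_, rfl⟩, hg.zz_zero⟩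
    | .zz 1 => exact .inl ⟨.zz, _, ⟨_, rfl⟩, hg.zz_one⟩

-- A transversal line has exactly two points on the quadric, and both are known on every such line
-- of Z. Those that are not enumerated lie on a ruling line of Z or are nodes, and such points are
-- not simple trace points.
include hZ in
theorem IsSimpleEnum.mem_range_iff (hg : Z.IsSimpleEnum F g) (hF : F.IsHomogeneous 2)
    (hℛ : IsRuling F ℛ) (p : Pt K) :
    p ∈ Set.range g ↔ Z.IsSimpleTracePoint F l ls t p := by
  refine ⟨?_, ?_⟩
  · rintro ⟨x, rfl⟩
    exact hg.isSimpleTracePoint hZ x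
  rintro ⟨hFp, hred, hnode, ⟨a, L, hL, hpL⟩ | ⟨i, hi, rfl⟩⟩
  swap
  · exact ⟨.point i hi, hg.point i hi⟩
  have hmeet : ∀ {W : Submodule K (Fin 4 → K)}, Module.finrank K W = 1 →
      ∃ y : Pt K, y.submodule = W := fun h => Pt.exists_of_finrank_eq_one h
  have hLT := hZ.transversal_of_offAt hL
  have htwo : ∀ {y y' : Pt K}, y ≠ y' → y.submodule ≤ L.1 → y'.submodule ≤ L.1 →
      VanishesOn F y.submodule → VanishesOn F y'.submodule → p = y ∨ p = y' := fun hne h1 h2 h3 h4 =>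
    hLT.eq_or_eq hF hne h1 h2 hpL h3 h4 hFp
  have hdis : ∀ {y y' : Pt K} {U W : Submodule K (Fin 4 → K)}, Disjoint U W → y.submodule ≤ U →
      y'.submodule ≤ W → y ≠ y' := fun h h1 h2 heq =>
    Pt.ne_bot _ (disjoint_self.1 (h.mono h1 (heq ▸ h2)))
  match a, hL with
  | .old (.line i), hL =>
    obtain ⟨hi, rfl⟩ := hL
    rcases htwo (hg.line_ne i hi) (hg.line i hi 0) (hg.line i hi 1) (hg.onQuadric _)
      (hg.onQuadric _) with h | h <;> exact ⟨_, h.symm⟩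
  | .old (.cross i), hL =>
    have hun : ∀ hi : ls ≤ i.val, ∀ j, L = Z.cross i j → p ∈ Set.range g := by
      rintro hi j rfl
      rcases htwo (hg.uncut_ne i hi j) (hg.uncut i hi j 0) (hg.uncut i hi j 1) (hg.onQuadric _)
        (hg.onQuadric _) with h | h <;> exact ⟨_, h.symm⟩
    rcases hL with rfl | ⟨hi, rfl⟩
    · rcases lt_or_ge i.val ls with hi | hi
      · obtain ⟨y, hy⟩ := hmeet ((hZ.proper.cross_chain i).1 0 1 rfl)
        have hy1 : y.submodule ≤ (Z.cross i 1).1 := hy.le.trans inf_le_right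
        rcases htwo (y := y) (y' := g (.cut i hi)) (fun h => hg.cut_not i hi (h ▸ hy1)) (hy.le.trans inf_le_left) (hg.cut i hi)
          ((hℛ.onQuadric _ (hZ.cross_on i hi)).mono hy1) (hg.onQuadric _) with rfl | rfl
        · exact absurd hy1 (hred (.old (.cross i)) _ ⟨hi, rfl⟩)
        · exact ⟨_, rfl⟩
      · exact hun hi 0 rfl
    · exact hun hi 1 rfl
  | .old .zig, ⟨j, hj, hL⟩ =>
    subst hL
    -- The two points of an even line of the reduced zig-zag are attached to its two sides: each is
    -- a free end or the intersection with the neighbour, which lies on the quadric because it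
    -- belongs to the ruling.
    have hleft : ∃ y : Pt K, y.submodule ≤ (Z.zig j).1 ∧ VanishesOn F y.submodule ∧
        ((∃ h, y = g (.zigStart h)) ∨ ∃ i : Fin z, i.val + 1 = j.val ∧
          y.submodule ≤ (Z.zig i).1) := by
      by_cases h0 : j.val = 0
      · have hz : 0 < z := by have := j.2; omega
        obtain rfl : j = ⟨0, hz⟩ := Fin.ext h0
        exact ⟨_, hg.zigStart hz, hg.onQuadric _, .inl ⟨hz, rfl⟩⟩
      · obtain ⟨y, hy⟩ := hmeet (hZ.proper.zig_chain.1 ⟨j.val - 1, by omega⟩ j (by simp; omega))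
        refine ⟨y, hy.le.trans inf_le_right, ?_, .inr ⟨_, by simp; omega, hy.le.trans inf_le_left⟩⟩
        exact (hℛ.onQuadric _ (hZ.zig_on ⟨j.val - 1, by omega⟩ (by simp; grind))).mono
          (hy.le.trans inf_le_left)
    have hright : ∃ y : Pt K, y.submodule ≤ (Z.zig j).1 ∧ VanishesOn F y.submodule ∧
        ((∃ h, y = g (.zigEnd h)) ∨ ∃ i : Fin z, j.val + 1 = i.val ∧
          y.submodule ≤ (Z.zig i).1) := by
      by_cases h0 : j.val + 1 = z
      · have hz : Odd z := h0 ▸ hj.add_one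
        exact ⟨_, hg.zigEnd hz j h0, hg.onQuadric _, .inl ⟨hz, rfl⟩⟩
      · have hj' : j.val + 1 < z := by have := j.2; omega
        obtain ⟨y, hy⟩ := hmeet (hZ.proper.zig_chain.1 j ⟨j.val + 1, hj'⟩ rfl)
        refine ⟨y, hy.le.trans inf_le_left, ?_, .inr ⟨_, rfl, hy.le.trans inf_le_right⟩⟩
        exact (hℛ.onQuadric _ (hZ.zig_on ⟨j.val + 1, hj'⟩ hj.add_one)).mono
          (hy.le.trans inf_le_right)
    obtain ⟨y, hy1, hy2, hy3⟩ := hleft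
    obtain ⟨y', hy1', hy2', hy3'⟩ := hright
    have hne : y ≠ y' := by
      rintro rfl
      rcases hy3 with ⟨h, rfl⟩ | ⟨i, hi, hyi⟩
      · rcases hy3' with ⟨h', he⟩ | ⟨i', hi', hyi'⟩
        · exact hg.zig_ne _ _ he
        · exact hg.zigStart_not h i' (hi' ▸ hj.add_one) hyi'
      · rcases hy3' with ⟨h', rfl⟩ | ⟨i', hi', hyi'⟩
        · exact hg.zigEnd_not h' i (by grind) hyi
        · exact hdis (hZ.proper.zig_chain.2 i i' (by omega)) hyi hyi' rfl
    rcases htwo hne hy1 hy1' hy2 hy2' with rfl | rfl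
    · rcases hy3 with ⟨h, rfl⟩ | ⟨i, hi, hyi⟩
      · exact ⟨_, rfl⟩
      · exact absurd hyi (hred (.old .zig) _ ⟨i, by grind, rfl⟩)
    · rcases hy3' with ⟨h, rfl⟩ | ⟨i, hi, hyi⟩
      · exact ⟨_, rfl⟩
      · exact absurd hyi (hred (.old .zig) _ ⟨i, hi ▸ hj.add_one, rfl⟩)
  | .sundial i, ⟨j, hL⟩ =>
    subst hL
    obtain ⟨y, hy⟩ := hmeet ((hZ.sundial_chain i).1 0 1 rfl)
    have hyj : ∀ j, y.submodule ≤ (Z.sundial i j).1 := fun j => by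
      fin_cases j
      · exact hy.le.trans inf_le_left
      · exact hy.le.trans inf_le_right
    have hnodeY : Z.NodeAt (.sundial i) y := hy.le
    have hne : y ≠ g (.sundial i j) := by
      obtain ⟨j', hj'⟩ := exists_ne j
      exact fun h => hg.sundial_not i j j' hj'.symm (h ▸ hyj j')
    rcases htwo hne (hyj j) (hg.sundial i j) (hZ.vanishesOn_of_nodeAt hnodeY) (hg.onQuadric _)
      with rfl | rfl
    · exact absurd hnodeY (hnode _)
    · exact ⟨_, rfl⟩
  | .zz, ⟨j, hL⟩ =>
    subst hL
    have hleft : ∃ y : Pt K, y.submodule ≤ (Z.zz j).1 ∧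
        (y = g (.zz 0) ∨ ∃ i : Fin (k + 1), i.val + 1 = j.val ∧
          y.submodule ≤ (Z.zz i).1 ∧ Z.NodeAt .zz y) := by
      by_cases h0 : j = 0
      · subst h0
        exact ⟨_, hg.zz_zero, .inl rfl⟩
      · have h0' : j.val ≠ 0 := fun h => h0 (Fin.ext h)
        have hij : (⟨j.val - 1, by omega⟩ : Fin (k + 1)).val + 1 = j.val := by simp; omega
        obtain ⟨y, hy⟩ := hmeet (hZ.zz_chain.1 ⟨j.val - 1, by omega⟩ j hij)
        exact ⟨y, hy.le.trans inf_le_right, .inr ⟨_, hij, hy.le.trans inf_le_left,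
          ⟨_, _, hij, hy.le⟩⟩⟩
    have hright : ∃ y : Pt K, y.submodule ≤ (Z.zz j).1 ∧
        (y = g (.zz 1) ∨ ∃ i : Fin (k + 1), j.val + 1 = i.val ∧
          y.submodule ≤ (Z.zz i).1 ∧ Z.NodeAt .zz y) := by
      by_cases h0 : j = Fin.last k
      · subst h0
        exact ⟨_, hg.zz_one, .inl rfl⟩
      · have h0' : j.val ≠ k := fun h => h0 (Fin.ext h)
        have hij : j.val + 1 = (⟨j.val + 1, by omega⟩ : Fin (k + 1)).val := rfl
        obtain ⟨y, hy⟩ := hmeet (hZ.zz_chain.1 j ⟨j.val + 1, by omega⟩ hij)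
        exact ⟨y, hy.le.trans inf_le_left, .inr ⟨_, hij, hy.le.trans inf_le_right,
          ⟨_, _, hij, hy.le⟩⟩⟩
    obtain ⟨y, hy1, hy3⟩ := hleft
    obtain ⟨y', hy1', hy3'⟩ := hright
    have hon : VanishesOn F y.submodule := by
      rcases hy3 with rfl | ⟨_, _, _, h⟩
      · exact hg.onQuadric _
      · exact hZ.vanishesOn_of_nodeAt h
    have hon' : VanishesOn F y'.submodule := by
      rcases hy3' with rfl | ⟨_, _, _, h⟩
      · exact hg.onQuadric _
      · exact hZ.vanishesOn_of_nodeAt h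
    have hne : y ≠ y' := by
      rintro rfl
      rcases hy3 with rfl | ⟨i, hi, hyi, hn⟩
      · rcases hy3' with he | ⟨i', hi', hyi', hn'⟩
        · exact hg.zz_ne he
        · exact hg.zz_not _ hn'
      · rcases hy3' with rfl | ⟨i', hi', hyi', hn'⟩
        · exact hg.zz_not _ hn
        · exact hdis (hZ.zz_chain.2 i i' (by omega)) hyi hyi' rfl
    rcases htwo hne hy1 hy1' hon hon' with rfl | rfl
    · rcases hy3 with rfl | ⟨_, _, _, h⟩
      · exact ⟨_, rfl⟩
      · exact absurd h (hnode _)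
    · rcases hy3' with rfl | ⟨_, _, _, h⟩
      · exact ⟨_, rfl⟩
      · exact absurd h (hnode _)

end Enum

end SpecConfig

end QuadricReduction

/-! ### Existence of the trace data. -/

namespace QuadricReduction

variable {K : Type*} [Field K]

namespace SpecConfig

variable {r s q z u k : ℕ} {l ls t δ : ℕ}

section RedLines

variable {w : ℕ} {Z : SpecConfig K r s q z u w} {F : Coord K} {ℛ : Set (Line K)}

theorem mem_range_redLine_iff (L : Line K) :
    L ∈ Set.range (Z.redLine (l := l) (ls := ls)) ↔ ∃ a, Z.RedAt l ls a L := by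
  constructor
  · rintro ⟨x, rfl⟩
    match x with
    | .line i h => exact ⟨.old (.line i), h, rfl⟩
    | .cut i h => exact ⟨.old (.cross i), h, rfl⟩
    | .zig i h => exact ⟨.old .zig, i, h, rfl⟩
  · rintro ⟨a, h⟩
    match a, h with
    | .old (.line i), h => exact ⟨.line i h.1, h.2.symm⟩
    | .old (.cross i), h => exact ⟨.cut i h.1, h.2.symm⟩
    | .old .zig, ⟨j, hj, h⟩ => exact ⟨.zig j hj, h.symm⟩

theorem IsSpecialization.redLine_injective (hZ : Z.IsSpecialization F ℛ δ l ls t) :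
    Function.Injective (Z.redLine (l := l) (ls := ls)) := by
  intro x y hxy
  have hmem : ∀ x : RedIdx r s z l ls, (Z.redLine x).1 ∈ Z.allPieces x.owner := fun x => by
    match x with
    | .line i h => exact rfl
    | .cut i h => exact ⟨1, rfl⟩
    | .zig i h => exact ⟨i, rfl⟩
  have ho : (x.owner : SpecPart r s q z u) = y.owner := by
    by_contra h
    have := hZ.disjoint _ _ h _ (hmem x) _ (hmem y)
    rw [hxy] at this
    exact Line.ne_bot _ (disjoint_self.1 this)
  cases x <;> cases y <;>
    simp only [RedIdx.owner, SpecPart.old.injEq, Part.line.injEq, Part.cross.injEq,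
      reduceCtorEq] at ho
  · subst ho; rfl
  · subst ho; rfl
  · rename_i i hi j hj
    have hij : i = j := by
      by_contra hne
      have hne' : i.val ≠ j.val := fun h => hne (Fin.ext h)
      have hd : ∀ i j : Fin z, i.val + 1 < j.val → Z.zig i ≠ Z.zig j := fun i j h he =>
        Line.ne_bot _ (disjoint_self.1 (he ▸ hZ.proper.zig_chain.2 i j h))
      rcases lt_or_gt_of_ne hne' with h | h
      · exact hd i j (by grind) hxy
      · exact hd j i (by grind) hxy.symm
    subst hij; rfl

end RedLines

section Assemble

variable {Z : SpecConfig K r s q z u (k + 1)} {F : Coord K} {ℛ : Set (Line K)}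
  {n p e : ℕ} {T : TraceData K δ n p e (2 - 2 * δ)}

/-- The double points with the given labels are the singular points of the sundials and of the
zig-zag. -/
def IsNodeEnum (Z : SpecConfig K r s q z u (k + 1)) (d : Fin u ⊕ Fin k → Pt K) : Prop :=
  (∀ i, (d (.inl i)).submodule ≤ (Z.sundial i 0).1 ⊓ (Z.sundial i 1).1) ∧
    ∀ i, (d (.inr i)).submodule ≤ (Z.zz i.castSucc).1 ⊓ (Z.zz i.succ).1

theorem IsNodeEnum.mem_range_iff {d : Fin u ⊕ Fin k → Pt K} (hd : Z.IsNodeEnum d)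
    (hZ : Z.IsSpecialization F ℛ δ l ls t) (x : Pt K) :
    x ∈ Set.range d ↔ ∃ a, Z.NodeAt a x := by
  constructor
  · rintro ⟨i | i, rfl⟩
    · exact ⟨.sundial i, hd.1 i⟩
    · exact ⟨.zz, i.castSucc, i.succ, by simp, hd.2 i⟩
  · rintro ⟨a, h⟩
    match a, h with
    | .sundial i, h =>
      refine ⟨.inl i, Projectivization.submodule_injective ?_⟩
      rw [Pt.eq_submodule_of_le ((hZ.sundial_chain i).1 0 1 rfl) h,
        Pt.eq_submodule_of_le ((hZ.sundial_chain i).1 0 1 rfl) (hd.1 i)]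
    | .zz, ⟨i, j, hij, h⟩ =>
      have hi : i.val < k := by have := j.2; omega
      have hj : j = Fin.succ ⟨i.val, hi⟩ := Fin.ext hij.symm
      refine ⟨.inr ⟨i.val, hi⟩, Projectivization.submodule_injective ?_⟩
      have hd' := hd.2 ⟨i.val, hi⟩
      rw [← hj, show Fin.castSucc ⟨i.val, hi⟩ = i from rfl] at hd'
      rw [Pt.eq_submodule_of_le (hZ.zz_chain.1 _ _ hij) h,
        Pt.eq_submodule_of_le (hZ.zz_chain.1 _ _ hij) hd']

theorem IsNodeEnum.injective {d : Fin u ⊕ Fin k → Pt K} (hd : Z.IsNodeEnum d)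
    (hZ : Z.IsSpecialization F ℛ δ l ls t) : Function.Injective d := by
  have hs : ∀ i, ∃ U ∈ Z.allPieces (.sundial i), (d (.inl i)).submodule ≤ U := fun i =>
    ⟨_, ⟨0, rfl⟩, (hd.1 i).trans inf_le_left⟩
  have hz : ∀ i, ∃ U ∈ Z.allPieces .zz, (d (.inr i)).submodule ≤ U := fun i =>
    ⟨_, ⟨i.castSucc, rfl⟩, (hd.2 i).trans inf_le_left⟩
  rintro (i | i) (j | j) hij
  · obtain ⟨U, hU, hiU⟩ := hs i
    obtain ⟨W, hW, hjW⟩ := hs j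
    have := hZ.owner_unique hU hW (p := d (.inl i)) hiU (hij ▸ hjW)
    simp only [SpecPart.sundial.injEq] at this
    rw [this]
  · obtain ⟨U, hU, hiU⟩ := hs i
    obtain ⟨W, hW, hjW⟩ := hz j
    exact absurd (hZ.owner_unique hU hW (p := d (.inl i)) hiU (hij ▸ hjW)) (by simp)
  · obtain ⟨U, hU, hiU⟩ := hz i
    obtain ⟨W, hW, hjW⟩ := hs j
    exact absurd (hZ.owner_unique hU hW (p := d (.inr i)) hiU (hij ▸ hjW)) (by simp)
  · have h1 := hd.2 i
    have h2 := hd.2 j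
    rw [← hij] at h2
    have hdis : ∀ a b : Fin (k + 1), (d (.inr i)).submodule ≤ (Z.zz a).1 →
        (d (.inr i)).submodule ≤ (Z.zz b).1 → ¬ a.val + 1 < b.val := fun a b ha hb h =>
      Pt.ne_bot _ (disjoint_self.1 ((hZ.zz_chain.2 a b h).mono ha hb))
    have h3 := hdis _ _ (h1.trans inf_le_left) (h2.trans inf_le_right)
    have h4 := hdis _ _ (h2.trans inf_le_left) (h1.trans inf_le_right)
    simp only [Fin.val_castSucc, Fin.val_succ] at h3 h4
    congr 1
    ext
    omega

theorem IsSpecialization.isTrace (hZ : Z.IsSpecialization F ℛ δ l ls t)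
    (hF : F.IsHomogeneous 2) (hℛ : IsRuling F ℛ) (hδ : δ = 0 ∨ δ = 1)
    (σ : SimpleIdx r s q z u l ls t ≃ Fin p) (ρ : RedIdx r s z l ls ≃ Fin n)
    (τ : Fin u ⊕ Fin k ≃ Fin e) (hfat : ∀ i, T.fatLine i = Z.fat)
    (hred : ∀ x, T.redLine (ρ x) = Z.redLine x) (hsimple : Z.IsSimpleEnum F (T.simple ∘ σ))
    (hdouble : Z.IsNodeEnum (T.double ∘ τ))
    (hmul : ∀ i, (T.multiple i).submodule ≤ Z.fat.1 ∧ VanishesOn F (T.multiple i).submodule)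
    (hmul_inj : Function.Injective T.multiple) : Z.IsTrace F l ls t T := by
  have hred' : T.redLine ∘ ρ = Z.redLine := funext hred
  refine ⟨hfat, fun L => ?_, fun x => ?_, fun x => ?_, fun x => ?_, ?_, ?_, ?_, hmul_inj⟩
  · rw [← mem_range_redLine_iff, ← hred', ρ.surjective.range_comp]
  · rw [← hsimple.mem_range_iff hZ hF hℛ, σ.surjective.range_comp]
  · rw [← hdouble.mem_range_iff hZ, τ.surjective.range_comp]
  · constructor
    · rintro ⟨i, rfl⟩
      exact ⟨by have := i.2; omega, hmul i⟩
    · rintro ⟨rfl, hx, hFx⟩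
      rcases (hZ.fat_off rfl).eq_or_eq hF (hmul_inj.ne (show (0 : Fin 2) ≠ 1 by simp)) (hmul 0).1
        (hmul 1).1 hx (hmul 0).2 (hmul 1).2 hFx with h | h <;> exact ⟨_, h.symm⟩
  · have := hZ.redLine_injective
    rw [← hred'] at this
    exact (Equiv.injective_comp ρ _).1 this
  · exact (Equiv.injective_comp σ _).1 (hsimple.injective hZ)
  · exact (Equiv.injective_comp τ _).1 (hdouble.injective hZ)

end Assemble

section Existence

variable {Z : SpecConfig K r s q z u (k + 1)} {F : Coord K} {ℛ : Set (Line K)}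

theorem IsSpecialization.exists_isNodeEnum (hZ : Z.IsSpecialization F ℛ δ l ls t) :
    ∃ d, Z.IsNodeEnum d := by
  choose d hd using fun i => Pt.exists_of_finrank_eq_one ((hZ.sundial_chain i).1 0 1 rfl)
  choose d' hd' using fun i : Fin k =>
    Pt.exists_of_finrank_eq_one (hZ.zz_chain.1 i.castSucc i.succ (by simp))
  exact ⟨Sum.elim d d', fun i => (hd i).le, fun i => (hd' i).le⟩

theorem _root_.QuadricReduction.Transversal.exists_pair {F : Coord K} {L : Line K} (hL : Transversal F L) :
    ∃ p : Fin 2 → Pt K, p 0 ≠ p 1 ∧ ∀ i, (p i).submodule ≤ L.1 ∧ VanishesOn F (p i).submodule := by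
  obtain ⟨-, x, y, hxy, hx, hy, hFx, hFy⟩ := hL
  refine ⟨![x, y], hxy, fun i => ?_⟩
  fin_cases i
  · exact ⟨hx, hFx⟩
  · exact ⟨hy, hFy⟩

/-- A transversal line that meets another line in one point meets the quadric in a point outside
the other line, if the lines meet on the quadric. -/
theorem _root_.QuadricReduction.Transversal.exists_notMem {F : Coord K} {L M : Line K} (hL : Transversal F L)
    (h : Module.finrank K ↥(L.1 ⊓ M.1) = 1) :
    ∃ p : Pt K, p.submodule ≤ L.1 ∧ VanishesOn F p.submodule ∧ ¬ p.submodule ≤ M.1 := by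
  obtain ⟨y, hy⟩ := Pt.exists_of_finrank_eq_one h
  obtain ⟨p, hne, hp, hFp⟩ := hL.exists_other y
  exact ⟨p, hp, hFp, fun hpM => hne (Pt.eq_of_le ((le_inf hp hpM).trans hy.ge))⟩

/-- A chain of lines, the first of which is transversal: a point on the first and a point on the
last line, on the quadric and outside the adjacent lines. -/
theorem _root_.QuadricReduction.IsChain.exists_ends {F : Coord K} {c : Fin (k + 1) → Line K} (hc : IsChain c)
    (h0 : Transversal F (c 0)) (h1 : Transversal F (c (Fin.last k))) :
    ∃ p : Fin 2 → Pt K, p 0 ≠ p 1 ∧ (∀ i, VanishesOn F (p i).submodule) ∧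
      (p 0).submodule ≤ (c 0).1 ∧ (p 1).submodule ≤ (c (Fin.last k)).1 ∧
      (∀ j, j ≠ 0 → ¬ (p 0).submodule ≤ (c j).1) ∧
      ∀ j, j ≠ Fin.last k → ¬ (p 1).submodule ≤ (c j).1 := by
  have hdis : ∀ {y : Pt K} {U W : Submodule K (Fin 4 → K)}, Disjoint U W → y.submodule ≤ U →
      ¬ y.submodule ≤ W := fun h h1 h2 => Pt.ne_bot _ (disjoint_self.1 (h.mono h1 h2))
  rcases Nat.eq_zero_or_pos k with rfl | hk
  -- In a chain of length one both ends lie on the same line.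
  · obtain ⟨p, hp, hp'⟩ := Transversal.exists_pair h0
    exact ⟨p, hp, fun i => (hp' i).2, (hp' 0).1, (hp' 1).1,
      fun j hj => absurd (Fin.ext (by omega)) hj,
      fun j hj => absurd (Fin.ext (by rw [Fin.val_last]; omega)) hj⟩
  · obtain ⟨x, hx, hFx, hx'⟩ := Transversal.exists_notMem h0
      (hc.1 0 ⟨1, by omega⟩ (by simp))
    have hlast : (⟨k - 1, by omega⟩ : Fin (k + 1)).val + 1 = (Fin.last k).val := by simp; omega
    obtain ⟨y, hy, hFy, hy'⟩ := Transversal.exists_notMem (M := c ⟨k - 1, by omega⟩) h1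
      (by rw [inf_comm]; exact hc.1 ⟨k - 1, by omega⟩ (Fin.last k) hlast)
    have h3 : ∀ j, j ≠ 0 → ¬ x.submodule ≤ (c j).1 := fun j hj => by
      have hj0 : j.val ≠ 0 := fun h => hj (Fin.ext h)
      by_cases h : j.val = 1
      · rwa [show j = ⟨1, by omega⟩ from Fin.ext h]
      · exact hdis (hc.2 0 j (by simp; omega)) hx
    have h4 : ∀ j, j ≠ Fin.last k → ¬ y.submodule ≤ (c j).1 := fun j hj => by
      have hj0 : j.val ≠ k := fun h => hj (Fin.ext h)
      by_cases h : j.val = k - 1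
      · rwa [show j = ⟨k - 1, by omega⟩ from Fin.ext h]
      · exact hdis (hc.2 j (Fin.last k) (by simp; omega)).symm hy
    refine ⟨![x, y], ?_, fun i => ?_, hx, hy, h3, h4⟩
    · rintro (rfl : x = y)
      refine h3 (Fin.last k) (fun h => ?_) hy
      have := congrArg Fin.val h
      simp at this
      omega
    · fin_cases i
      · exact hFx
      · exact hFy

theorem IsSpecialization.exists_isSimpleEnum (hZ : Z.IsSpecialization F ℛ δ l ls t)
    : ∃ g : SimpleIdx r s q z u l ls t → Pt K, Z.IsSimpleEnum F g := by
  have hdis : ∀ {y : Pt K} {U W : Submodule K (Fin 4 → K)}, Disjoint U W → y.submodule ≤ U →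
      ¬ y.submodule ≤ W := fun h h1 h2 => Pt.ne_bot _ (disjoint_self.1 (h.mono h1 h2))
  choose a ha ha' using fun (i : Fin r) (h : l ≤ i.val) =>
    Transversal.exists_pair (hZ.line_off i h)
  choose b hb hb' hb'' using fun i : Fin s => Transversal.exists_notMem (hZ.cross_off_zero i)
    ((hZ.proper.cross_chain i).1 0 1 rfl)
  have hcr : ∀ (i : Fin s) (h : ls ≤ i.val) (j : Fin 2), Transversal F (Z.cross i j) :=
    fun i h j => by
      fin_cases j
      · exact hZ.cross_off_zero i
      · exact (hZ.cross_off i h).1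
  choose c hc hc' using fun (i : Fin s) (h : ls ≤ i.val) (j : Fin 2) =>
    Transversal.exists_pair (hcr i h j)
  have hsu : ∀ (i : Fin u) (j : Fin 2), ∃ p : Pt K, p.submodule ≤ (Z.sundial i j).1 ∧
      VanishesOn F p.submodule ∧ ∀ j', j ≠ j' → ¬ p.submodule ≤ (Z.sundial i j').1 := by
    intro i j
    have hone := (hZ.sundial_chain i).1 0 1 rfl
    fin_cases j
    · obtain ⟨p, h1, h2, h3⟩ := Transversal.exists_notMem (hZ.sundial_off i 0) hone
      refine ⟨p, h1, h2, fun j' hj' => ?_⟩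
      fin_cases j'
      · exact absurd rfl hj'
      · exact h3
    · rw [inf_comm] at hone
      obtain ⟨p, h1, h2, h3⟩ := Transversal.exists_notMem (hZ.sundial_off i 1) hone
      refine ⟨p, h1, h2, fun j' hj' => ?_⟩
      fin_cases j'
      · exact h3
      · exact absurd rfl hj'
  choose d hd hd' hd'' using hsu
  obtain ⟨x, hx, hFx, hx0, hx1, hx0', hx1'⟩ := hZ.zz_chain.exists_ends (hZ.zz_off 0) (hZ.zz_off _)
  obtain ⟨y, hy0, hyne, hFy, hy1, hy0', hy1'⟩ : ∃ y : Fin 2 → Pt K,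
      (∀ h : 0 < z, (y 0).submodule ≤ (Z.zig ⟨0, h⟩).1) ∧ (0 < z → y 0 ≠ y 1) ∧
      (0 < z → VanishesOn F (y 0).submodule) ∧
      (Odd z → (∀ j : Fin z, j.val + 1 = z → (y 1).submodule ≤ (Z.zig j).1) ∧
        VanishesOn F (y 1).submodule) ∧
      (∀ j : Fin z, Odd j.val → ¬ (y 0).submodule ≤ (Z.zig j).1) ∧
      (Odd z → ∀ j : Fin z, Odd j.val → ¬ (y 1).submodule ≤ (Z.zig j).1) := by
    rcases Nat.eq_zero_or_pos z with rfl | hz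
    · exact ⟨fun _ => x 0, by simp, by simp, by simp, by simp, fun j => j.elim0, by simp⟩
    obtain ⟨z', rfl⟩ : ∃ z', z = z' + 1 := ⟨z - 1, by omega⟩
    by_cases hodd : Odd (z' + 1)
    · obtain ⟨y, h1, h2, h3, h4, h5, h6⟩ := hZ.proper.zig_chain.exists_ends
        (hZ.zig_off 0 (by simp)) (hZ.zig_off (Fin.last z') (by simp; grind))
      refine ⟨y, fun _ => h3, fun _ => h1, fun _ => h2 0, fun _ => ⟨fun j hj => ?_, h2 1⟩,
        fun j hj => h5 j ?_, fun _ j hj => h6 j ?_⟩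
      · obtain rfl : j = Fin.last z' := by ext; simp; omega
        exact h4
      · rintro rfl
        simp at hj
      · rintro rfl
        simp at hj
        grind
    · have hz1 : 1 < z' + 1 := by
        rcases Nat.eq_zero_or_pos z' with rfl | h
        · simp at hodd
        · omega
      obtain ⟨y, h1, h2, h3⟩ := Transversal.exists_notMem (hZ.zig_off 0 (by simp))
        (hZ.proper.zig_chain.1 0 ⟨1, hz1⟩ (by simp))
      -- For even length the last line is in the ruling and has no free end, so any point different
      -- from y can fill the second place.
      obtain ⟨y', hne, -⟩ := (hZ.zig_off 0 (by simp)).exists_other y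
      refine ⟨![y, y'], fun _ => h1, fun _ => hne.symm, fun _ => h2, fun h => absurd h hodd,
        fun j hj => ?_, fun h => absurd h hodd⟩
      by_cases hj1 : j.val = 1
      · obtain rfl : j = ⟨1, hz1⟩ := Fin.ext hj1
        exact h3
      · have hj0 : j.val ≠ 0 := by rintro h; simp [h] at hj
        exact hdis (hZ.proper.zig_chain.2 0 j (by simp; omega)) h1
  refine ⟨fun x' => match x' with
    | .line i h ε => a i h ε
    | .cut i _ => b i
    | .uncut i h j ε => c i h j ε
    | .point i _ => Z.point i
    | .zigStart _ => y 0
    | .zigEnd _ => y 1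
    | .sundial i j => d i j
    | .zz ε => x ε, ⟨?_, ?_, ?_, ?_, ?_, ?_, ?_, ?_, ?_, ?_, ?_, ?_, ?_, ?_, ?_, ?_, ?_, ?_, ?_⟩⟩
  · intro x'
    match x' with
    | .line i h ε => exact (ha' i h ε).2
    | .cut i _ => exact hb' i
    | .uncut i h j ε => exact (hc' i h j ε).2
    | .point i h => exact hZ.point_on i h
    | .zigStart h => exact hFy h
    | .zigEnd h => exact (hy1 h).2
    | .sundial i j => exact hd' i j
    | .zz ε => exact hFx ε
  · exact fun i h ε => (ha' i h ε).1
  · exact fun i h => ha i h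
  · exact fun i h => hb i
  · exact fun i h => hb'' i
  · exact fun i h j ε => (hc' i h j ε).1
  · exact fun i h j => hc i h j
  · exact fun i h => rfl
  · exact hy0
  · exact fun _ j hj => hy0' j hj
  · exact fun h j hj => (hy1 h).1 j hj
  · exact fun h j hj => hy1' h j hj
  · exact fun h _ => hyne h
  · exact hd
  · exact hd''
  · exact hx0
  · exact hx1
  · rintro ε ⟨i, j, hij, hle⟩
    fin_cases ε
    · exact hx0' j (by rintro rfl; simp at hij) (hle.trans inf_le_right)
    · exact hx1' i (by rintro rfl; have := j.2; simp at hij; omega) (hle.trans inf_le_left)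
  · exact hx

theorem IsSpecialization.exists_isTrace (hZ : Z.IsSpecialization F ℛ δ l ls t)
    (hF : F.IsHomogeneous 2) (hℛ : IsRuling F ℛ) (hδ : δ = 0 ∨ δ = 1) {n p e : ℕ}
    (σ : SimpleIdx r s q z u l ls t ≃ Fin p) (ρ : RedIdx r s z l ls ≃ Fin n)
    (τ : Fin u ⊕ Fin k ≃ Fin e) :
    ∃ T : TraceData K δ n p e (2 - 2 * δ), Z.IsTrace F l ls t T := by
  obtain ⟨g, hg⟩ := hZ.exists_isSimpleEnum
  obtain ⟨d, hd⟩ := hZ.exists_isNodeEnum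
  obtain ⟨x, hx, hx'⟩ : ∃ x : Fin (2 - 2 * δ) → Pt K, Function.Injective x ∧
      ∀ i, (x i).submodule ≤ Z.fat.1 ∧ VanishesOn F (x i).submodule := by
    rcases hδ with rfl | rfl
    · obtain ⟨x, hx, hx'⟩ := Transversal.exists_pair (hZ.fat_off rfl)
      exact ⟨x, fun i j hij => eq_of_fin_two_of_ne hx hij, hx'⟩
    · exact ⟨fun i => i.elim0, fun i => i.elim0, fun i => i.elim0⟩
  refine ⟨⟨fun _ => Z.fat, Z.redLine ∘ ρ.symm, g ∘ σ.symm, d ∘ τ.symm, x⟩, ?_⟩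
  refine hZ.isTrace hF hℛ hδ σ ρ τ (fun _ => rfl) (fun x => by simp) ?_ ?_ hx' hx
  · simpa [Function.comp_assoc] using hg
  · simpa [Function.comp_assoc] using hd

end Existence

end SpecConfig

end QuadricReduction

namespace QuadricReduction

variable {K : Type*} [Field K]

/-! ### Coordinates in which the quadric is the determinant. -/

section NormalForm

open MvPolynomial Matrix

theorem eval_line_eq_zero_iff {F : Coord K} (hF : F.IsHomogeneous 2) {L : Line K}
    (hL : VanishesOn F L.1) {u v : Fin 4 → K} (hu : u ∈ L.1) (hv : v ∈ L.1) :
    polarForm F u v = 0 := by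
  have h := eval_add_eq hF u v
  rw [hL _ (L.1.add_mem hu hv), hL u hu, hL v hv] at h
  linear_combination -h

theorem exists_ne_zero_eval_eq_zero [IsAlgClosed K] {F : Coord K} (hF : F.IsHomogeneous 2) :
    ∃ v : Fin 4 → K, v ≠ 0 ∧ eval v F = 0 := by
  set x : Fin 4 → K := Pi.single 0 1
  set y : Fin 4 → K := Pi.single 1 1
  by_cases hy : eval y F = 0
  · exact ⟨y, by simp [y], hy⟩
  obtain ⟨a, ha⟩ := IsAlgClosed.exists_root
    (Polynomial.C (eval y F) * Polynomial.X ^ 2 + Polynomial.C (polarForm F x y) * Polynomial.X +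
      Polynomial.C (eval x F)) (by rw [Polynomial.degree_quadratic hy]; simp)
  refine ⟨(1 : K) • x + a • y, fun h => ?_, ?_⟩
  · have := congrFun h 0
    simp [x, y] at this
  · rw [eval_add_smul_eq hF]
    simp [Polynomial.IsRoot] at ha
    linear_combination ha

theorem exists_two_lines [IsAlgClosed K] {F : Coord K} (hF : IsSmoothQuadric F)
    {ℛ : Set (Line K)} (hℛ : IsRuling F ℛ) : ∃ L ∈ ℛ, ∃ L' ∈ ℛ, Disjoint L.1 L'.1 := by
  have hline : ∀ v : Fin 4 → K, v ≠ 0 → eval v F = 0 → ∃ L ∈ ℛ, v ∈ L.1 := fun v hv hFv => by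
    have hmem : v ∈ (Projectivization.mk K v hv).submodule := by
      rw [Projectivization.submodule_mk]
      exact Submodule.mem_span_singleton_self v
    obtain ⟨L, hL, hle⟩ := hℛ.covers (.mk K v hv) ((Pt.vanishesOn_iff hF.1 hv hmem).2 hFv)
    exact ⟨L, hL, hle hmem⟩
  obtain ⟨u, hu, hFu⟩ := exists_ne_zero_eval_eq_zero hF.1
  obtain ⟨L, hL, huL⟩ := hline u hu hFu
  obtain ⟨w, hw⟩ := hF.exists_polarForm_ne_zero hu hFu
  -- The line through u and w meets the quadric again in x. Since B(u, x) = B(u, w) ≠ 0, no line on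
  -- the quadric contains both u and x.
  set x := (-(eval w F) / polarForm F u w) • u + (1 : K) • w with hx
  have hFx : eval x F = 0 := by
    rw [hx, eval_add_smul_eq hF.1, hFu]
    field_simp
    ring
  have hxL : x ∉ L.1 := fun h => by
    have := eval_line_eq_zero_iff hF.1 (hℛ.onQuadric L hL) huL h
    rw [hx, map_add, map_smul, map_smul, polarForm_self hF.1 hFu] at this
    simp [hw] at this
  obtain ⟨L', hL', hxL'⟩ := hline x (fun h => hxL (h ▸ L.1.zero_mem)) hFx
  exact ⟨L, hL, L', hL', hℛ.disjoint L hL L' hL' fun h => hxL (h ▸ hxL')⟩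

theorem exists_basis_line (L : Line K) : ∃ u : Fin 2 → Fin 4 → K, (∀ i, u i ∈ L.1) ∧
    LinearIndependent K u := by
  let b := Module.finBasisOfFinrankEq K L.1 L.2
  refine ⟨fun i => b i, fun i => (b i).2, ?_⟩
  exact b.linearIndependent.map' L.1.subtype (by simp)

theorem Line.exists_eq_of_basis {L : Line K} {u : Fin 2 → Fin 4 → K} (hu : ∀ i, u i ∈ L.1)
    (h : LinearIndependent K u) {x : Fin 4 → K} (hx : x ∈ L.1) :
    ∃ a b : K, x = a • u 0 + b • u 1 := by
  have h' : LinearIndependent K ![u 0, u 1] := by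
    convert h using 1
    ext i
    fin_cases i <;> rfl
  rw [← Line.span_pair_eq (hu 0) (hu 1) h', Submodule.mem_span_pair] at hx
  obtain ⟨a, b, rfl⟩ := hx
  exact ⟨a, b, rfl⟩

/-- The polar form is a perfect pairing between L and L′. A vector of L orthogonal to L′ is also
orthogonal to L, on which F vanishes, hence to L + L′ = K⁴, and this contradicts smoothness. -/
theorem exists_dual_basis {F : Coord K} (hF : IsSmoothQuadric F) {L L' : Line K}
    (hL : VanishesOn F L.1) (hd : Disjoint L.1 L'.1) :
    ∃ u w : Fin 2 → Fin 4 → K, (∀ i, u i ∈ L.1) ∧ (∀ i, w i ∈ L'.1) ∧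
      ∀ i j, polarForm F (u i) (w j) = if i = j then 1 else 0 := by
  obtain ⟨u, hu, hui⟩ := exists_basis_line L
  obtain ⟨y, hy, hyi⟩ := exists_basis_line L'
  set G : Matrix (Fin 2) (Fin 2) K := Matrix.of fun i j => polarForm F (u i) (y j) with hG
  have hdet : G.det ≠ 0 := by
    intro h0
    obtain ⟨c, hc, hcG⟩ := Matrix.exists_vecMul_eq_zero_iff.2 h0
    set x := c 0 • u 0 + c 1 • u 1 with hx
    have hxL : x ∈ L.1 := L.1.add_mem (L.1.smul_mem _ (hu 0)) (L.1.smul_mem _ (hu 1))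
    have hx0 : x ≠ 0 := fun h => hc (by
      have := Fintype.linearIndependent_iff.1 hui c (by rw [Fin.sum_univ_two]; exact h)
      exact funext this)
    obtain ⟨w, hw⟩ := hF.exists_polarForm_ne_zero hx0 (hL x hxL)
    have htop : L.1 ⊔ L'.1 = ⊤ := by
      refine Submodule.eq_top_of_disjoint _ _ ?_ hd
      rw [L.2, L'.2]
      simp
    obtain ⟨a, ha, b, hb, rfl⟩ := Submodule.mem_sup.1 (htop ▸ Submodule.mem_top : w ∈ L.1 ⊔ L'.1)
    apply hw
    rw [map_add, eval_line_eq_zero_iff hF.1 hL hxL ha, zero_add]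
    obtain ⟨d, e, rfl⟩ := Line.exists_eq_of_basis hy hyi hb
    have key : ∀ j, polarForm F x (y j) = 0 := fun j => by
      have := congrFun hcG j
      simp only [Matrix.vecMul, dotProduct, Fin.sum_univ_two, hG, Matrix.of_apply,
        Pi.zero_apply] at this
      rw [polarForm_comm hF.1, hx, map_add, map_smul, map_smul, polarForm_comm hF.1 (y j),
        polarForm_comm hF.1 (y j)]
      simpa using this
    rw [map_add, map_smul, map_smul, key, key, smul_zero, smul_zero, add_zero]
  rw [Matrix.det_fin_two] at hdet
  simp only [hG, Matrix.of_apply] at hdet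
  set D := polarForm F (u 0) (y 0) * polarForm F (u 1) (y 1) -
    polarForm F (u 0) (y 1) * polarForm F (u 1) (y 0) with hD
  -- The coefficients come from the adjugate of the Gram matrix, whose determinant is D.
  refine ⟨u, ![D⁻¹ • (polarForm F (u 1) (y 1) • y 0 - polarForm F (u 1) (y 0) • y 1),
    D⁻¹ • (polarForm F (u 0) (y 0) • y 1 - polarForm F (u 0) (y 1) • y 0)], hu, ?_, ?_⟩
  · intro i
    fin_cases i
    · exact L'.1.smul_mem _ (L'.1.sub_mem (L'.1.smul_mem _ (hy _)) (L'.1.smul_mem _ (hy _)))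
    · exact L'.1.smul_mem _ (L'.1.sub_mem (L'.1.smul_mem _ (hy _)) (L'.1.smul_mem _ (hy _)))
  · intro i j
    fin_cases i <;> fin_cases j <;>
      simp only [Fin.zero_eta, Fin.mk_one, Matrix.cons_val_zero, Matrix.cons_val_one, map_smul,
        map_sub, smul_eq_mul, if_true, zero_ne_one, one_ne_zero, if_false, Fin.isValue]
    · rw [inv_mul_eq_one₀ hdet, hD]; ring
    · ring
    · ring
    · rw [inv_mul_eq_one₀ hdet, hD]

theorem exists_vecMulVec_of_det_eq_zero {X : Matrix (Fin 2) (Fin 2) K} (h : X.det = 0) :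
    ∃ a b, X = vecMulVec a b := by
  rw [Matrix.det_fin_two] at h
  by_cases h0 : X 0 0 = 0
  · by_cases h1 : X 0 1 = 0
    · refine ⟨![0, 1], X 1, ?_⟩
      ext i j
      fin_cases i <;> fin_cases j <;> simp [vecMulVec_apply, h0, h1]
    · refine ⟨![1, X 1 1 / X 0 1], X 0, ?_⟩
      ext i j
      fin_cases i <;> fin_cases j <;> simp [vecMulVec_apply]
      · rw [h0, mul_zero]
        rw [h0, zero_mul, zero_sub, neg_eq_zero] at h
        exact (mul_eq_zero.1 h).resolve_left h1
      · field_simp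
  · refine ⟨![1, X 1 0 / X 0 0], X 0, ?_⟩
    ext i j
    fin_cases i <;> fin_cases j <;> simp [vecMulVec_apply]
    · field_simp
    · field_simp
      linear_combination h

/-- This is the polar form of the determinant at two matrices of rank at most one. It is zero
exactly if the two first factors or the two second factors are proportional. -/
theorem det_vecMulVec_add (a b c d : Fin 2 → K) :
    (vecMulVec a b + vecMulVec c d).det = (a 0 * c 1 - a 1 * c 0) * (b 0 * d 1 - b 1 * d 0) := by
  simp [Matrix.det_fin_two, vecMulVec_apply]
  ring

theorem det_vecMulVec_two (a b : Fin 2 → K) : (vecMulVec a b).det = 0 := by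
  simp [Matrix.det_fin_two, vecMulVec_apply]
  ring

theorem exists_smul_of_cross_eq_zero {a c : Fin 2 → K} (ha : a ≠ 0)
    (h : a 0 * c 1 - a 1 * c 0 = 0) : ∃ t : K, c = t • a := by
  by_cases h0 : a 0 = 0
  · have h1 : a 1 ≠ 0 := fun h1 => ha (by ext i; fin_cases i <;> assumption)
    refine ⟨c 1 / a 1, ?_⟩
    ext i
    fin_cases i <;> simp
    · rw [h0] at h ⊢
      have : a 1 * c 0 = 0 := by linear_combination -h
      simpa [h1] using this
    · field_simp
  · refine ⟨c 0 / a 0, ?_⟩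
    ext i
    fin_cases i <;> simp
    · field_simp
    · field_simp
      linear_combination h

/-- Coordinates in which the quadric is the determinant and the lines of the ruling are
`a ⊗ K²`. -/
structure IsNormalForm (F : Coord K) (ℛ : Set (Line K))
    (Φ : Matrix (Fin 2) (Fin 2) K ≃ₗ[K] (Fin 4 → K)) : Prop where
  eval_eq : ∀ X, eval (Φ X) F = X.det
  exists_line : ∀ a, a ≠ 0 → ∃ L ∈ ℛ, ∀ b, Φ (vecMulVec a b) ∈ L.1

/-- Dual bases of two disjoint ruling lines L and L′ give the coordinates. A line on the quadric
through a ⊗ b is a ⊗ K² or K² ⊗ b. The second one meets L, so it cannot be the ruling line through a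
point off L. -/
theorem exists_normalForm [IsAlgClosed K] {F : Coord K} (hF : IsSmoothQuadric F)
    {ℛ : Set (Line K)} (hℛ : IsRuling F ℛ) : ∃ Φ, IsNormalForm F ℛ Φ := by
  obtain ⟨L, hL, L', hL', hd⟩ := exists_two_lines hF hℛ
  have hFL := hℛ.onQuadric L hL
  have hFL' := hℛ.onQuadric L' hL'
  obtain ⟨u, w, hu, hw, huw⟩ := exists_dual_basis hF hFL hd
  -- The first row gives coordinates on L, and the second row, reversed and with a sign, coordinates
  -- on L′. The pairing of the dual bases then becomes X₀₀X₁₁ − X₀₁X₁₀.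
  let φ : Matrix (Fin 2) (Fin 2) K →ₗ[K] (Fin 4 → K) :=
    { toFun := fun X => (X 0 0 • u 0 + X 0 1 • u 1) + (X 1 1 • w 0 - X 1 0 • w 1)
      map_add' := fun X Y => by simp only [Matrix.add_apply, add_smul]; abel
      map_smul' := fun c X => by
        simp only [Matrix.smul_apply, smul_eq_mul, mul_smul, RingHom.id_apply, smul_add, smul_sub] }
  have hφ : ∀ X, φ X = (X 0 0 • u 0 + X 0 1 • u 1) + (X 1 1 • w 0 - X 1 0 • w 1) := fun _ => rfl
  have hinj : Function.Injective φ := by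
    rw [← LinearMap.ker_eq_bot, LinearMap.ker_eq_bot']
    intro X hX
    have h1 : ∀ j, polarForm F (w j) (φ X) = X 0 j := fun j => by
      rw [hφ, map_add, map_sub, map_smul, map_smul, eval_line_eq_zero_iff hF.1 hFL' (hw j) (hw 0),
        eval_line_eq_zero_iff hF.1 hFL' (hw j) (hw 1), map_add, map_smul, map_smul,
        polarForm_comm hF.1 _ (u 0), polarForm_comm hF.1 _ (u 1), huw, huw]
      fin_cases j <;> simp
    have h2 : ∀ j, polarForm F (u j) (φ X) = if j = 0 then X 1 1 else - X 1 0 := fun j => by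
      rw [hφ, map_add, map_sub, map_smul, map_smul, huw, huw, map_add, map_smul, map_smul,
        eval_line_eq_zero_iff hF.1 hFL (hu j) (hu 0), eval_line_eq_zero_iff hF.1 hFL (hu j) (hu 1)]
      fin_cases j <;> simp
    rw [hX] at h1 h2
    simp only [map_zero] at h1 h2
    ext i j
    fin_cases i <;> fin_cases j
    · exact (h1 0).symm
    · exact (h1 1).symm
    · simpa using (h2 1).symm
    · simpa using (h2 0).symm
  let Φ := LinearEquiv.ofInjectiveOfFinrankEq φ hinj (by simp [Module.finrank_matrix])
  have hΦ : ∀ X, Φ X = (X 0 0 • u 0 + X 0 1 • u 1) + (X 1 1 • w 0 - X 1 0 • w 1) := fun _ => rfl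
  have hdet : ∀ X, eval (Φ X) F = X.det := fun X => by
    rw [hΦ, eval_add_eq hF.1, hFL _ (L.1.add_mem (L.1.smul_mem _ (hu 0)) (L.1.smul_mem _ (hu 1))),
      hFL' _ (L'.1.sub_mem (L'.1.smul_mem _ (hw 0)) (L'.1.smul_mem _ (hw 1))), map_sub, map_smul,
      map_smul, polarForm_comm hF.1 _ (w 0), polarForm_comm hF.1 _ (w 1), map_add, map_add,
      map_smul, map_smul, map_smul, map_smul, polarForm_comm hF.1 (w 0), polarForm_comm hF.1 (w 0),
      polarForm_comm hF.1 (w 1), polarForm_comm hF.1 (w 1), huw, huw, huw, huw, Matrix.det_fin_two]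
    simp
    ring
  have hL0 : ∀ a b : Fin 2 → K, a 1 = 0 → Φ (vecMulVec a b) ∈ L.1 := fun a b ha => by
    rw [hΦ]
    simp only [vecMulVec_apply, ha, zero_mul, zero_smul, sub_zero, add_zero]
    exact L.1.add_mem (L.1.smul_mem _ (hu 0)) (L.1.smul_mem _ (hu 1))
  have hL1 : ∀ a b : Fin 2 → K, a 0 = 0 → Φ (vecMulVec a b) ∈ L'.1 := fun a b ha => by
    rw [hΦ]
    simp only [vecMulVec_apply, ha, zero_mul, zero_smul, zero_add]
    exact L'.1.sub_mem (L'.1.smul_mem _ (hw 0)) (L'.1.smul_mem _ (hw 1))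
  refine ⟨Φ, hdet, fun a ha => ?_⟩
  by_cases ha0 : a 0 = 0
  · exact ⟨L', hL', fun b => hL1 a b ha0⟩
  by_cases ha1 : a 1 = 0
  · exact ⟨L, hL, fun b => hL0 a b ha1⟩
  set b : Fin 2 → K := ![1, 0] with hb
  set x := Φ (vecMulVec a b) with hx
  have hvec : ∀ c : Fin 2 → K, vecMulVec c b = 0 → c = 0 := fun c hc => by
    ext i
    have := congrFun (congrFun hc i) 0
    simpa [vecMulVec_apply, hb] using this
  have hx0 : x ≠ 0 := fun h => ha (hvec a (Φ.map_eq_zero_iff.1 h))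
  have hmem : x ∈ (Projectivization.mk K x hx0).submodule := by
    rw [Projectivization.submodule_mk]
    exact Submodule.mem_span_singleton_self x
  obtain ⟨M, hM, hle⟩ := hℛ.covers (.mk K x hx0)
    ((Pt.vanishesOn_iff hF.1 hx0 hmem).2 (by rw [hx, hdet, det_vecMulVec_two]))
  have hxM := hle hmem
  have hFM := hℛ.onQuadric M hM
  -- If M were L, then L would also contain the component of a ⊗ b in L′.
  have hML : Disjoint M.1 L.1 := by
    refine hℛ.disjoint M hM L hL fun h => ?_
    have h1 : Φ (vecMulVec ![0, a 1] b) ∈ L'.1 := hL1 _ _ (by simp)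
    have h2 : Φ (vecMulVec ![0, a 1] b) ∈ L.1 := by
      have : vecMulVec ![0, a 1] b = vecMulVec a b - vecMulVec ![a 0, 0] b := by
        rw [eq_sub_iff_add_eq, ← add_vecMulVec]
        congr 1
        ext i
        fin_cases i <;> simp
      rw [this, map_sub]
      exact L.1.sub_mem (h ▸ hxM) (hL0 _ _ (by simp))
    have := hvec _ (Φ.map_eq_zero_iff.1 (Submodule.disjoint_def.1 hd _ h2 h1))
    exact ha1 (by simpa using congrFun this 1)
  refine ⟨M, hM, ?_⟩
  -- a second point of `M`
  obtain ⟨m, hm, hmi⟩ := exists_basis_line M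
  obtain ⟨y, hy, hxy⟩ : ∃ y ∈ M.1, LinearIndependent K ![x, y] := by
    by_contra! hcon
    have hdep : ∀ y ∈ M.1, ∃ c : K, c • x = y := fun y hy => by
      have := hcon y hy
      rw [LinearIndependent.pair_iff' hx0] at this
      push Not at this
      exact this
    obtain ⟨c, hc⟩ := hdep _ (hm 0)
    obtain ⟨d, hd'⟩ := hdep _ (hm 1)
    have h1 := Fintype.linearIndependent_iff.1 hmi ![d, -c] (by
      rw [Fin.sum_univ_two, ← hc, ← hd']
      simp [smul_smul, mul_comm])
    have hd0 : d = 0 := h1 0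
    exact hmi.ne_zero 1 (by rw [← hd', hd0, zero_smul])
  obtain ⟨Y, rfl⟩ := Φ.surjective y
  have hYdet : Y.det = 0 := by rw [← hdet]; exact hFM _ hy
  obtain ⟨c, d, rfl⟩ := exists_vecMulVec_of_det_eq_zero hYdet
  have hsum : (vecMulVec a b + vecMulVec c d).det = 0 := by
    rw [← hdet, map_add]
    exact hFM _ (M.1.add_mem hxM hy)
  rw [det_vecMulVec_add] at hsum
  have hb0 : b ≠ 0 := fun h => by simpa [hb] using congrFun h 0
  -- M lies on the quadric and joins a ⊗ b and c ⊗ d, so the two points share their first or their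
  -- second factor.
  rcases mul_eq_zero.1 hsum with h | h
  · obtain ⟨t, rfl⟩ := exists_smul_of_cross_eq_zero ha h
    have htd : vecMulVec (t • a) d = vecMulVec a (t • d) := by
      rw [smul_vecMulVec, vecMulVec_smul]
    rw [htd] at hxy hy
    have hbd : LinearIndependent K ![b, t • d] := by
      rw [LinearIndependent.pair_iff] at hxy ⊢
      intro p q hpq
      refine hxy p q ?_
      rw [hx, ← map_smul, ← map_smul, ← map_add, ← vecMulVec_smul, ← vecMulVec_smul,
        ← vecMulVec_add, hpq, vecMulVec_zero, map_zero]
    intro e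
    have he : e ∈ Submodule.span K {b, t • d} := by
      have hspan := hbd.span_eq_top_of_card_eq_finrank (by simp)
      rw [Matrix.range_cons_cons_empty] at hspan
      rw [hspan]
      trivial
    obtain ⟨p, q, rfl⟩ := Submodule.mem_span_pair.1 he
    rw [vecMulVec_add, vecMulVec_smul, vecMulVec_smul, map_add, map_smul, map_smul]
    exact M.1.add_mem (M.1.smul_mem _ hxM) (M.1.smul_mem _ hy)
  · exfalso
    obtain ⟨t, rfl⟩ := exists_smul_of_cross_eq_zero hb0 h
    have htd : vecMulVec c (t • b) = vecMulVec (t • c) b := by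
      rw [smul_vecMulVec, vecMulVec_smul]
    rw [htd] at hxy hy
    -- a combination of the two points lies on `L`
    have hz : Φ (vecMulVec ((t • c) 1 • a - a 1 • (t • c)) b) ∈ M.1 := by
      rw [sub_vecMulVec, smul_vecMulVec, smul_vecMulVec, map_sub, map_smul, map_smul]
      exact M.1.sub_mem (M.1.smul_mem _ hxM) (M.1.smul_mem _ hy)
    have hz' : Φ (vecMulVec ((t • c) 1 • a - a 1 • (t • c)) b) ∈ L.1 :=
      hL0 _ _ (by simp; ring)
    have h0 := Submodule.disjoint_def.1 hML _ hz hz'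
    rw [sub_vecMulVec, smul_vecMulVec, smul_vecMulVec, map_sub, map_smul, map_smul] at h0
    have := LinearIndependent.pair_iff.1 hxy ((t • c) 1) (- a 1) (by
      rw [neg_smul, ← sub_eq_add_neg]; exact h0)
    exact ha1 (neg_eq_zero.1 this.2)

end NormalForm

end QuadricReduction

namespace QuadricReduction

variable {K : Type*} [Field K]

/-! ### Generic vectors. -/

section Genericity

variable {V : Type*} [AddCommGroup V] [Module K V]

variable (K V) in
/-- The algebra of functions on a vector space that are polynomial on every line. -/
def lineAlgebra : Subalgebra K (V → K) where
  carrier := {f | ∀ x y, ∃ p : Polynomial K, ∀ t : K, f (x + t • y) = p.eval t}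
  mul_mem' := fun hf hg x y => by
    obtain ⟨p, hp⟩ := hf x y
    obtain ⟨q, hq⟩ := hg x y
    exact ⟨p * q, fun t => by simp [hp, hq]⟩
  add_mem' := fun hf hg x y => by
    obtain ⟨p, hp⟩ := hf x y
    obtain ⟨q, hq⟩ := hg x y
    exact ⟨p + q, fun t => by simp [hp, hq]⟩
  algebraMap_mem' := fun c x y => ⟨Polynomial.C c, fun t => by simp⟩

theorem mem_lineAlgebra_of_affine {f : V → K} (h : ∀ x y (t : K), f (x + t • y) = f x + t * f y) :
    f ∈ lineAlgebra K V := fun x y =>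
  ⟨Polynomial.C (f x) + Polynomial.X * Polynomial.C (f y), fun t => by rw [h]; simp [mul_comm t]⟩

omit [AddCommGroup V] [Module K V] in
theorem const_mem_subalgebra (S : Subalgebra K (V → K)) (c : K) : (fun _ => c) ∈ S :=
  S.algebraMap_mem c

omit [AddCommGroup V] [Module K V] in
theorem det_mem_subalgebra {S : Subalgebra K (V → K)} {n : Type*} [Fintype n] [DecidableEq n]
    {A : V → Matrix n n K} (h : ∀ i j, (fun v => A v i j) ∈ S) : (fun v => (A v).det) ∈ S := by
  have : (fun v => (A v).det) =
      ∑ σ : Equiv.Perm n, Equiv.Perm.sign σ • ∏ i, fun v => A v (σ i) i := by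
    ext v
    simp [Matrix.det_apply, Finset.sum_apply, Finset.prod_apply]
  rw [this]
  refine S.sum_mem fun σ _ => ?_
  rw [Units.smul_def]
  exact S.zsmul_mem (S.prod_mem fun i _ => h _ _) _

omit [AddCommGroup V] [Module K V] in
theorem eval_mem_subalgebra {S : Subalgebra K (V → K)} {σ : Type*} {x : V → σ → K}
    (h : ∀ i, (fun v => x v i) ∈ S) (G : MvPolynomial σ K) :
    (fun v => MvPolynomial.eval (x v) G) ∈ S := by
  induction G using MvPolynomial.induction_on with
  | C a => simpa using const_mem_subalgebra S a
  | add p q hp hq =>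
    simp only [map_add]
    exact S.add_mem hp hq
  | mul_X p i hp =>
    simp only [map_mul, MvPolynomial.eval_X]
    exact S.mul_mem hp (h i)

/-- On the line that joins a point with f ≠ 0 to a point with g ≠ 0, both restrict to nonzero
polynomials in one variable, and these have a nonzero product. -/
theorem exists_mul_ne_zero_of_mem_lineAlgebra [Infinite K] {f g : V → K}
    (hf : f ∈ lineAlgebra K V) (hg : g ∈ lineAlgebra K V) (hf0 : f ≠ 0) (hg0 : g ≠ 0) :
    f * g ≠ 0 := by
  obtain ⟨x, hx⟩ := Function.ne_iff.1 hf0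
  obtain ⟨y, hy⟩ := Function.ne_iff.1 hg0
  obtain ⟨p, hp⟩ := hf x (y - x)
  obtain ⟨q, hq⟩ := hg x (y - x)
  have hp0 : p ≠ 0 := by
    rintro rfl
    exact hx (by simpa using hp 0)
  have hq0 : q ≠ 0 := by
    rintro rfl
    exact hy (by simpa using hq 1)
  intro h
  refine mul_ne_zero hp0 hq0 (Polynomial.funext fun t => ?_)
  rw [Polynomial.eval_mul, ← hp, ← hq]
  simpa using congrFun h (x + t • (y - x))

variable (K V) in
/-- The filter generated by the nonvanishing loci of nonzero functions in `lineAlgebra`. -/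
def generic [Infinite K] : Filter V where
  sets := {s | ∃ f ∈ lineAlgebra K V, f ≠ 0 ∧ ∀ v, f v ≠ 0 → v ∈ s}
  univ_sets := ⟨1, one_mem _, one_ne_zero, fun _ _ => trivial⟩
  sets_of_superset := fun ⟨f, hf, h0, h⟩ hst => ⟨f, hf, h0, fun v hv => hst (h v hv)⟩
  inter_sets := fun ⟨f, hf, hf0, h⟩ ⟨g, hg, hg0, h'⟩ =>
    ⟨f * g, mul_mem hf hg, exists_mul_ne_zero_of_mem_lineAlgebra hf hg hf0 hg0, fun v hv =>
      ⟨h v (left_ne_zero_of_mul hv), h' v (right_ne_zero_of_mul hv)⟩⟩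

/-- One witness makes a condition generic, and different conditions may have unrelated witnesses. -/
theorem eventually_generic [Infinite K] {f : V → K} (hf : f ∈ lineAlgebra K V)
    (h : ∃ v, f v ≠ 0) : ∀ᶠ v in generic K V, f v ≠ 0 :=
  ⟨f, hf, Function.ne_iff.2 h, fun _ hv => hv⟩

instance [Infinite K] : (generic K V).NeBot := by
  refine Filter.neBot_iff.2 fun h => ?_
  obtain ⟨f, -, hf0, hf⟩ := Filter.empty_mem_iff_bot.2 h
  obtain ⟨v, hv⟩ := Function.ne_iff.1 hf0
  exact hf v hv

end Genericity

end QuadricReduction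

namespace QuadricReduction

variable {K : Type*} [Field K]

/-! ### Parameters for points on the quadric with coplanar quadruples. -/

section Parametrization

open Matrix

/-- A vector orthogonal to `w`. -/
def rot (w : Fin 2 → K) : Fin 2 → K := ![-w 1, w 0]

theorem exists_eq_smul_rot {w b : Fin 2 → K} (hw : w ≠ 0) (h : w ⬝ᵥ b = 0) :
    ∃ c : K, b = c • rot w := by
  have hr : rot w ≠ 0 := fun h0 => hw (by
    ext i
    fin_cases i
    · exact congrFun h0 1
    · exact neg_eq_zero.1 (congrFun h0 0))
  refine exists_smul_of_cross_eq_zero hr ?_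
  simp only [dotProduct, Fin.sum_univ_two] at h
  simp only [rot, cons_val_zero, cons_val_one]
  linear_combination -h

theorem dotProduct_rot (w : Fin 2 → K) : w ⬝ᵥ rot w = 0 := by
  simp [rot, dotProduct, Fin.sum_univ_two]
  ring

/-- The linear form on matrices with coefficients `M`. -/
def planeForm (M : Matrix (Fin 2) (Fin 2) K) : Matrix (Fin 2) (Fin 2) K →ₗ[K] K where
  toFun X := M 0 0 * X 0 0 + M 0 1 * X 0 1 + M 1 0 * X 1 0 + M 1 1 * X 1 1
  map_add' X Y := by simp only [Matrix.add_apply]; ring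
  map_smul' c X := by simp only [Matrix.smul_apply, smul_eq_mul, RingHom.id_apply]; ring

theorem planeForm_apply (M X : Matrix (Fin 2) (Fin 2) K) : planeForm M X =
    M 0 0 * X 0 0 + M 0 1 * X 0 1 + M 1 0 * X 1 0 + M 1 1 * X 1 1 := rfl

theorem planeForm_vecMulVec (M : Matrix (Fin 2) (Fin 2) K) (a b : Fin 2 → K) :
    planeForm M (vecMulVec a b) = a ⬝ᵥ M *ᵥ b := by
  simp [planeForm_apply, vecMulVec_apply, dotProduct, mulVec, Fin.sum_univ_two]
  ring

theorem exists_eq_planeForm (φ : Matrix (Fin 2) (Fin 2) K →ₗ[K] K) : ∃ M, φ = planeForm M := by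
  refine ⟨of fun i j => φ (single i j 1), LinearMap.ext fun X => ?_⟩
  conv_lhs => rw [matrix_eq_sum_single X]
  have : ∀ i j, φ (single i j (X i j)) = φ (single i j 1) * X i j := fun i j => by
    rw [mul_comm, ← smul_eq_mul, ← map_smul, smul_single, smul_eq_mul, mul_one]
  simp [Fin.sum_univ_two, this, planeForm_apply]
  ring

theorem planeForm_ne_zero {M : Matrix (Fin 2) (Fin 2) K} (hM : M ≠ 0) : planeForm M ≠ 0 :=
  fun h => hM (by
    have h' : ∀ i j, planeForm M (single i j 1) = 0 := fun i j => by rw [h]; rfl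
    ext i j
    have := h' i j
    fin_cases i <;> fin_cases j <;> simpa [planeForm_apply, single_apply] using this)

/-- A point `a ⊗ b` in the plane given by `M`, in one of two charts. -/
def planePt (k : Bool) (M : Matrix (Fin 2) (Fin 2) K) (a b : Fin 2 → K) (c : K) :
    Matrix (Fin 2) (Fin 2) K :=
  if k then vecMulVec a (c • rot (a ᵥ* M)) else vecMulVec (c • rot (M *ᵥ b)) b

variable (K) in
/-- Parameters for families of points on the quadric `det = 0`. -/
abbrev Par (Λ ι : Type*) := (Λ → Fin 2 → K) × (Λ → Fin 2 → K) × (Λ → Fin 2 → K) × (Λ → K) ×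
  (ι → Matrix (Fin 2) (Fin 2) K)

variable {Λ ι : Type*} (blk : Λ → Option ι) (chart : Λ → Bool)

/-- Two points on a line of the ruling for every label; the first points with labels in one
block are coplanar. -/
def parPt (v : Par K Λ ι) (x : Λ × Bool) : Matrix (Fin 2) (Fin 2) K :=
  if x.2 then vecMulVec (v.1 x.1) (v.2.2.1 x.1) else
    match blk x.1 with
    | none => vecMulVec (v.1 x.1) (v.2.1 x.1)
    | some j => planePt (chart x.1) (v.2.2.2.2 j) (v.1 x.1) (v.2.1 x.1) (v.2.2.2.1 x.1)

variable {V : Type*} {S : Subalgebra K (V → K)}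

theorem vecMulVec_mem_subalgebra {a b : V → Fin 2 → K} (ha : ∀ i, (fun v => a v i) ∈ S)
    (hb : ∀ i, (fun v => b v i) ∈ S) (i j : Fin 2) : (fun v => vecMulVec (a v) (b v) i j) ∈ S :=
  S.mul_mem (ha i) (hb j)

theorem rot_mem_subalgebra {a : V → Fin 2 → K} (ha : ∀ i, (fun v => a v i) ∈ S) (i : Fin 2) :
    (fun v => rot (a v) i) ∈ S := by
  fin_cases i
  · exact S.neg_mem (ha 1)
  · exact ha 0

theorem mulVec_mem_subalgebra {M : V → Matrix (Fin 2) (Fin 2) K} {a : V → Fin 2 → K}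
    (hM : ∀ i j, (fun v => M v i j) ∈ S) (ha : ∀ i, (fun v => a v i) ∈ S) (i : Fin 2) :
    (fun v => (M v *ᵥ a v) i) ∈ S := by
  simp only [mulVec, dotProduct, Fin.sum_univ_two]
  exact S.add_mem (S.mul_mem (hM _ _) (ha _)) (S.mul_mem (hM _ _) (ha _))

theorem vecMul_mem_subalgebra {M : V → Matrix (Fin 2) (Fin 2) K} {a : V → Fin 2 → K}
    (hM : ∀ i j, (fun v => M v i j) ∈ S) (ha : ∀ i, (fun v => a v i) ∈ S) (i : Fin 2) :
    (fun v => (a v ᵥ* M v) i) ∈ S := by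
  simp only [vecMul, dotProduct, Fin.sum_univ_two]
  exact S.add_mem (S.mul_mem (ha _) (hM _ _)) (S.mul_mem (ha _) (hM _ _))

theorem parPt_mem_lineAlgebra (x : Λ × Bool) (i j : Fin 2) :
    (fun v => parPt blk chart v x i j) ∈ lineAlgebra K (Par K Λ ι) := by
  obtain ⟨l, ε⟩ := x
  have ha : ∀ i, (fun v : Par K Λ ι => v.1 l i) ∈ lineAlgebra K (Par K Λ ι) := fun i =>
    mem_lineAlgebra_of_affine fun x y t => by simp
  have hb : ∀ i, (fun v : Par K Λ ι => v.2.1 l i) ∈ lineAlgebra K (Par K Λ ι) := fun i =>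
    mem_lineAlgebra_of_affine fun x y t => by simp
  have hb' : ∀ i, (fun v : Par K Λ ι => v.2.2.1 l i) ∈ lineAlgebra K (Par K Λ ι) := fun i =>
    mem_lineAlgebra_of_affine fun x y t => by simp
  have hc : (fun v : Par K Λ ι => v.2.2.2.1 l) ∈ lineAlgebra K (Par K Λ ι) :=
    mem_lineAlgebra_of_affine fun x y t => by simp
  have hM : ∀ k i j, (fun v : Par K Λ ι => v.2.2.2.2 k i j) ∈ lineAlgebra K (Par K Λ ι) :=
    fun k i j => mem_lineAlgebra_of_affine fun x y t => by simp
  cases ε with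
  | true => exact vecMulVec_mem_subalgebra ha hb' i j
  | false =>
    rcases hl : blk l with - | k
    · simp only [parPt, hl, Bool.false_eq_true, if_false]
      exact vecMulVec_mem_subalgebra ha hb i j
    · simp only [parPt, hl, Bool.false_eq_true, if_false, planePt]
      rcases chart l
      swap
      · exact vecMulVec_mem_subalgebra ha (fun i => mul_mem hc
          (rot_mem_subalgebra (vecMul_mem_subalgebra (hM k) ha) i)) i j
      · exact vecMulVec_mem_subalgebra (fun i => mul_mem hc
          (rot_mem_subalgebra (mulVec_mem_subalgebra (hM k) hb) i)) hb i j

/-- If aM ≠ 0, the equation a·Mb = 0 forces b to be a multiple of rot(aM); likewise a is a multiple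
of rot(Mb) in the other chart. The scalar parameter adjusts the multiple, so the given matrix itself
is attained and not only its class. -/
theorem exists_parPt_eq (a b : Λ → Fin 2 → K) (M : ι → Matrix (Fin 2) (Fin 2) K)
    (h : ∀ l j, blk l = some j → a l ⬝ᵥ M j *ᵥ b l = 0 ∧
      if chart l then a l ᵥ* M j ≠ 0 else M j *ᵥ b l ≠ 0) (b' : Λ → Fin 2 → K) :
    ∃ v : Par K Λ ι, v.2.2.2.2 = M ∧ ∀ l, parPt blk chart v (l, false) = vecMulVec (a l) (b l) ∧
      parPt blk chart v (l, true) = vecMulVec (a l) (b' l) := by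
  have hc : ∀ l, ∃ c : K, ∀ j, blk l = some j →
      planePt (chart l) (M j) (a l) (b l) c = vecMulVec (a l) (b l) := fun l => by
    rcases hl : blk l with - | j
    · exact ⟨0, by simp⟩
    obtain ⟨h1, h2⟩ := h l j hl
    unfold planePt
    rcases hk : chart l
    · rw [hk] at h2
      obtain ⟨c, hc⟩ := exists_eq_smul_rot (w := M j *ᵥ b l) (b := a l) (by simpa using h2)
        (by rw [dotProduct_comm]; exact h1)
      refine ⟨c, fun j' hj' => ?_⟩
      cases hj'
      simp only [Bool.false_eq_true, if_false]
      rw [← hc]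
    · rw [hk] at h2
      obtain ⟨c, hc⟩ := exists_eq_smul_rot (w := a l ᵥ* M j) (b := b l) (by simpa using h2)
        (by rw [← dotProduct_mulVec]; exact h1)
      refine ⟨c, fun j' hj' => ?_⟩
      cases hj'
      simp only [if_true]
      rw [← hc]
  choose c hc using hc
  refine ⟨(a, b, b', c, M), rfl, fun l => ⟨?_, rfl⟩⟩
  rcases hl : blk l with - | j
  · simp [parPt, hl]
  · simp [parPt, hl, hc l j hl]

/-- For invertible M both charts reach every point of the plane section, so witnesses for generic
conditions need not depend on the choice of charts. -/
theorem exists_parPt_eq_of_det_ne_zero (a : Λ → Fin 2 → K) (b : Λ × Bool → Fin 2 → K)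
    (M : ι → Matrix (Fin 2) (Fin 2) K) (hM : ∀ j, (M j).det ≠ 0)
    (h : ∀ l j, blk l = some j → a l ≠ 0 ∧ b (l, false) ≠ 0 ∧ a l ⬝ᵥ M j *ᵥ b (l, false) = 0) :
    ∃ v : Par K Λ ι, v.2.2.2.2 = M ∧ ∀ x, parPt blk chart v x = vecMulVec (a x.1) (b x) := by
  obtain ⟨v, hv, hv'⟩ := exists_parPt_eq blk chart a (fun l => b (l, false)) M (fun l j hl => by
    obtain ⟨ha, hb, hab⟩ := h l j hl
    refine ⟨hab, ?_⟩
    split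
    · exact fun h => ha (eq_zero_of_vecMul_eq_zero (hM j) h)
    · exact fun h => hb (eq_zero_of_mulVec_eq_zero (hM j) h)) fun l => b (l, true)
  refine ⟨v, hv, ?_⟩
  rintro ⟨l, _ | _⟩
  · exact (hv' l).1
  · exact (hv' l).2

theorem exists_parPt_eq_vecMulVec (v : Par K Λ ι) (x : Λ × Bool) :
    ∃ a b, parPt blk chart v x = vecMulVec a b := by
  unfold parPt planePt
  split
  · exact ⟨_, _, rfl⟩
  · split
    · exact ⟨_, _, rfl⟩
    · split <;> exact ⟨_, _, rfl⟩

theorem planeForm_parPt {l : Λ} {j : ι} (hl : blk l = some j) (v : Par K Λ ι) :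
    planeForm (v.2.2.2.2 j) (parPt blk chart v (l, false)) = 0 := by
  simp only [parPt, hl, Bool.false_eq_true, if_false, planePt]
  split
  · rw [planeForm_vecMulVec, dotProduct_mulVec, dotProduct_smul, dotProduct_rot, smul_zero]
  · rw [planeForm_vecMulVec, smul_dotProduct, dotProduct_comm, dotProduct_rot, smul_zero]

end Parametrization

end QuadricReduction

namespace QuadricReduction

variable {K : Type*} [Field K]

/-! ### Linear algebra of coplanar quadruples. -/

section GeneralPosition

open Matrix

/-- The entries of a `2 × 2` matrix as a vector. -/
def flatten : Matrix (Fin 2) (Fin 2) K →ₗ[K] (Fin 4 → K) where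
  toFun X := ![X 0 0, X 0 1, X 1 0, X 1 1]
  map_add' X Y := by ext i; fin_cases i <;> rfl
  map_smul' c X := by ext i; fin_cases i <;> rfl

theorem flatten_mem_subalgebra {V : Type*} {S : Subalgebra K (V → K)}
    {A : V → Matrix (Fin 2) (Fin 2) K} (hA : ∀ i j, (fun v => A v i j) ∈ S) (i : Fin 4) :
    (fun v => flatten (A v) i) ∈ S := by
  fin_cases i <;> exact hA _ _

theorem flatten_injective : Function.Injective (flatten (K := K)) := fun X Y h => by
  ext i j
  fin_cases i <;> fin_cases j
  · exact congrFun h 0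
  · exact congrFun h 1
  · exact congrFun h 2
  · exact congrFun h 3

theorem linearIndependent_iff_det_flatten_ne_zero {X : Fin 4 → Matrix (Fin 2) (Fin 2) K} :
    LinearIndependent K X ↔ (of fun i => flatten (X i)).det ≠ 0 := by
  rw [← isUnit_iff_ne_zero, ← isUnit_iff_isUnit_det, ← linearIndependent_rows_iff_isUnit]
  exact (LinearMap.linearIndependent_iff_of_injOn flatten flatten_injective.injOn).symm

/-- Independence of three vectors in dimension four is not the nonvanishing of one determinant, but
it follows from one after a fixed fourth vector is adjoined. -/
theorem exists_linearIndependent_ne {W : Type*} [AddCommGroup W] [Module K W]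
    [FiniteDimensional K W] (hW : Module.finrank K W = 4) (i₀ : Fin 4) {y : Fin 4 → W}
    (hy : LinearIndependent K fun i : {i : Fin 4 // i ≠ i₀} => y i) :
    ∃ w, LinearIndependent K (Function.update y i₀ w) := by
  have hlt : Submodule.span K (Set.range fun i : {i : Fin 4 // i ≠ i₀} => y i) < ⊤ := by
    refine lt_top_iff_ne_top.2 fun h => ?_
    have h1 := finrank_span_eq_card hy
    rw [h, finrank_top, hW] at h1
    simp [Fintype.card_subtype_compl] at h1
  obtain ⟨w, -, hw⟩ := SetLike.exists_of_lt hlt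
  refine ⟨w, ?_⟩
  rw [← linearIndependent_equiv (Equiv.optionSubtypeNe i₀), linearIndependent_option]
  have : (Function.update y i₀ w ∘ Equiv.optionSubtypeNe i₀) ∘ (some : {i // i ≠ i₀} → _) =
      fun i : {i : Fin 4 // i ≠ i₀} => y i := by
    ext i
    simp [Function.update_of_ne i.2]
  refine ⟨?_, ?_⟩
  · erw [this]
    exact hy
  · erw [this]
    simpa using hw

theorem LinearIndependent.of_update {W : Type*} [AddCommGroup W] [Module K W] {i₀ : Fin 4}
    {y : Fin 4 → W} {w : W} (h : LinearIndependent K (Function.update y i₀ w)) :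
    LinearIndependent K fun i : {i : Fin 4 // i ≠ i₀} => y i := by
  convert h.comp (Subtype.val : {i : Fin 4 // i ≠ i₀} → Fin 4) Subtype.val_injective using 1
  ext i
  simp [Function.update_of_ne i.2]

theorem not_forall_mem_of_finrank_le_two {W : Type*} [AddCommGroup W] [Module K W]
    [FiniteDimensional K W] {y : Fin 4 → W} {i j k : Fin 4} (hij : i ≠ j) (hik : i ≠ k)
    (hjk : j ≠ k) (hy : ∀ i₀, LinearIndependent K fun i : {i : Fin 4 // i ≠ i₀} => y i)
    {S : Submodule K W} (hS : Module.finrank K S ≤ 2) : ¬ (y i ∈ S ∧ y j ∈ S ∧ y k ∈ S) := by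
  rintro ⟨hi, hj, hk⟩
  have key : ∀ i j k : Fin 4, i ≠ j → i ≠ k → j ≠ k →
      ∃ i₀ : Fin 4, ∀ x, x ≠ i₀ → x = i ∨ x = j ∨ x = k := by decide
  obtain ⟨i₀, h₀⟩ := key i j k hij hik hjk
  have h1 := finrank_span_eq_card (hy i₀)
  have h2 : Submodule.span K (Set.range fun i : {i : Fin 4 // i ≠ i₀} => y i) ≤ S := by
    rw [Submodule.span_le]
    rintro _ ⟨⟨x, hx⟩, rfl⟩
    rcases h₀ x hx with rfl | rfl | rfl <;> assumption
  have h3 := Submodule.finrank_mono h2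
  have h4 : Fintype.card {i : Fin 4 // i ≠ i₀} = 3 := by simp [Fintype.card_subtype_compl]
  omega

theorem finrank_range_le_two (f : (Fin 2 → K) →ₗ[K] Matrix (Fin 2) (Fin 2) K) :
    Module.finrank K (LinearMap.range f) ≤ 2 := by
  simpa using f.finrank_range_le

theorem eq_zero_of_dotProduct_eq_zero {u v w : Fin 2 → K} (h : u 0 * v 1 - u 1 * v 0 ≠ 0)
    (hu : u ⬝ᵥ w = 0) (hv : v ⬝ᵥ w = 0) : w = 0 := by
  simp only [dotProduct, Fin.sum_univ_two] at hu hv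
  ext i
  refine (mul_eq_zero.1 (?_ : (u 0 * v 1 - u 1 * v 0) * w i = 0)).resolve_left h
  fin_cases i
  · simp only [Fin.zero_eta]
    linear_combination v 1 * hu - u 1 * hv
  · simp only [Fin.mk_one]
    linear_combination u 0 * hv - v 0 * hu

/-- Four coplanar points on the quadric, no three of which are collinear: none of them is the
point at which the plane touches the quadric. -/
theorem vecMul_ne_zero_or_mulVec_ne_zero {a b : Fin 4 → Fin 2 → K}
    {M : Matrix (Fin 2) (Fin 2) K} (hM : M ≠ 0) (h : ∀ i, a i ⬝ᵥ M *ᵥ b i = 0)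
    (hy : ∀ i₀, LinearIndependent K fun i : {i : Fin 4 // i ≠ i₀} => vecMulVec (a i) (b i))
    (i : Fin 4) : a i ᵥ* M ≠ 0 ∨ M *ᵥ b i ≠ 0 := by
  by_contra! hcon
  obtain ⟨h1, h2⟩ := hcon
  have hne : ∀ j, vecMulVec (a j) (b j) ≠ 0 := fun j => by
    have hk : ∃ k : Fin 4, j ≠ k := by revert j; decide
    obtain ⟨k, hk⟩ := hk
    exact (hy k).ne_zero ⟨j, hk⟩
  have ha : ∀ j, a j ≠ 0 := fun j h => hne j (by rw [h, zero_vecMulVec])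
  have hb : ∀ j, b j ≠ 0 := fun j h => hne j (by rw [h, vecMulVec_zero])
  -- A plane tangent at point i cuts the quadric in the two lines through this point, so every other
  -- point has a factor in common with it. Otherwise M would annihilate a basis.
  have hor : ∀ j, (∃ t : K, a j = t • a i) ∨ ∃ t : K, b j = t • b i := fun j => by
    by_contra! hcon
    obtain ⟨hn1, hn2⟩ := hcon
    have hc1 : a i 0 * a j 1 - a i 1 * a j 0 ≠ 0 := fun h =>
      (exists_smul_of_cross_eq_zero (ha i) h).elim hn1
    have hc2 : b i 0 * b j 1 - b i 1 * b j 0 ≠ 0 := fun h =>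
      (exists_smul_of_cross_eq_zero (hb i) h).elim hn2
    have hMb : M *ᵥ b j = 0 := eq_zero_of_dotProduct_eq_zero hc1
      (by rw [dotProduct_mulVec, h1, zero_dotProduct]) (h j)
    refine hM (Matrix.ext fun k l => congrFun (eq_zero_of_dotProduct_eq_zero hc2 (w := M k) ?_ ?_) l)
    · rw [dotProduct_comm]
      exact congrFun h2 k
    · rw [dotProduct_comm]
      exact congrFun hMb k
  classical
  -- Three points are distributed over two lines through point i, so two of them are collinear with
  -- it.
  obtain ⟨j, k, hjk, heq⟩ := Fintype.exists_ne_map_eq_of_card_lt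
    (fun j : {j : Fin 4 // j ≠ i} => decide (∃ t : K, a j = t • a i))
    (by simp [Fintype.card_subtype_compl])
  have hjk' : j.1 ≠ k.1 := fun h => hjk (Subtype.ext h)
  by_cases hj : ∃ t : K, a j = t • a i
  · have hk : ∃ t : K, a k = t • a i := by simpa [hj] using heq
    refine not_forall_mem_of_finrank_le_two (y := fun i => vecMulVec (a i) (b i)) j.2.symm k.2.symm
      hjk' hy (finrank_range_le_two (K := K)
        { toFun := fun x => vecMulVec (a i) x
          map_add' := fun x y => vecMulVec_add _ _ _
          map_smul' := fun c x => vecMulVec_smul _ _ _ }) ⟨⟨_, rfl⟩, ?_, ?_⟩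
    · obtain ⟨t, ht⟩ := hj
      exact ⟨t • b j, by simp [ht, smul_vecMulVec]⟩
    · obtain ⟨t, ht⟩ := hk
      exact ⟨t • b k, by simp [ht, smul_vecMulVec]⟩
  · have hk : ¬ ∃ t : K, a k = t • a i := by simpa [hj] using heq
    refine not_forall_mem_of_finrank_le_two (y := fun i => vecMulVec (a i) (b i)) j.2.symm k.2.symm
      hjk' hy (finrank_range_le_two (K := K)
        { toFun := fun x => vecMulVec x (b i)
          map_add' := fun x y => add_vecMulVec _ _ _
          map_smul' := fun c x => smul_vecMulVec _ _ _ }) ⟨⟨_, rfl⟩, ?_, ?_⟩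
    · obtain ⟨t, ht⟩ := (hor j).resolve_left hj
      exact ⟨t • a j, by simp [ht, vecMulVec_smul]⟩
    · obtain ⟨t, ht⟩ := (hor k).resolve_left hk
      exact ⟨t • a k, by simp [ht, vecMulVec_smul]⟩

end GeneralPosition

end QuadricReduction

namespace QuadricReduction

variable {K : Type*} [Field K]

/-! ### Realization of a given configuration, and witnesses for general position. -/

section GeneralPosition

open Matrix

variable {Λ ι : Type*} {blk : Λ → Option ι}

/-- The given configuration is a value of the parametrization for a suitable choice of charts. So an
open condition that it satisfies does not vanish identically on the parameter space. -/
theorem exists_realization {F : Coord K} {ℛ : Set (Line K)}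
    {Φ : Matrix (Fin 2) (Fin 2) K ≃ₗ[K] (Fin 4 → K)} (hΦ : IsNormalForm F ℛ Φ)
    {quad : ι × Fin 4 ↪ Λ} (hblk : ∀ l j, blk l = some j ↔ ∃ i, quad (j, i) = l)
    {v₀ : Λ → Fin 4 → K} (h0 : ∀ l, MvPolynomial.eval (v₀ l) F = 0)
    (hq : ∀ j, ¬ LinearIndependent K (fun i : Fin 4 => v₀ (quad (j, i))) ∧
      ∀ i₀, LinearIndependent K (fun i : {i : Fin 4 // i ≠ i₀} => v₀ (quad (j, i.1)))) :
    ∃ (chart : Λ → Bool) (v : Par K Λ ι), ∀ l, Φ (parPt blk chart v (l, false)) = v₀ l := by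
  have hab : ∀ l, ∃ a b, Φ.symm (v₀ l) = vecMulVec a b := fun l =>
    exists_vecMulVec_of_det_eq_zero (by rw [← hΦ.eval_eq, Φ.apply_symm_apply, h0])
  choose a b hab using hab
  -- Four dependent vectors of a quadruple lie in the kernel of a nonzero linear form.
  have hM : ∀ j, ∃ M : Matrix (Fin 2) (Fin 2) K, M ≠ 0 ∧
      ∀ i, a (quad (j, i)) ⬝ᵥ M *ᵥ b (quad (j, i)) = 0 := fun j => by
    have hlt : Submodule.span K (Set.range fun i => Φ.symm (v₀ (quad (j, i)))) < ⊤ := by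
      refine lt_top_iff_ne_top.2 fun h => (hq j).1 ?_
      have h1 : LinearIndependent K fun i => Φ.symm (v₀ (quad (j, i))) :=
        linearIndependent_of_top_le_span_of_card_eq_finrank h.ge (by simp [Module.finrank_matrix])
      have h2 := h1.map' Φ.toLinearMap Φ.ker
      simpa [Function.comp_def] using h2
    obtain ⟨φ, hφ, hle⟩ := Submodule.exists_le_ker_of_lt_top _ hlt
    obtain ⟨M, rfl⟩ := exists_eq_planeForm φ
    refine ⟨M, ?_, fun i => ?_⟩
    · rintro rfl
      exact hφ (LinearMap.ext fun X => by simp [planeForm_apply])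
    · rw [← planeForm_vecMulVec, ← hab]
      exact hle (Submodule.subset_span ⟨i, rfl⟩)
  choose M hM0 hM using hM
  have hy : ∀ j i₀, LinearIndependent K fun i : {i : Fin 4 // i ≠ i₀} =>
      vecMulVec (a (quad (j, i))) (b (quad (j, i))) := fun j i₀ => by
    have h2 := ((hq j).2 i₀).map' Φ.symm.toLinearMap Φ.symm.ker
    simpa [Function.comp_def, hab] using h2
  classical
  -- The first chart is used where aM ≠ 0. Where aM = 0, the absence of three collinear points gives
  -- Mb ≠ 0.
  refine ⟨fun l => decide (∃ j, blk l = some j ∧ a l ᵥ* M j ≠ 0), ?_⟩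
  obtain ⟨v, -, hv⟩ := exists_parPt_eq blk
    (fun l => decide (∃ j, blk l = some j ∧ a l ᵥ* M j ≠ 0)) a b M (fun l j hl => by
      obtain ⟨i, rfl⟩ := (hblk l j).1 hl
      refine ⟨hM j i, ?_⟩
      by_cases h : a (quad (j, i)) ᵥ* M j = 0
      · simpa [hl, h] using (vecMul_ne_zero_or_mulVec_ne_zero (a := fun i => a (quad (j, i)))
          (b := fun i => b (quad (j, i))) (hM0 j) (hM j) (hy j) i).resolve_left (not_not.2 h)
      · simp [hl, h]) b
  exact ⟨v, fun l => by rw [(hv l).1, ← hab, Φ.apply_symm_apply]⟩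

section Generic

variable {chart : Λ → Bool}

/-- The function that is `e₀` on `s` and `e₁` elsewhere. -/
noncomputable def splitVec {α : Type*} (s : Set α) (x : α) : Fin 2 → K :=
  open Classical in if x ∈ s then ![1, 0] else ![0, 1]

theorem splitVec_ne_zero {α : Type*} (s : Set α) (x : α) : splitVec (K := K) s x ≠ 0 := by
  unfold splitVec
  split
  · exact fun h => one_ne_zero (congrFun h 0)
  · exact fun h => one_ne_zero (congrFun h 1)

theorem splitVec_of_mem {α : Type*} {s : Set α} {x : α} (h : x ∈ s) :
    splitVec (K := K) s x = ![1, 0] := if_pos h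

theorem splitVec_of_notMem {α : Type*} {s : Set α} {x : α} (h : x ∉ s) :
    splitVec (K := K) s x = ![0, 1] := if_neg h

/-- The matrix of the plane `x₀₁ + x₁₀ = 0`. -/
def swapMatrix : Matrix (Fin 2) (Fin 2) K := !![0, 1; 1, 0]

theorem det_swapMatrix : (swapMatrix (K := K)).det = -1 := by simp [swapMatrix]

-- All factors are e₀ or e₁. The points e₀ ⊗ e₀ and e₁ ⊗ e₁ lie in the plane x₀₁ + x₁₀ = 0, so a
-- point in a block is admissible if its two factors agree, which is the condition on `s` and `t`.
variable (chart) in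
theorem exists_parPt_eq_splitVec (s : Set Λ) (t : Set (Λ × Bool))
    (h : ∀ l, blk l ≠ none → (l ∈ s ↔ (l, false) ∈ t)) :
    ∃ v : Par K Λ ι, ∀ x, parPt blk chart v x = vecMulVec (splitVec s x.1) (splitVec t x) := by
  obtain ⟨v, -, hv⟩ := exists_parPt_eq_of_det_ne_zero blk chart (splitVec s) (splitVec t)
    (fun _ => swapMatrix (K := K)) (fun _ => by simp [det_swapMatrix]) fun l j hl => by
      refine ⟨splitVec_ne_zero _ _, splitVec_ne_zero _ _, ?_⟩
      have := h l (by simp [hl])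
      by_cases hs : l ∈ s
      · rw [splitVec_of_mem hs, splitVec_of_mem (this.1 hs)]
        simp [swapMatrix, dotProduct, mulVec, Fin.sum_univ_two]
      · rw [splitVec_of_notMem hs, splitVec_of_notMem (fun h => hs (this.2 h))]
        simp [swapMatrix, dotProduct, mulVec, Fin.sum_univ_two]
  exact ⟨v, hv⟩

theorem parPt_rows_mem (x : Fin 4 → Λ × Bool) :
    (fun v => (of fun i => flatten (parPt blk chart v (x i))).det) ∈
      lineAlgebra K (Par K Λ ι) :=
  det_mem_subalgebra fun _ _ => flatten_mem_subalgebra (parPt_mem_lineAlgebra _ _ _) _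

/-- Four points that form two pairs with different labels. -/
theorem exists_parPt_linearIndependent {x : Fin 4 → Λ × Bool} (hx : Function.Injective x)
    (hb : ∀ i, blk (x i).1 = none) :
    ∃ v : Par K Λ ι, LinearIndependent K fun i => parPt blk chart v (x i) := by
  have key : ∀ π : Equiv.Perm (Fin 4), (x (π 0)).1 ≠ (x (π 2)).1 → (x (π 0)).1 ≠ (x (π 3)).1 →
      (x (π 1)).1 ≠ (x (π 2)).1 → (x (π 1)).1 ≠ (x (π 3)).1 →
      ∃ v : Par K Λ ι, LinearIndependent K fun i => parPt blk chart v (x i) := by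
    intro π h02 h03 h12 h13
    have hne : ∀ i j, x (π i) = x (π j) ↔ i = j := fun i j => by
      rw [hx.eq_iff, π.injective.eq_iff]
    -- In the order given by π the points become e₀ ⊗ e₀, e₀ ⊗ e₁, e₁ ⊗ e₀, e₁ ⊗ e₁.
    obtain ⟨v, hv⟩ := exists_parPt_eq_splitVec (K := K) (blk := blk) chart
      {(x (π 0)).1, (x (π 1)).1}
      {x (π 0), x (π 2)}
      (by
        intro l hl
        have h1 : ∀ i, (x i).1 ≠ l := fun i h => hl (h ▸ hb i)
        have h2 : ∀ i, (l, false) ≠ x i := fun i h => h1 i (by rw [← h])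
        simp [(h1 _).symm, h2])
    refine ⟨v, ?_⟩
    rw [← linearIndependent_equiv π, linearIndependent_iff_det_flatten_ne_zero]
    simp [hv, splitVec, hne, h02.symm, h03.symm, h12.symm, h13.symm, flatten, vecMulVec_apply,
      det_succ_row_zero, Fin.sum_univ_succ]
  have h3 : ∀ i j k, i ≠ j → i ≠ k → j ≠ k → (x i).1 = (x j).1 → (x i).1 ≠ (x k).1 := by
    intro i j k hij hik hjk h1 h2
    have h : ∀ {i j}, i ≠ j → (x i).1 = (x j).1 → (x i).2 ≠ (x j).2 := fun hij h h' =>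
      hij (hx (Prod.ext h h'))
    have e1 := h hij h1
    have e2 := h hik h2
    have e3 := h hjk (h1.symm.trans h2)
    revert e1 e2 e3
    cases (x i).2 <;> cases (x j).2 <;> cases (x k).2 <;> simp
  -- These are the three ways to split four points into two pairs. No three points share a label, so
  -- one of the splittings separates the labels.
  have k1 := key 1
  have k2 := key (Equiv.swap 1 2)
  have k3 := key (Equiv.swap 1 3)
  have s0 : Equiv.swap (1 : Fin 4) 2 0 = 0 := by decide
  have s3 : Equiv.swap (1 : Fin 4) 2 3 = 3 := by decide
  have s0' : Equiv.swap (1 : Fin 4) 3 0 = 0 := by decide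
  have s2' : Equiv.swap (1 : Fin 4) 3 2 = 2 := by decide
  simp only [Equiv.Perm.coe_one, id_eq, Equiv.swap_apply_left, Equiv.swap_apply_right, s0, s3, s0',
    s2'] at k1 k2 k3
  have h012 := h3 0 1 2 (by decide) (by decide) (by decide)
  have h013 := h3 0 1 3 (by decide) (by decide) (by decide)
  have h102 := h3 1 0 2 (by decide) (by decide) (by decide)
  have h103 := h3 1 0 3 (by decide) (by decide) (by decide)
  have h023 := h3 0 2 3 (by decide) (by decide) (by decide)
  have h123 := h3 1 2 3 (by decide) (by decide) (by decide)
  clear key h3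
  by_contra hcon
  simp only [hcon, imp_false] at k1 k2 k3
  generalize (x 0).1 = a at *
  generalize (x 1).1 = b at *
  generalize (x 2).1 = c at *
  generalize (x 3).1 = d at *
  clear hcon hb hx
  grind +splitImp

/-- Two points in one block and two points without a block. -/
theorem exists_parPt_linearIndependent_of_block {x : Fin 4 → Λ × Bool}
    (hx : Function.Injective x) {j : ι} (h0 : blk (x 0).1 = some j) (h1 : blk (x 1).1 = some j)
    (h01 : (x 0).1 ≠ (x 1).1) (h2 : blk (x 2).1 = none) (h3 : blk (x 3).1 = none)
    (hε : (x 0).2 = false) :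
    ∃ v : Par K Λ ι, LinearIndependent K fun i => parPt blk chart v (x i) := by
  classical
  have n02 : (x 0).1 ≠ (x 2).1 := fun h => by simp [h, h2] at h0
  have n03 : (x 0).1 ≠ (x 3).1 := fun h => by simp [h, h3] at h0
  have n12 : (x 1).1 ≠ (x 2).1 := fun h => by simp [h, h2] at h1
  have n13 : (x 1).1 ≠ (x 3).1 := fun h => by simp [h, h3] at h1
  have hne : ∀ i j, x i = x j ↔ i = j := fun i j => hx.eq_iff
  -- The points become e₀ ⊗ e₀, e₁ ⊗ e₁, (1,1) ⊗ e₀, (1,1) ⊗ e₁, and the first two lie in the plane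
  -- x₀₁ + x₁₀ = 0.
  obtain ⟨v, -, hv⟩ := exists_parPt_eq_of_det_ne_zero blk chart
    (fun l => if l = (x 2).1 ∨ l = (x 3).1 then ![1, 1] else splitVec {(x 0).1} l)
    (splitVec {x 0, x 2}) (fun _ => swapMatrix (K := K)) (fun _ => by simp [det_swapMatrix])
    fun l j hl => by
      have n2 : l ≠ (x 2).1 := fun h => by simp [h, h2] at hl
      have n3 : l ≠ (x 3).1 := fun h => by simp [h, h3] at hl
      have n2' : (l, false) ≠ x 2 := fun h => n2 (by rw [← h])
      simp only [n2, n3, or_self, if_false]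
      refine ⟨splitVec_ne_zero _ _, splitVec_ne_zero _ _, ?_⟩
      by_cases hs : l = (x 0).1
      · have : (l, false) = x 0 := Prod.ext hs hε.symm
        rw [splitVec_of_mem (by simpa using hs), splitVec_of_mem (by simp [this])]
        simp [swapMatrix, dotProduct, mulVec, Fin.sum_univ_two]
      · have : (l, false) ≠ x 0 := fun h => hs (by rw [← h])
        rw [splitVec_of_notMem (by simpa using hs), splitVec_of_notMem (by simp [this, n2'])]
        simp [swapMatrix, dotProduct, mulVec, Fin.sum_univ_two]
  refine ⟨v, ?_⟩
  rw [linearIndependent_iff_det_flatten_ne_zero]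
  simp [hv, splitVec, hne, h01.symm, n02, n03, n12, n13, flatten, vecMulVec_apply,
    det_succ_row_zero, Fin.sum_univ_succ]

/-- Two points each in two different blocks. -/
theorem exists_parPt_linearIndependent_of_blocks {x : Fin 4 → Λ × Bool}
    (hx : Function.Injective x) {j j' : ι} (hj : j' ≠ j) (h0 : blk (x 0).1 = some j)
    (h1 : blk (x 1).1 = some j) (h2 : blk (x 2).1 = some j') (h3 : blk (x 3).1 = some j')
    (hε : ∀ i, (x i).2 = false) :
    ∃ v : Par K Λ ι, LinearIndependent K fun i => parPt blk chart v (x i) := by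
  classical
  have hne : ∀ i j, (x i).1 = (x j).1 ↔ i = j := fun i j =>
    ⟨fun h => hx (Prod.ext h ((hε i).trans (hε j).symm)), fun h => by rw [h]⟩
  have hne' : ∀ i j, x i = x j ↔ i = j := fun i j => hx.eq_iff
  -- Block j gets the plane x₀₁ + x₁₀ = 0 and every other block the plane x₀₀ + x₁₁ = 0. The points
  -- become e₀ ⊗ e₀, e₁ ⊗ e₁, e₀ ⊗ e₁, e₁ ⊗ e₀.
  obtain ⟨v, -, hv⟩ := exists_parPt_eq_of_det_ne_zero blk chart (splitVec {(x 0).1, (x 2).1})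
    (splitVec ({x 0} ∪ {y | blk y.1 ≠ some j ∧ y.1 ≠ (x 2).1}))
    (fun i => if i = j then swapMatrix (K := K) else 1)
    (fun i => by split <;> simp [det_swapMatrix])
    fun l i hl => by
      refine ⟨splitVec_ne_zero _ _, splitVec_ne_zero _ _, ?_⟩
      have e0 : (l, false) = x 0 ↔ l = (x 0).1 := by simp [Prod.ext_iff, hε]
      by_cases hi : i = j
      · subst hi
        have n2 : l ≠ (x 2).1 := fun h => hj (by rw [h, h2] at hl; simpa using hl)
        by_cases hs : l = (x 0).1
        · rw [splitVec_of_mem (by simp [hs]), splitVec_of_mem (by simp [e0.2 hs])]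
          simp [swapMatrix, dotProduct, mulVec, Fin.sum_univ_two]
        · rw [splitVec_of_notMem (by simp [hs, n2]), splitVec_of_notMem (by simp [e0, hs, hl])]
          simp [swapMatrix, dotProduct, mulVec, Fin.sum_univ_two]
      · have n0 : l ≠ (x 0).1 := fun h => hi (by rw [h, h0] at hl; simpa using hl.symm)
        by_cases hs : l = (x 2).1
        · rw [splitVec_of_mem (by simp [hs]), splitVec_of_notMem (by
            rintro (h | h)
            · exact n0 (e0.1 h)
            · exact h.2 hs)]
          simp [hi, dotProduct, Fin.sum_univ_two]
        · rw [splitVec_of_notMem (by simp [hs, n0]), splitVec_of_mem (by simp [hl, hi, hs])]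
          simp [hi, dotProduct, Fin.sum_univ_two]
  refine ⟨v, ?_⟩
  rw [linearIndependent_iff_det_flatten_ne_zero]
  simp [hv, splitVec, hne, hne', h0, h1, h2, h3, hj, flatten, vecMulVec_apply,
    det_succ_row_zero, Fin.sum_univ_succ]

variable [Infinite K]

theorem eventually_det_ne_zero (j : ι) :
    ∀ᶠ v in generic K (Par K Λ ι), (v.2.2.2.2 j).det ≠ 0 :=
  eventually_generic (f := fun v : Par K Λ ι => (v.2.2.2.2 j).det)
    (det_mem_subalgebra fun i i' => mem_lineAlgebra_of_affine fun x y t => by simp)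
    ⟨(0, 0, 0, 0, fun _ => 1), by simp⟩

/-- This minor of the two first rows serves twice: it shows that the two points are independent, and
that their common first factor is not zero for labels without a block. -/
theorem eventually_line (l : Λ) : ∀ᶠ v in generic K (Par K Λ ι),
    parPt blk chart v (l, false) 0 0 * parPt blk chart v (l, true) 0 1 -
      parPt blk chart v (l, false) 0 1 * parPt blk chart v (l, true) 0 0 ≠ 0 := by
  refine eventually_generic (f := fun v : Par K Λ ι => parPt blk chart v (l, false) 0 0 *
    parPt blk chart v (l, true) 0 1 - parPt blk chart v (l, false) 0 1 *
    parPt blk chart v (l, true) 0 0) (sub_mem (mul_mem ?_ ?_) (mul_mem ?_ ?_)) ?_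
  iterate 4 exact parPt_mem_lineAlgebra _ _ _ _ _
  obtain ⟨v, hv⟩ := exists_parPt_eq_splitVec (K := K) (blk := blk) chart Set.univ {x | x.2 = false}
    (by simp)
  refine ⟨v, ?_⟩
  simp [hv, splitVec, vecMulVec_apply]

/-- On points of the quadric the determinant of a sum is the polar form. The witness puts x at e₀ ⊗
e₀ and y at e₁ ⊗ e₁. -/
theorem eventually_det_add_ne_zero {x y : Λ × Bool} (hxy : x.1 ≠ y.1) 
    (hx : blk x.1 ≠ none → x.2 = false) : ∀ᶠ v in generic K (Par K Λ ι),
    (parPt blk chart v x + parPt blk chart v y).det ≠ 0 := by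
  refine eventually_generic
    (f := fun v : Par K Λ ι => (parPt blk chart v x + parPt blk chart v y).det)
    (det_mem_subalgebra fun i j => add_mem
      (parPt_mem_lineAlgebra blk chart x i j) (parPt_mem_lineAlgebra blk chart y i j)) ?_
  obtain ⟨v, hv⟩ := exists_parPt_eq_splitVec (K := K) (blk := blk) chart {x.1} {x}
    (by
      intro l hl
      simp only [Set.mem_singleton_iff, Prod.ext_iff]
      refine ⟨fun h => ⟨h, ?_⟩, fun h => h.1⟩
      subst h
      exact (hx hl).symm)
  refine ⟨v, ?_⟩
  have hne : y ≠ x := fun h => hxy (congrArg Prod.fst h.symm)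
  rw [hv, hv, det_vecMulVec_add]
  simp [splitVec, hne, hxy.symm]

theorem eventually_linearIndependent {x : Fin 4 → Λ × Bool}
    (h : ∃ v : Par K Λ ι, LinearIndependent K fun i => parPt blk chart v (x i)) :
    ∀ᶠ v in generic K (Par K Λ ι), LinearIndependent K fun i => parPt blk chart v (x i) := by
  simp only [linearIndependent_iff_det_flatten_ne_zero] at h ⊢
  exact eventually_generic (parPt_rows_mem x) h

end Generic

end GeneralPosition

end QuadricReduction

namespace QuadricReduction

variable {K : Type*} [Field K]

/-! ### All conditions of general position at once. -/

section GeneralPosition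

open Matrix

variable {Λ ι : Type*}

/-- Two distinct points, both without a block or both the first points for labels in the same
block. -/
def GoodPair (blk : Λ → Option ι) (x y : Λ × Bool) : Prop :=
  x ≠ y ∧ ((blk x.1 = none ∧ blk y.1 = none) ∨
    ∃ j, blk x.1 = some j ∧ blk y.1 = some j ∧ x.2 = false ∧ y.2 = false)

/-- Points on a quadric in general position: for every label, two points on a line of the ruling.
The lines joining two points are transversal to the quadric and disjoint, as far as this is
possible when the first points for the labels in one block are coplanar. -/
structure IsGeneral (F : Coord K) (ℛ : Set (Line K)) (blk : Λ → Option ι)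
    (P : Λ × Bool → Fin 4 → K) : Prop where
  onQuadric : ∀ x, MvPolynomial.eval (P x) F = 0
  linearIndependent : ∀ l, blk l = none → LinearIndependent K ![P (l, false), P (l, true)]
  exists_line : ∀ l, blk l = none → ∃ L ∈ ℛ, ∀ ε, P (l, ε) ∈ L.1
  polarForm_ne_zero : ∀ x y : Λ × Bool, x.1 ≠ y.1 → (blk x.1 ≠ none → x.2 = false) →
    polarForm F (P x) (P y) ≠ 0
  disjoint : ∀ x y x' y', GoodPair blk x y → GoodPair blk x' y' → x ≠ x' → x ≠ y' → y ≠ x' →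
    y ≠ y' → (blk x.1 = none ∨ blk x.1 ≠ blk x'.1) →
      Disjoint (Submodule.span K {P x, P y}) (Submodule.span K {P x', P y'})

theorem disjoint_span_pair_of_linearIndependent {W : Type*} [AddCommGroup W] [Module K W]
    {X : Fin 4 → W} (h : LinearIndependent K X) :
    Disjoint (Submodule.span K {X 0, X 1}) (Submodule.span K {X 2, X 3}) := by
  rw [Submodule.disjoint_def]
  intro w h1 h2
  obtain ⟨a, b, rfl⟩ := Submodule.mem_span_pair.1 h1
  obtain ⟨c, d, hcd⟩ := Submodule.mem_span_pair.1 h2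
  have := Fintype.linearIndependent_iff.1 h ![a, b, -c, -d] (by
    simp only [Fin.sum_univ_four, cons_val_zero, cons_val_one, cons_val, neg_smul]
    rw [← hcd]
    abel)
  have ha : a = 0 := this 0
  have hb : b = 0 := this 1
  simp [ha, hb]

theorem injective_vec_four {α : Type*} {x y z w : α} (hxy : x ≠ y) (hxz : x ≠ z) (hxw : x ≠ w)
    (hyz : y ≠ z) (hyw : y ≠ w) (hzw : z ≠ w) : Function.Injective ![x, y, z, w] := by
  intro i j hij
  fin_cases i <;> fin_cases j <;> simp_all

/-- Each condition follows from the nonvanishing of a function in `lineAlgebra` that has a witness.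
For G and for the independence of triples the witness is the parameter that realizes `v₀`; for the
others it is a configuration of standard vectors. A generic parameter satisfies all of them. -/
theorem exists_isGeneral [IsAlgClosed K] {F : Coord K} (hF : IsSmoothQuadric F)
    {ℛ : Set (Line K)} (hℛ : IsRuling F ℛ) [Finite Λ] [Finite ι] {quad : ι × Fin 4 ↪ Λ}
    {blk : Λ → Option ι} (hblk : ∀ l j, blk l = some j ↔ ∃ i, quad (j, i) = l)
    {v₀ : Λ → Fin 4 → K} (h0 : ∀ l, MvPolynomial.eval (v₀ l) F = 0)
    (hq : ∀ j, ¬ LinearIndependent K (fun i : Fin 4 => v₀ (quad (j, i))) ∧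
      ∀ i₀, LinearIndependent K (fun i : {i : Fin 4 // i ≠ i₀} => v₀ (quad (j, i.1))))
    {G : MvPolynomial (Λ × Fin 4) K} (hG : MvPolynomial.eval (fun x => v₀ x.1 x.2) G ≠ 0) :
    ∃ P : Λ × Bool → Fin 4 → K, IsGeneral F ℛ blk P ∧
      (∀ j, ¬ LinearIndependent K (fun i : Fin 4 => P (quad (j, i), false)) ∧
        ∀ i₀, LinearIndependent K (fun i : {i : Fin 4 // i ≠ i₀} => P (quad (j, i.1), false))) ∧
      MvPolynomial.eval (fun x => P (x.1, false) x.2) G ≠ 0 := by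
  have : Infinite K := IsAlgClosed.instInfinite
  obtain ⟨Φ, hΦ⟩ := exists_normalForm hF hℛ
  obtain ⟨chart, w, hw⟩ := exists_realization hΦ hblk h0 hq
  have hX : ∀ x i, (fun v => Φ (parPt blk chart v x) i) ∈ lineAlgebra K (Par K Λ ι) := by
    intro x i
    have : (fun v => Φ (parPt blk chart v x) i) = fun v =>
        ∑ k, ∑ l, Φ (single k l 1) i * parPt blk chart v x k l := by
      ext v
      conv_lhs => rw [matrix_eq_sum_single (parPt blk chart v x)]
      have : ∀ (k l : Fin 2) (c : K), single k l c = c • single k l 1 := fun k l c => by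
        rw [smul_single, smul_eq_mul, mul_one]
      simp only [map_sum, Finset.sum_apply]
      refine Finset.sum_congr rfl fun k _ => Finset.sum_congr rfl fun l _ => ?_
      rw [this, map_smul, Pi.smul_apply, smul_eq_mul, mul_comm]
    rw [this]
    simp only [Fin.sum_univ_two]
    exact add_mem (add_mem (mul_mem (const_mem_subalgebra _ _) (parPt_mem_lineAlgebra _ _ _ _ _))
      (mul_mem (const_mem_subalgebra _ _) (parPt_mem_lineAlgebra _ _ _ _ _)))
      (add_mem (mul_mem (const_mem_subalgebra _ _) (parPt_mem_lineAlgebra _ _ _ _ _))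
      (mul_mem (const_mem_subalgebra _ _) (parPt_mem_lineAlgebra _ _ _ _ _)))
  have e1 : ∀ᶠ v in generic K (Par K Λ ι),
      MvPolynomial.eval (fun x : Λ × Fin 4 => Φ (parPt blk chart v (x.1, false)) x.2) G ≠ 0 :=
    eventually_generic (eval_mem_subalgebra
      (x := fun (v : Par K Λ ι) (x : Λ × Fin 4) => Φ (parPt blk chart v (x.1, false)) x.2)
      (fun x => hX _ _) G) ⟨w, by simpa only [hw] using hG⟩
  have e2 : ∀ᶠ v in generic K (Par K Λ ι), ∀ j i₀,
      LinearIndependent K fun i : {i : Fin 4 // i ≠ i₀} =>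
        Φ (parPt blk chart v (quad (j, i.1), false)) := by
    refine Filter.eventually_all.2 fun j => Filter.eventually_all.2 fun i₀ => ?_
    obtain ⟨y, hy⟩ := exists_linearIndependent_ne (by simp) i₀ (y := fun i => v₀ (quad (j, i)))
      ((hq j).2 i₀)
    have := eventually_generic (f := fun v : Par K Λ ι => (of (Function.update
      (fun i => Φ (parPt blk chart v (quad (j, i), false))) i₀ y)).det)
      (det_mem_subalgebra fun i k => by
        by_cases hi : i = i₀
        · subst hi
          simpa using const_mem_subalgebra _ _
        · simpa [Function.update_of_ne hi] using hX _ _) ⟨w, by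
        rw [← isUnit_iff_ne_zero, ← isUnit_iff_isUnit_det, ← linearIndependent_rows_iff_isUnit]
        simp only [hw]
        exact hy⟩
    filter_upwards [this] with v hv
    rw [← isUnit_iff_ne_zero, ← isUnit_iff_isUnit_det, ← linearIndependent_rows_iff_isUnit] at hv
    exact LinearIndependent.of_update (y := fun i => Φ (parPt blk chart v (quad (j, i), false))) hv
  have e3 : ∀ᶠ v in generic K (Par K Λ ι), ∀ l,
      parPt blk chart v (l, false) 0 0 * parPt blk chart v (l, true) 0 1 -
        parPt blk chart v (l, false) 0 1 * parPt blk chart v (l, true) 0 0 ≠ 0 :=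
    Filter.eventually_all.2 fun l => eventually_line l
  have e4 : ∀ᶠ v in generic K (Par K Λ ι), ∀ x y : Λ × Bool, x.1 ≠ y.1 →
      (blk x.1 ≠ none → x.2 = false) → (parPt blk chart v x + parPt blk chart v y).det ≠ 0 := by
    simp only [Filter.eventually_all]
    exact fun x y => eventually_det_add_ne_zero
  -- This keeps the planes nonzero, so that the quadruples remain linearly dependent.
  have e5 : ∀ᶠ v in generic K (Par K Λ ι), ∀ j, (v.2.2.2.2 j).det ≠ 0 :=
    Filter.eventually_all.2 eventually_det_ne_zero
  have e6 : ∀ᶠ v in generic K (Par K Λ ι), ∀ x : Fin 4 → Λ × Bool, Function.Injective x →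
      GoodPair blk (x 0) (x 1) → GoodPair blk (x 2) (x 3) →
      ((blk (x 0).1 = none ∧ blk (x 2).1 = none) ∨
        (blk (x 0).1 ≠ none ∧ blk (x 0).1 ≠ blk (x 2).1)) →
      LinearIndependent K fun i => parPt blk chart v (x i) := by
    simp only [Filter.eventually_all]
    rintro x hx ⟨h01, h⟩ ⟨h23, h'⟩ hor
    apply eventually_linearIndependent
    rcases h with ⟨h0, h1⟩ | ⟨j, h0, h1, h2, h3⟩
    · rcases h' with ⟨h0', h1'⟩ | ⟨j', h0', h1', h2', h3'⟩
      · exact exists_parPt_linearIndependent hx fun i => by fin_cases i <;> assumption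
      · simp [h0, h0'] at hor
    · have hne : (x 0).1 ≠ (x 1).1 := fun h => h01 (Prod.ext h (h2.trans h3.symm))
      rcases h' with ⟨h0', h1'⟩ | ⟨j', h0', h1', h2', h3'⟩
      · exact exists_parPt_linearIndependent_of_block hx h0 h1 hne h0' h1' h2
      · exact exists_parPt_linearIndependent_of_blocks hx
          (by rintro rfl; simp [h0, h0'] at hor) h0 h1 h0' h1' fun i => by
            fin_cases i <;> assumption
  obtain ⟨v, h1, h2, h3, h4, h5, h6⟩ := (e1.and (e2.and (e3.and (e4.and (e5.and e6))))).exists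
  have hon : ∀ x, MvPolynomial.eval (Φ (parPt blk chart v x)) F = 0 := fun x => by
    obtain ⟨a, b, h⟩ := exists_parPt_eq_vecMulVec blk chart v x
    rw [hΦ.eval_eq, h, det_vecMulVec_two]
  have hdis : ∀ x : Fin 4 → Λ × Bool, Function.Injective x →
      GoodPair blk (x 0) (x 1) → GoodPair blk (x 2) (x 3) →
      ((blk (x 0).1 = none ∧ blk (x 2).1 = none) ∨
        (blk (x 0).1 ≠ none ∧ blk (x 0).1 ≠ blk (x 2).1)) →
      Disjoint (Submodule.span K {Φ (parPt blk chart v (x 0)), Φ (parPt blk chart v (x 1))})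
        (Submodule.span K {Φ (parPt blk chart v (x 2)), Φ (parPt blk chart v (x 3))}) := by
    intro x hx hg hg' hor
    exact disjoint_span_pair_of_linearIndependent (X := fun i => Φ (parPt blk chart v (x i)))
      ((h6 x hx hg hg' hor).map' Φ.toLinearMap Φ.ker)
  refine ⟨fun x => Φ (parPt blk chart v x), ⟨hon, fun l _ => ?_, fun l hl => ?_, ?_, ?_⟩,
    fun j => ⟨?_, h2 j⟩, h1⟩
  · rw [LinearIndependent.pair_iff]
    intro p q hpq
    rw [← map_smul, ← map_smul, ← map_add, Φ.map_eq_zero_iff] at hpq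
    have a0 := congrFun (congrFun hpq 0) 0
    have a1 := congrFun (congrFun hpq 0) 1
    simp only [Matrix.add_apply, Matrix.smul_apply, smul_eq_mul, Matrix.zero_apply] at a0 a1
    constructor
    · refine (mul_eq_zero.1 ?_).resolve_left (h3 l)
      linear_combination parPt blk chart v (l, true) 0 1 * a0 -
        parPt blk chart v (l, true) 0 0 * a1
    · refine (mul_eq_zero.1 ?_).resolve_left (h3 l)
      linear_combination parPt blk chart v (l, false) 0 0 * a1 -
        parPt blk chart v (l, false) 0 1 * a0
  · have hp : ∀ ε, ∃ b, parPt blk chart v (l, ε) = vecMulVec (v.1 l) b := fun ε => by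
      cases ε
      · exact ⟨_, by simp only [parPt, hl]; rfl⟩
      · exact ⟨_, rfl⟩
    have ha : v.1 l ≠ 0 := fun h => h3 l (by
      obtain ⟨b, hb⟩ := hp false
      simp [hb, h, zero_vecMulVec])
    obtain ⟨L, hL, hL'⟩ := hΦ.exists_line _ ha
    refine ⟨L, hL, fun ε => ?_⟩
    obtain ⟨b, hb⟩ := hp ε
    rw [hb]
    exact hL' b
  · intro x y hxy hx h
    apply h4 x y hxy hx
    rw [← hΦ.eval_eq, map_add, eval_add_eq hF.1, hon, hon, h]
    simp
  · intro x y x' y' hg hg' hxx hxy hyx hyy hor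
    -- The independence was established with a pair from a block in front; if only the second pair
    -- is in a block, the pairs are exchanged.
    by_cases hb : (blk x.1 = none ∧ blk x'.1 = none) ∨ (blk x.1 ≠ none ∧ blk x.1 ≠ blk x'.1)
    · refine hdis ![x, y, x', y'] ?_ hg hg' hb
      exact injective_vec_four hg.1 hxx hxy hyx hyy hg'.1
    · refine (hdis ![x', y', x, y] ?_ hg' hg ?_).symm
      · exact injective_vec_four hg'.1 hxx.symm hyx.symm hxy.symm hyy.symm hg.1
      · simp only [cons_val_zero, cons_val]
        grind
  · intro hli
    have hli' := (hli.map' Φ.symm.toLinearMap Φ.symm.ker)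
    simp only [Function.comp_def, LinearEquiv.coe_coe, Φ.symm_apply_apply] at hli'
    have hM : v.2.2.2.2 j ≠ 0 := fun h => h5 j (by simp [h])
    have hspan := hli'.span_eq_top_of_card_eq_finrank (by simp [Module.finrank_matrix])
    refine planeForm_ne_zero hM (LinearMap.ext_on hspan ?_)
    rintro _ ⟨i, rfl⟩
    exact planeForm_parPt blk chart ((hblk _ _).2 ⟨i, rfl⟩) v

end GeneralPosition

end QuadricReduction

namespace QuadricReduction

variable {K : Type*} [Field K]

/-! ### Lines spanned by points of the quadric. -/

section Join

open MvPolynomial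

variable {F : Coord K} {a b c : Fin 4 → K}

theorem linearIndependent_of_polarForm_ne_zero (hF : F.IsHomogeneous 2) (ha : eval a F = 0)
    (hb : eval b F = 0) (h : polarForm F a b ≠ 0) : LinearIndependent K ![a, b] := by
  rw [LinearIndependent.pair_iff' (by rintro rfl; rw [polarForm_comm hF] at h; simp at h)]
  rintro t rfl
  rw [map_smul, polarForm_self hF ha, smul_zero] at h
  exact h rfl

theorem exists_line_eq_span (h : LinearIndependent K ![a, b]) :
    ∃ L : Line K, L.1 = Submodule.span K {a, b} := by
  refine ⟨⟨_, ?_⟩, rfl⟩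
  have := finrank_span_eq_card h
  rwa [Matrix.range_cons_cons_empty, Fintype.card_fin] at this

theorem exists_pt_eq_span (h : a ≠ 0) : ∃ p : Pt K, p.submodule = Submodule.span K {a} :=
  ⟨.mk K a h, Projectivization.submodule_mk _ _⟩

theorem vanishesOn_span_singleton (hF : F.IsHomogeneous 2) (h : eval a F = 0) :
    VanishesOn F (Submodule.span K {a}) := by
  intro v hv
  obtain ⟨t, rfl⟩ := Submodule.mem_span_singleton.1 hv
  rw [eval_smul_eq hF, h, mul_zero]

theorem transversal_of_polarForm_ne_zero (hF : F.IsHomogeneous 2) (ha : eval a F = 0)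
    (hb : eval b F = 0) (h : polarForm F a b ≠ 0) {L : Line K}
    (hL : L.1 = Submodule.span K {a, b}) : Transversal F L := by
  have hli := linearIndependent_of_polarForm_ne_zero hF ha hb h
  have haL : a ∈ L.1 := hL ▸ Submodule.subset_span (by simp)
  have hbL : b ∈ L.1 := hL ▸ Submodule.subset_span (by simp)
  obtain ⟨p, hp⟩ := exists_pt_eq_span (hli.ne_zero 0)
  obtain ⟨p', hp'⟩ := exists_pt_eq_span (hli.ne_zero 1)
  refine ⟨fun hv => h (eval_line_eq_zero_iff hF hv haL hbL), p, p', ?_, ?_, ?_, ?_, ?_⟩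
  · rintro rfl
    have : b ∈ Submodule.span K {a} := by
      rw [show a = ![a, b] 0 from rfl, ← hp, hp']
      exact Submodule.mem_span_singleton_self _
    obtain ⟨t, ht⟩ := Submodule.mem_span_singleton.1 this
    exact (LinearIndependent.pair_iff' (hli.ne_zero 0)).1 hli t ht
  · rw [hp]; exact (Submodule.span_singleton_le_iff_mem _ _).2 haL
  · rw [hp']; exact (Submodule.span_singleton_le_iff_mem _ _).2 hbL
  · rw [hp]; exact vanishesOn_span_singleton hF ha
  · rw [hp']; exact vanishesOn_span_singleton hF hb

/-- As B(b, c) ≠ 0, the span of b and c meets the quadric only in multiples of b or of c. These are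
orthogonal to b or to c respectively, but a is orthogonal to neither. -/
theorem notMem_span_pair_of_polarForm_ne_zero (hF : F.IsHomogeneous 2) (ha : eval a F = 0)
    (hb : eval b F = 0) (hc : eval c F = 0) (hab : polarForm F a b ≠ 0)
    (hac : polarForm F a c ≠ 0) (hbc : polarForm F b c ≠ 0) :
    a ∉ Submodule.span K {b, c} := by
  intro h
  obtain ⟨x, y, rfl⟩ := Submodule.mem_span_pair.1 h
  rw [eval_add_smul_eq hF, hb, hc] at ha
  have hxy : x = 0 ∨ y = 0 := by simpa [hbc] using ha
  rw [polarForm_comm hF, map_add, map_smul, map_smul] at hab hac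
  rw [polarForm_self hF hb] at hab
  rw [polarForm_self hF hc] at hac
  rcases hxy with rfl | rfl
  · simp at hac
  · simp at hab

theorem Line.finrank_inf_eq_one {L M : Line K} (h : L ≠ M) (ha0 : a ≠ 0) (haL : a ∈ L.1)
    (haM : a ∈ M.1) : Module.finrank K ↥(L.1 ⊓ M.1) = 1 := by
  have h1 : Module.finrank K ↥(L.1 ⊓ M.1) ≤ 2 :=
    (Submodule.finrank_mono inf_le_left).trans L.2.le
  have h2 : Module.finrank K ↥(L.1 ⊓ M.1) ≠ 0 := fun h0 =>
    ha0 ((Submodule.mem_bot K).1 (by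
      rw [← Submodule.finrank_eq_zero.1 h0]
      exact ⟨haL, haM⟩))
  have h3 : Module.finrank K ↥(L.1 ⊓ M.1) ≠ 2 := fun h3 =>
    h (Line.eq_of_le (inf_eq_left.1 (Submodule.eq_of_le_of_finrank_eq inf_le_left
      (h3.trans L.2.symm))))
  omega

theorem inf_eq_span_singleton {L M : Line K} (h : Module.finrank K ↥(L.1 ⊓ M.1) = 1)
    (ha0 : a ≠ 0) (haL : a ∈ L.1) (haM : a ∈ M.1) : L.1 ⊓ M.1 = Submodule.span K {a} :=
  (Submodule.eq_of_le_of_finrank_eq ((Submodule.span_singleton_le_iff_mem _ _).2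
    (Submodule.mem_inf.2 ⟨haL, haM⟩))
    (by rw [h, finrank_span_singleton ha0])).symm

/-- The four vectors span a space of dimension exactly three, and the dimension formula leaves 2 + 2
− 3 for the intersection. -/
theorem finrank_inf_eq_one_of_coplanar {y : Fin 4 → Fin 4 → K} {L M : Line K}
    (hL : L.1 = Submodule.span K {y 0, y 1}) (hM : M.1 = Submodule.span K {y 2, y 3})
    (hy : ¬ LinearIndependent K y)
    (hy' : ∀ i₀, LinearIndependent K (fun i : {i : Fin 4 // i ≠ i₀} => y i.1)) :
    Module.finrank K ↥(L.1 ⊓ M.1) = 1 := by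
  have hsup : L.1 ⊔ M.1 = Submodule.span K (Set.range y) := by
    rw [hL, hM, ← Submodule.span_union]
    congr 1
    ext v
    constructor
    · rintro ((rfl | rfl) | (rfl | rfl)) <;> exact ⟨_, rfl⟩
    · rintro ⟨i, rfl⟩
      fin_cases i <;> simp
  have h1 := Submodule.finrank_sup_add_finrank_inf_eq L.1 M.1
  have h2 : 3 ≤ Module.finrank K ↥(L.1 ⊔ M.1) := by
    have := finrank_span_eq_card (hy' 0)
    have h4 : Fintype.card {i : Fin 4 // i ≠ 0} = 3 := by simp [Fintype.card_subtype_compl]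
    rw [h4] at this
    rw [← this, hsup]
    exact Submodule.finrank_mono (Submodule.span_mono (Set.range_comp_subset_range Subtype.val y))
  have h3 : Module.finrank K ↥(L.1 ⊔ M.1) < 4 := by
    rw [hsup]
    by_contra! hge
    refine hy (linearIndependent_iff_card_le_finrank_span.2 ?_)
    simpa [Set.finrank] using hge
  have := L.2
  have := M.2
  omega

end Join

end QuadricReduction

/-! ### Labels for the trace, and the two ends of each line. -/

namespace QuadricReduction

variable {K : Type*} [Field K]

/-- Labels for the lines and points of the trace of a specialization, and for auxiliary points on
the quadric. -/
inductive TraceLabel (δ r s q z u k l ls t : ℕ)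
  | fatLine (i : Fin δ)
  | red (x : RedIdx r s z l ls)
  | simple (x : SimpleIdx r s q z u l ls t)
  | double (x : Fin u ⊕ Fin k)
  | multiple (i : Fin (2 - 2 * δ))
  | extra (i : Fin q) (ε : Fin 2)

namespace TraceLabel

variable {δ r s q z u k l ls t : ℕ}

/-- The component that contains the line or point with a given label. -/
def owner : TraceLabel δ r s q z u k l ls t → SpecPart r s q z u
  | .fatLine _ => .old .fat
  | .red x => x.owner
  | .simple x => x.owner
  | .double (.inl i) => .sundial i
  | .double (.inr _) => .zz
  | .multiple _ => .old .fat
  | .extra i _ => .old (.point i)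

/-- The label of a point of an uncut cross determines the cross. -/
def block : TraceLabel δ r s q z u k l ls t → Option {i : Fin s // ls ≤ i.val}
  | .simple (.uncut i h _ _) => some ⟨i, h⟩
  | _ => none

theorem block_eq_some {x : TraceLabel δ r s q z u k l ls t} {i : {i : Fin s // ls ≤ i.val}} :
    x.block = some i ↔ ∃ j ε, x = .simple (.uncut i.1 i.2 j ε) := by
  refine ⟨fun h => ?_, fun ⟨j, ε, h⟩ => by rw [h]; rfl⟩
  cases x with
  | simple x =>
    cases x with
    | uncut i' h' j ε =>
      obtain rfl : ⟨i', h'⟩ = i := Option.some.inj h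
      exact ⟨j, ε, rfl⟩
    | _ => cases h
  | _ => cases h

theorem owner_eq_of_block_eq_some {x : TraceLabel δ r s q z u k l ls t}
    {i : {i : Fin s // ls ≤ i.val}} (h : x.block = some i) : x.owner = .old (.cross i.1) := by
  obtain ⟨j, ε, rfl⟩ := block_eq_some.1 h
  rfl

end TraceLabel

namespace Construction

variable {δ r s q z u k l ls t : ℕ}

local notation "Lab" => TraceLabel δ r s q z u k l ls t

/-- Two points on the fat line. -/
def fatEnd (ε : Fin 2) : Lab × Bool :=
  if h : 0 < δ then (.fatLine ⟨0, h⟩, ε == 1) else (.multiple ⟨ε, by omega⟩, false)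

/-- Two points on the `i`-th line. -/
def lineEnd (i : Fin r) (ε : Fin 2) : Lab × Bool :=
  if h : i.val < l then (.red (.line i h), ε == 1)
  else (.simple (.line i (not_lt.1 h) ε), false)

/-- Two points on the `j`-th line of the `i`-th cross. -/
def crossEnd (i : Fin s) (j ε : Fin 2) : Lab × Bool :=
  if h : i.val < ls then
    -- The transversal line of a cut cross joins its free point to the second point of the ruling
    -- line; the first point represents that line in the trace.
    if j = 0 ∧ ε = 0 then (.simple (.cut i h), false) else (.red (.cut i h), j == 0 || ε == 1)
  else (.simple (.uncut i (not_lt.1 h) j ε), false)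

/-- Two points that span the `i`-th point or a line through it. -/
def pointEnd (i : Fin q) (ε : Fin 2) : Lab × Bool :=
  if h : i.val < t then (.simple (.point i h), ε == 1) else (.extra i ε, false)

/-- Two points on the `i`-th line of the reduced zig-zag. -/
def zigEnd (i : Fin z) (ε : Fin 2) : Lab × Bool :=
  if h : Odd i.val then (.red (.zig i h), ε == 1)
  -- An even line joins the first point of the preceding ruling line to the second point of the
  -- following one. So the two neighbours of a ruling line meet it in different points.
  else if ε = 0 then
    if h0 : i.val = 0 then (.simple (.zigStart i.pos), false)
    else (.red (.zig ⟨i.val - 1, by omega⟩ (Nat.Even.sub_odd (by omega) (Nat.not_odd_iff_even.1 h)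
      odd_one)), false)
  else
    if h1 : i.val + 1 < z then
      (.red (.zig ⟨i.val + 1, h1⟩ (Nat.not_odd_iff_even.1 h).add_one), true)
    else (.simple (.zigEnd (by
      have : z = i.val + 1 := by omega
      rw [this]
      exact (Nat.not_odd_iff_even.1 h).add_one)), false)

/-- Two points on the `j`-th line of the `i`-th sundial. -/
def sundialEnd (i : Fin u) (j ε : Fin 2) : Lab × Bool :=
  if ε = 0 then (.simple (.sundial i j), false) else (.double (.inl i), false)

/-- The points at which the lines of the zig-zag begin and end. -/
def zzPt (i : ℕ) : Lab × Bool :=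
  if i = 0 then (.simple (.zz 0), false)
  else if h : i - 1 < k then (.double (.inr ⟨i - 1, h⟩), false) else (.simple (.zz 1), false)

section Ends

theorem owner_fatEnd (ε : Fin 2) : (fatEnd ε : Lab × Bool).1.owner = .old .fat := by
  unfold fatEnd; split <;> rfl

theorem owner_lineEnd (i : Fin r) (ε : Fin 2) :
    (lineEnd i ε : Lab × Bool).1.owner = .old (.line i) := by
  unfold lineEnd; split <;> rfl

theorem owner_crossEnd (i : Fin s) (j ε : Fin 2) :
    (crossEnd i j ε : Lab × Bool).1.owner = .old (.cross i) := by
  unfold crossEnd; split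
  · split <;> rfl
  · rfl

theorem owner_pointEnd (i : Fin q) (ε : Fin 2) :
    (pointEnd i ε : Lab × Bool).1.owner = .old (.point i) := by
  unfold pointEnd; split <;> rfl

theorem owner_zigEnd (i : Fin z) (ε : Fin 2) :
    (zigEnd i ε : Lab × Bool).1.owner = .old .zig := by
  unfold zigEnd
  repeat' split
  all_goals rfl

theorem owner_sundialEnd (i : Fin u) (j ε : Fin 2) :
    (sundialEnd i j ε : Lab × Bool).1.owner = .sundial i := by
  unfold sundialEnd; split <;> rfl

theorem owner_zzPt (i : ℕ) : (zzPt i : Lab × Bool).1.owner = .zz := by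
  unfold zzPt
  repeat' split
  all_goals rfl

theorem goodPair_of_block_eq_none {x y : Lab × Bool} (h : x ≠ y) (hx : x.1.block = none)
    (hy : y.1.block = none) : GoodPair TraceLabel.block x y :=
  ⟨h, .inl ⟨hx, hy⟩⟩

theorem goodPair_fatEnd : GoodPair TraceLabel.block (fatEnd 0 : Lab × Bool) (fatEnd 1) := by
  apply goodPair_of_block_eq_none <;> unfold fatEnd <;> split <;> simp [TraceLabel.block]

theorem goodPair_lineEnd (i : Fin r) :
    GoodPair TraceLabel.block (lineEnd i 0 : Lab × Bool) (lineEnd i 1) := by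
  apply goodPair_of_block_eq_none <;> unfold lineEnd <;> split <;> simp [TraceLabel.block]

theorem goodPair_crossEnd (i : Fin s) (j : Fin 2) :
    GoodPair TraceLabel.block (crossEnd i j 0 : Lab × Bool) (crossEnd i j 1) := by
  unfold crossEnd
  by_cases h : i.val < ls
  · apply goodPair_of_block_eq_none <;> fin_cases j <;> simp [h, TraceLabel.block]
  · refine ⟨by simp [h], .inr ⟨⟨i, not_lt.1 h⟩, ?_⟩⟩
    simp [h, TraceLabel.block]

theorem goodPair_pointEnd (i : Fin q) :
    GoodPair TraceLabel.block (pointEnd i 0 : Lab × Bool) (pointEnd i 1) := by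
  apply goodPair_of_block_eq_none <;> unfold pointEnd <;> split <;> simp [TraceLabel.block]

theorem block_zigEnd (i : Fin z) (ε : Fin 2) : (zigEnd i ε : Lab × Bool).1.block = none := by
  unfold zigEnd
  repeat' split
  all_goals rfl

theorem zigEnd_ne {i j : Fin z} {ε ε' : Fin 2} (h : i.val + 1 < j.val ∨ (i = j ∧ ε ≠ ε')) :
    (zigEnd i ε : Lab × Bool) ≠ zigEnd j ε' := by
  have hε : ∀ ε : Fin 2, ε ≠ 0 → ε = 1 := by decide
  have hij : i = j → i.val = j.val := fun h => by rw [h]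
  unfold zigEnd
  simp only [Nat.odd_iff]
  repeat' split
  all_goals
    simp only [ne_eq, Prod.mk.injEq, TraceLabel.red.injEq, RedIdx.zig.injEq, Fin.ext_iff,
      reduceCtorEq, not_false_eq_true, false_and, not_and, TraceLabel.simple.injEq]
  all_goals grind

theorem goodPair_zigEnd (i : Fin z) :
    GoodPair TraceLabel.block (zigEnd i 0 : Lab × Bool) (zigEnd i 1) :=
  goodPair_of_block_eq_none (zigEnd_ne (.inr ⟨rfl, by simp⟩)) (block_zigEnd _ _) (block_zigEnd _ _)

theorem goodPair_sundialEnd (i : Fin u) (j : Fin 2) :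
    GoodPair TraceLabel.block (sundialEnd i j 0 : Lab × Bool) (sundialEnd i j 1) := by
  apply goodPair_of_block_eq_none <;> simp [sundialEnd, TraceLabel.block]

theorem block_zzPt (i : ℕ) : (zzPt i : Lab × Bool).1.block = none := by
  unfold zzPt
  repeat' split
  all_goals rfl

theorem zzPt_fst_ne {i j : ℕ} (h : i ≠ j) (hi : i ≤ k + 1) (hj : j ≤ k + 1) :
    (zzPt i : Lab × Bool).1 ≠ (zzPt j).1 := by
  unfold zzPt
  split <;> split <;> (try split) <;> (try split) <;> simp <;> omega

theorem goodPair_zzPt {i j : ℕ} (h : i ≠ j) (hi : i ≤ k + 1) (hj : j ≤ k + 1) :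
    GoodPair TraceLabel.block (zzPt i : Lab × Bool) (zzPt j) :=
  goodPair_of_block_eq_none (fun h' => zzPt_fst_ne h hi hj (congrArg Prod.fst h')) (block_zzPt _)
    (block_zzPt _)

end Ends

end Construction

end QuadricReduction

/-! ### The specialization spanned by points in general position. -/

namespace QuadricReduction

variable {K : Type*} [Field K]

namespace Construction

variable {δ r s q z u k l ls t : ℕ}

local notation "Lab" => TraceLabel δ r s q z u k l ls t

/-- The specialization with given lines `J x y` through two points and given points. -/
noncomputable def config (J : Lab × Bool → Lab × Bool → Line K) (V : Lab × Bool → Pt K)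
    (W : Lab × Bool → Lab × Bool → Pt K) : SpecConfig K r s q z u (k + 1) where
  fat := J (fatEnd 0) (fatEnd 1)
  line i := J (lineEnd i 0) (lineEnd i 1)
  cross i j := J (crossEnd i j 0) (crossEnd i j 1)
  -- A point off the quadric is the sum of two auxiliary vectors on it.
  point i := if h : i.val < t then V (.simple (.point i h), false)
    else W (pointEnd i 0) (pointEnd i 1)
  zig i := J (zigEnd i 0) (zigEnd i 1)
  sundial i j := J (sundialEnd i j 0) (sundialEnd i j 1)
  zz i := J (zzPt i) (zzPt (i + 1))

/-- The functions `J`, `V` and `W` yield the lines and points spanned by the vectors `P x`, and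
the points spanned by the sum of two of them. -/
structure Spans (P : Lab × Bool → Fin 4 → K) (J : Lab × Bool → Lab × Bool → Line K)
    (V : Lab × Bool → Pt K) (W : Lab × Bool → Lab × Bool → Pt K) : Prop where
  line : ∀ x y, LinearIndependent K ![P x, P y] → (J x y).1 = Submodule.span K {P x, P y}
  point : ∀ x, P x ≠ 0 → (V x).submodule = Submodule.span K {P x}
  add : ∀ x y, LinearIndependent K ![P x, P y] →
    (W x y).submodule = Submodule.span K {P x + P y}

/-- `L₀` and the vector of ones give values where two vectors are dependent or a vector is zero. -/
theorem exists_spans (L₀ : Line K) (P : Lab × Bool → Fin 4 → K) : ∃ J V W, Spans P J V W := by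
  have hJ : ∀ x y, ∃ L : Line K, LinearIndependent K ![P x, P y] →
      L.1 = Submodule.span K {P x, P y} := fun x y => by
    by_cases h : LinearIndependent K ![P x, P y]
    · obtain ⟨L, hL⟩ := exists_line_eq_span h
      exact ⟨L, fun _ => hL⟩
    · exact ⟨L₀, fun h' => absurd h' h⟩
  have hpt : ∀ v : Fin 4 → K, ∃ p : Pt K, v ≠ 0 → p.submodule = Submodule.span K {v} :=
    fun v => by
      by_cases h : v ≠ 0
      · obtain ⟨p, hp⟩ := exists_pt_eq_span h
        exact ⟨p, fun _ => hp⟩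
      · exact ⟨.mk K (fun _ => 1) (fun h => one_ne_zero (congrFun h 0)), fun h' => absurd h' h⟩
  choose J hJ using hJ
  choose p hp using hpt
  refine ⟨J, fun x => p (P x), fun x y => p (P x + P y), hJ, fun x h => hp _ h,
    fun x y h => hp _ fun h0 => ?_⟩
  have := LinearIndependent.pair_iff.1 h 1 1 (by simpa using h0)
  exact one_ne_zero this.1

variable {F : Coord K} {ℛ : Set (Line K)} {P : TraceLabel δ r s q z u k l ls t × Bool → Fin 4 → K}
  {J : TraceLabel δ r s q z u k l ls t × Bool → TraceLabel δ r s q z u k l ls t × Bool → Line K}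
  {V : TraceLabel δ r s q z u k l ls t × Bool → Pt K}
  {W : TraceLabel δ r s q z u k l ls t × Bool → TraceLabel δ r s q z u k l ls t × Bool → Pt K}

section General

variable (hP : IsGeneral F ℛ TraceLabel.block P) (hF : F.IsHomogeneous 2)

include hP hF

/-- Two points with the same label span a line of the ruling; two with different labels have nonzero
polar form. -/
theorem linearIndependent_of_goodPair {x y : Lab × Bool}
    (h : GoodPair TraceLabel.block x y) : LinearIndependent K ![P x, P y] := by
  by_cases hxy : x.1 = y.1
  · obtain ⟨l, ε⟩ := x
    obtain ⟨l', ε'⟩ := y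
    obtain rfl : l = l' := hxy
    obtain ⟨hne, ⟨hl, -⟩ | ⟨j, -, -, h1, h2⟩⟩ := h
    · cases ε <;> cases ε'
      · exact absurd rfl hne
      · exact hP.linearIndependent l hl
      · rw [LinearIndependent.pair_symm_iff]
        exact hP.linearIndependent l hl
      · exact absurd rfl hne
    · exact absurd (by rw [show ε = ε' from h1.trans h2.symm]) hne
  · refine linearIndependent_of_polarForm_ne_zero hF (hP.onQuadric x) (hP.onQuadric y)
      (hP.polarForm_ne_zero x y hxy fun hx => ?_)
    obtain ⟨-, ⟨hx', -⟩ | ⟨j, -, -, h1, -⟩⟩ := h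
    · exact absurd hx' hx
    · exact h1

theorem ne_zero (x : Lab) : P (x, false) ≠ 0 := by
  rcases h : x.block with - | ⟨i, hi⟩
  · exact (hP.linearIndependent x h).ne_zero 0
  · obtain ⟨j, ε, rfl⟩ := TraceLabel.block_eq_some.1 h
    -- A point of an uncut cross is compared with the other point of the same line.
    have : (TraceLabel.simple (.uncut i hi j ε) : Lab) ≠ .simple (.uncut i hi j (ε + 1)) := by
      simp
    intro h0
    refine hP.polarForm_ne_zero (.simple (.uncut i hi j ε), false)
      (.simple (.uncut i hi j (ε + 1)), false) this (fun _ => rfl) ?_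
    rw [h0, polarForm_comm hF, map_zero]

variable (hS : Spans P J V W)
include hS

theorem line_eq {x y : Lab × Bool} (h : GoodPair TraceLabel.block x y) :
    (J x y).1 = Submodule.span K {P x, P y} :=
  hS.line x y (linearIndependent_of_goodPair hP hF h)

theorem mem_left {x y : Lab × Bool} (h : GoodPair TraceLabel.block x y) : P x ∈ (J x y).1 := by
  rw [line_eq hP hF hS h]
  exact Submodule.subset_span (by simp)

theorem mem_right {x y : Lab × Bool} (h : GoodPair TraceLabel.block x y) : P y ∈ (J x y).1 := by
  rw [line_eq hP hF hS h]
  exact Submodule.subset_span (by simp)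

theorem point_eq (x : Lab) : (V (x, false)).submodule = Submodule.span K {P (x, false)} :=
  hS.point _ (ne_zero hP hF x)

theorem point_le_iff (x : Lab) {U : Submodule K (Fin 4 → K)} :
    (V (x, false)).submodule ≤ U ↔ P (x, false) ∈ U := by
  rw [point_eq hP hF hS, Submodule.span_singleton_le_iff_mem]

theorem vanishesOn_point (x : Lab) : VanishesOn F (V (x, false)).submodule := by
  rw [point_eq hP hF hS]
  exact vanishesOn_span_singleton hF (hP.onQuadric _)

theorem point_ne {x y : Lab} (h : x ≠ y) : V (x, false) ≠ V (y, false) := by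
  intro h'
  have h1 : P (x, false) ∈ Submodule.span K {P (y, false)} := by
    rw [← point_eq hP hF hS, ← h', point_eq hP hF hS]
    exact Submodule.mem_span_singleton_self _
  obtain ⟨c, hc⟩ := Submodule.mem_span_singleton.1 h1
  refine hP.polarForm_ne_zero (y, false) (x, false) h.symm (fun _ => rfl) ?_
  rw [← hc, map_smul, polarForm_self hF (hP.onQuadric _), smul_zero]

theorem transversal_of_goodPair {x y : Lab × Bool} (h : GoodPair TraceLabel.block x y)
    (hxy : x.1 ≠ y.1) : Transversal F (J x y) := by
  refine transversal_of_polarForm_ne_zero hF (hP.onQuadric x) (hP.onQuadric y)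
      (hP.polarForm_ne_zero x y hxy fun hx => ?_) (line_eq hP hF hS h)
  obtain ⟨-, ⟨hx', -⟩ | ⟨j, -, -, h1, -⟩⟩ := h
  · exact absurd hx' hx
  · exact h1

omit hF in
theorem mem_ruling {x : Lab} (h : x.block = none) : J (x, false) (x, true) ∈ ℛ := by
  obtain ⟨L, hL, hL'⟩ := hP.exists_line x h
  have : J (x, false) (x, true) = L := Subtype.ext (by
    rw [hS.line _ _ (hP.linearIndependent x h)]
    exact Line.span_pair_eq (hL' _) (hL' _) (hP.linearIndependent x h))
  rwa [this]

omit hS in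
/-- A point does not lie on a line of the ruling that passes through a point with a different
label. -/
theorem notMem_of_mem_ruling (hℛ : IsRuling F ℛ) {x y : Lab × Bool} (hxy : x.1 ≠ y.1)
    (hx : x.1.block ≠ none → x.2 = false) {L : Line K} (hL : L ∈ ℛ) (hy : P y ∈ L.1) :
    P x ∉ L.1 := fun h =>
  hP.polarForm_ne_zero x y hxy hx (eval_line_eq_zero_iff hF (hℛ.onQuadric L hL) h hy)

theorem notMem_of_goodPair {x y w : Lab × Bool} (h : GoodPair TraceLabel.block y w)
    (hxy : x.1 ≠ y.1) (hxw : x.1 ≠ w.1) (hyw : y.1 ≠ w.1)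
    (hx : x.1.block ≠ none → x.2 = false) : P x ∉ (J y w).1 := by
  rw [line_eq hP hF hS h]
  refine notMem_span_pair_of_polarForm_ne_zero hF (hP.onQuadric _) (hP.onQuadric _)
    (hP.onQuadric _) (hP.polarForm_ne_zero _ _ hxy hx) (hP.polarForm_ne_zero _ _ hxw hx)
    (hP.polarForm_ne_zero _ _ hyw fun hy => ?_)
  obtain ⟨-, ⟨hx', -⟩ | ⟨j, -, -, h1, -⟩⟩ := h
  · exact absurd hx' hy
  · exact h1

/-- Points are replaced by lines through them as well, so that disjointness of components becomes
one statement about spans of good pairs. -/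
theorem exists_goodPair_of_mem_allPieces {a : SpecPart r s q z u}
    {U : Submodule K (Fin 4 → K)} (hU : U ∈ (config J V W).allPieces a) :
    ∃ x y : Lab × Bool, GoodPair TraceLabel.block x y ∧ x.1.owner = a ∧ y.1.owner = a ∧
      U ≤ Submodule.span K {P x, P y} := by
  match a, hU with
  | .old .fat, hU =>
    obtain rfl := hU
    exact ⟨_, _, goodPair_fatEnd, owner_fatEnd _, owner_fatEnd _,
      (line_eq hP hF hS goodPair_fatEnd).le⟩
  | .old (.line i), hU =>
    obtain rfl := hU
    exact ⟨_, _, goodPair_lineEnd i, owner_lineEnd _ _, owner_lineEnd _ _,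
      (line_eq hP hF hS (goodPair_lineEnd i)).le⟩
  | .old (.cross i), hU =>
    obtain ⟨j, rfl⟩ := hU
    exact ⟨_, _, goodPair_crossEnd i j, owner_crossEnd _ _ _, owner_crossEnd _ _ _,
      (line_eq hP hF hS (goodPair_crossEnd i j)).le⟩
  | .old (.point i), hU =>
    obtain rfl := hU
    refine ⟨_, _, goodPair_pointEnd i, owner_pointEnd _ _, owner_pointEnd _ _, ?_⟩
    by_cases h : i.val < t
    · simp only [config, h, dif_pos]
      rw [point_le_iff hP hF hS]
      exact Submodule.subset_span (by simp [pointEnd, h])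
    · simp only [config, h, dif_neg, not_false_eq_true]
      rw [hS.add _ _ (linearIndependent_of_goodPair hP hF (goodPair_pointEnd i)),
        Submodule.span_singleton_le_iff_mem]
      exact Submodule.add_mem _ (Submodule.subset_span (by simp)) (Submodule.subset_span (by simp))
  | .old .zig, hU =>
    obtain ⟨j, rfl⟩ := hU
    exact ⟨_, _, goodPair_zigEnd j, owner_zigEnd _ _, owner_zigEnd _ _,
      (line_eq hP hF hS (goodPair_zigEnd j)).le⟩
  | .sundial i, hU =>
    obtain ⟨j, rfl⟩ := hU
    exact ⟨_, _, goodPair_sundialEnd i j, owner_sundialEnd _ _ _, owner_sundialEnd _ _ _,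
      (line_eq hP hF hS (goodPair_sundialEnd i j)).le⟩
  | .zz, hU =>
    obtain ⟨j, rfl⟩ := hU
    have hg : GoodPair TraceLabel.block (zzPt j : Lab × Bool) (zzPt (j + 1)) :=
      goodPair_zzPt (by omega) (by omega) (by omega)
    exact ⟨_, _, hg, owner_zzPt _, owner_zzPt _, (line_eq hP hF hS hg).le⟩

/-- General position separates two good pairs unless both lie in the same block, and a block
determines its cross. -/
theorem disjoint_allPieces {a b : SpecPart r s q z u} (hab : a ≠ b)
    {U : Submodule K (Fin 4 → K)} (hU : U ∈ (config J V W).allPieces a)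
    {U' : Submodule K (Fin 4 → K)} (hU' : U' ∈ (config J V W).allPieces b) : Disjoint U U' := by
  obtain ⟨x, y, hxy, hx, hy, hle⟩ := exists_goodPair_of_mem_allPieces hP hF hS hU
  obtain ⟨x', y', hxy', hx', hy', hle'⟩ := exists_goodPair_of_mem_allPieces hP hF hS hU'
  have hne : ∀ {v w : Lab × Bool}, v.1.owner = a → w.1.owner = b → v ≠ w := by
    rintro v w hv hw rfl
    exact hab (hv.symm.trans hw)
  refine (hP.disjoint x y x' y' hxy hxy' (hne hx hx') (hne hx hy') (hne hy hx') (hne hy hy')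
    ?_).mono hle hle'
  by_contra! hcon
  obtain ⟨i, hi⟩ := Option.ne_none_iff_exists'.1 hcon.1
  have h1 := TraceLabel.owner_eq_of_block_eq_some hi
  have h2 := TraceLabel.owner_eq_of_block_eq_some (hcon.2.symm.trans hi)
  exact hab (hx.symm.trans (h1.trans (h2.symm.trans hx')))

theorem disjoint_of_goodPair {x y x' y' : Lab × Bool} (h : GoodPair TraceLabel.block x y)
    (h' : GoodPair TraceLabel.block x' y') (hxx : x ≠ x') (hxy : x ≠ y') (hyx : y ≠ x')
    (hyy : y ≠ y') (hb : x.1.block = none) : Disjoint (J x y).1 (J x' y').1 := by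
  rw [line_eq hP hF hS h, line_eq hP hF hS h']
  exact hP.disjoint x y x' y' h h' hxx hxy hyx hyy (.inl hb)

end General

end Construction

end QuadricReduction

/-! ### Chains in the constructed specialization. -/

namespace QuadricReduction

variable {K : Type*} [Field K]

namespace Construction

variable {δ r s q z u k l ls t : ℕ}

local notation "Lab" => TraceLabel δ r s q z u k l ls t

/-- The points of a cross are numbered line by line. -/
def fourEquiv : Fin 4 ≃ Fin 2 × Fin 2 where
  toFun m := (![0, 0, 1, 1] m, ![0, 1, 0, 1] m)
  invFun x := ![![0, 1], ![2, 3]] x.1 x.2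
  left_inv := by decide
  right_inv := by decide

/-- The labels of the points of an uncut cross. -/
def uncutLabel (x : {i : Fin s // ls ≤ i.val} × Fin 4) : Lab :=
  .simple (.uncut x.1.1 x.1.2 (fourEquiv x.2).1 (fourEquiv x.2).2)

theorem crossEnd_of_le {i : Fin s} (h : ls ≤ i.val) (j ε : Fin 2) :
    (crossEnd i j ε : Lab × Bool) = (.simple (.uncut i h j ε), false) := by
  rw [crossEnd, dif_neg (not_lt.2 h)]

theorem crossEnd_of_lt {i : Fin s} (h : i.val < ls) (ε : Fin 2) :
    (crossEnd i 1 ε : Lab × Bool) = (.red (.cut i h), ε == 1) := by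
  simp [crossEnd, h]

theorem crossEnd_zero_zero {i : Fin s} (h : i.val < ls) :
    (crossEnd i 0 0 : Lab × Bool) = (.simple (.cut i h), false) := by
  simp [crossEnd, h]

theorem crossEnd_zero_one {i : Fin s} (h : i.val < ls) :
    (crossEnd i 0 1 : Lab × Bool) = (.red (.cut i h), true) := by
  simp [crossEnd, h]

theorem zigEnd_of_odd {i : Fin z} (h : Odd i.val) (ε : Fin 2) :
    (zigEnd i ε : Lab × Bool) = (.red (.zig i h), ε == 1) := by
  rw [zigEnd, dif_pos h]

theorem zigEnd_one_of_even {i j : Fin z} (h : Odd j.val) (hij : i.val + 1 = j.val) :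
    (zigEnd i 1 : Lab × Bool) = (.red (.zig j h), true) := by
  have hi : ¬ Odd i.val := by
    rw [← hij] at h
    simpa [parity_simps] using h
  obtain ⟨j, hj⟩ := j
  obtain rfl : i.val + 1 = j := hij
  rw [zigEnd, dif_neg hi, if_neg (by simp), dif_pos hj]

theorem zigEnd_zero_of_even {i j : Fin z} (h : Odd i.val) (hij : i.val + 1 = j.val) :
    (zigEnd j 0 : Lab × Bool) = (.red (.zig i h), false) := by
  have hj : ¬ Odd j.val := by
    rw [← hij]
    simpa [parity_simps] using h
  rw [zigEnd, dif_neg hj, if_pos rfl, dif_neg (by omega)]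
  simp [← hij]

theorem zigEnd_zero_start (h : 0 < z) :
    (zigEnd ⟨0, h⟩ 0 : Lab × Bool) = (.simple (.zigStart h), false) := by
  simp [zigEnd]

theorem zigEnd_one_last (h : Odd z) {j : Fin z} (hj : j.val + 1 = z) :
    (zigEnd j 1 : Lab × Bool) = (.simple (.zigEnd h), false) := by
  have hj' : ¬ Odd j.val := by
    rw [← hj] at h
    simpa [parity_simps] using h
  rw [zigEnd, dif_neg hj', if_neg (by simp), dif_neg (by omega)]

theorem zigEnd_fst_ne {i : Fin z} (h : Even i.val) :
    (zigEnd i 0 : Lab × Bool).1 ≠ (zigEnd i 1 : Lab × Bool).1 := by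
  rw [zigEnd, zigEnd, dif_neg (Nat.not_odd_iff_even.2 h), dif_neg (Nat.not_odd_iff_even.2 h)]
  repeat' split
  all_goals simp_all

theorem zzPt_zero : (zzPt 0 : Lab × Bool) = (.simple (.zz 0), false) := rfl

theorem zzPt_last : (zzPt (k + 1) : Lab × Bool) = (.simple (.zz 1), false) := by
  simp [zzPt]

theorem zzPt_succ (i : Fin k) : (zzPt (i + 1) : Lab × Bool) = (.double (.inr i), false) := by
  simp [zzPt]

theorem zzPt_eq_snd_false (i : ℕ) : (zzPt i : Lab × Bool).2 = false := by
  unfold zzPt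
  repeat' split
  all_goals rfl

variable {F : Coord K} {ℛ : Set (Line K)} {P : TraceLabel δ r s q z u k l ls t × Bool → Fin 4 → K}
  {J : TraceLabel δ r s q z u k l ls t × Bool → TraceLabel δ r s q z u k l ls t × Bool → Line K}
  {V : TraceLabel δ r s q z u k l ls t × Bool → Pt K}
  {W : TraceLabel δ r s q z u k l ls t × Bool → TraceLabel δ r s q z u k l ls t × Bool → Pt K}

theorem isChain_two {L : Fin 2 → Line K} (h : Module.finrank K ↥((L 0).1 ⊓ (L 1).1) = 1) :
    IsChain L := by
  refine ⟨fun i j hij => ?_, fun i j hij => by omega⟩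
  obtain rfl : i = 0 := by omega
  obtain rfl : j = 1 := by omega
  exact h

theorem ne_of_transversal_of_mem (hℛ : IsRuling F ℛ) {L M : Line K} (hL : Transversal F L) (hM : M ∈ ℛ) : L ≠ M :=
  fun h => hL.1 (h ▸ hℛ.onQuadric M hM)

variable (hP : IsGeneral F ℛ TraceLabel.block P) (hF : F.IsHomogeneous 2)
  (hℛ : IsRuling F ℛ) (hS : Spans P J V W)

include hP hF hS

omit hP hF hS in
theorem config_redLine (x : RedIdx r s z l ls) :
    (config J V W).redLine x = J (.red x, false) (.red x, true) := by
  match x with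
  | .line i h => simp [SpecConfig.redLine, config, lineEnd, h]
  | .cut i h => simp [SpecConfig.redLine, config, crossEnd_of_lt h]
  | .zig i h => simp [SpecConfig.redLine, config, zigEnd_of_odd h]

omit hF in
theorem config_redLine_mem (x : RedIdx r s z l ls) : (config J V W).redLine x ∈ ℛ := by
  rw [config_redLine]
  exact mem_ruling hP hS rfl

theorem mem_config_redLine (x : RedIdx r s z l ls) (ε : Bool) :
    P (.red x, ε) ∈ ((config J V W).redLine x).1 := by
  rw [config_redLine]
  have hg : GoodPair TraceLabel.block (.red x, false) ((.red x, true) : Lab × Bool) :=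
    goodPair_of_block_eq_none (by simp) rfl rfl
  cases ε
  · exact mem_left hP hF hS hg
  · exact mem_right hP hF hS hg

omit hF hS in
theorem red_ne_zero (x : RedIdx r s z l ls) (ε : Bool) : P (.red x, ε) ≠ 0 := by
  cases ε
  · exact (hP.linearIndependent (.red x) rfl).ne_zero 0
  · exact (hP.linearIndependent (.red x) rfl).ne_zero 1

theorem mem_config_fat (ε : Fin 2) : P (fatEnd ε) ∈ (config J V W).fat.1 := by
  fin_cases ε
  · exact mem_left hP hF hS goodPair_fatEnd
  · exact mem_right hP hF hS goodPair_fatEnd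

theorem mem_config_line (i : Fin r) (ε : Fin 2) :
    P (lineEnd i ε) ∈ ((config J V W).line i).1 := by
  fin_cases ε
  · exact mem_left hP hF hS (goodPair_lineEnd i)
  · exact mem_right hP hF hS (goodPair_lineEnd i)

theorem mem_config_cross (i : Fin s) (j ε : Fin 2) :
    P (crossEnd i j ε) ∈ ((config J V W).cross i j).1 := by
  fin_cases ε
  · exact mem_left hP hF hS (goodPair_crossEnd i j)
  · exact mem_right hP hF hS (goodPair_crossEnd i j)

theorem mem_config_zig (i : Fin z) (ε : Fin 2) :
    P (zigEnd i ε) ∈ ((config J V W).zig i).1 := by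
  fin_cases ε
  · exact mem_left hP hF hS (goodPair_zigEnd i)
  · exact mem_right hP hF hS (goodPair_zigEnd i)

theorem config_cross_off (i : Fin s) (j : Fin 2) (h : j = 0 ∨ ls ≤ i.val) :
    Transversal F ((config J V W).cross i j) := by
  refine transversal_of_goodPair hP hF hS (goodPair_crossEnd i j) ?_
  rcases lt_or_ge i.val ls with hi | hi
  · obtain rfl : j = 0 := h.resolve_right (by omega)
    rw [crossEnd_zero_zero hi, crossEnd_zero_one hi]
    simp
  · rw [crossEnd_of_le hi, crossEnd_of_le hi]
    simp

theorem config_zig_off (i : Fin z) (h : Even i.val) : Transversal F ((config J V W).zig i) :=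
  transversal_of_goodPair hP hF hS (goodPair_zigEnd i) (zigEnd_fst_ne h)

theorem config_zz_off (i : Fin (k + 1)) : Transversal F ((config J V W).zz i) :=
  transversal_of_goodPair hP hF hS (goodPair_zzPt (by omega) (by omega) (by omega))
    (zzPt_fst_ne (by omega) (by omega) (by omega))

theorem mem_zz_left (i : Fin (k + 1)) : P (zzPt i) ∈ ((config J V W).zz i).1 :=
  mem_left hP hF hS (goodPair_zzPt (by omega) (by omega) (by omega))

theorem mem_zz_right (i : Fin (k + 1)) : P (zzPt (i + 1)) ∈ ((config J V W).zz i).1 :=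
  mem_right hP hF hS (goodPair_zzPt (by omega) (by omega) (by omega))

theorem zzPt_notMem (i : ℕ) (hi : i ≤ k + 1) (j : Fin (k + 1)) (h : i ≠ j.val)
    (h' : i ≠ j.val + 1) : P (zzPt i) ∉ ((config J V W).zz j).1 :=
  notMem_of_goodPair hP hF hS (goodPair_zzPt (by omega) (by omega) (by omega))
    (zzPt_fst_ne h hi (by omega)) (zzPt_fst_ne h' hi (by omega))
    (zzPt_fst_ne (by omega) (by omega) (by omega)) fun h => absurd (block_zzPt i) h

omit hS in
theorem zzPt_ne_zero (i : ℕ) : P (zzPt i) ≠ 0 := by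
  have : (zzPt i : Lab × Bool) = ((zzPt i).1, false) :=
    Prod.ext rfl (zzPt_eq_snd_false i)
  rw [this]
  exact ne_zero hP hF _

theorem config_zz_chain : IsChain (config J V W).zz := by
  refine ⟨fun i j hij => ?_, fun i j hij => ?_⟩
  · refine Line.finrank_inf_eq_one (a := P (zzPt j)) (fun h => ?_) (zzPt_ne_zero hP hF _) ?_ ?_
    · refine zzPt_notMem hP hF hS i (by omega) j (by omega) (by omega) ?_
      rw [← h]
      exact mem_zz_left hP hF hS i
    · rw [← hij]
      exact mem_zz_right hP hF hS i
    · exact mem_zz_left hP hF hS j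
  · have hne : ∀ {i j : ℕ}, i ≠ j → i ≤ k + 1 → j ≤ k + 1 → (zzPt i : Lab × Bool) ≠ zzPt j :=
      fun h hi hj h' => zzPt_fst_ne h hi hj (congrArg Prod.fst h')
    exact disjoint_of_goodPair hP hF hS (goodPair_zzPt (by omega) (by omega) (by omega))
      (goodPair_zzPt (by omega) (by omega) (by omega)) (hne (by omega) (by omega) (by omega))
      (hne (by omega) (by omega) (by omega)) (hne (by omega) (by omega) (by omega))
      (hne (by omega) (by omega) (by omega)) (block_zzPt _)

theorem sundial_notMem (i : Fin u) {j j' : Fin 2} (h : j ≠ j') :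
    P (.simple (.sundial i j), false) ∉ ((config J V W).sundial i j').1 :=
  notMem_of_goodPair hP hF hS (goodPair_sundialEnd i j') (by simp [sundialEnd, h])
    (by simp [sundialEnd]) (by simp [sundialEnd]) fun h => absurd rfl h

theorem mem_sundial (i : Fin u) (j : Fin 2) :
    P (.simple (.sundial i j), false) ∈ ((config J V W).sundial i j).1 :=
  mem_left hP hF hS (goodPair_sundialEnd i j)

theorem node_mem_sundial (i : Fin u) (j : Fin 2) :
    P (.double (.inl i), false) ∈ ((config J V W).sundial i j).1 :=
  mem_right hP hF hS (goodPair_sundialEnd i j)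

theorem config_sundial_chain (i : Fin u) : IsChain ((config J V W).sundial i) := by
  refine isChain_two (Line.finrank_inf_eq_one (fun h => ?_) (ne_zero hP hF _)
    (node_mem_sundial hP hF hS i 0) (node_mem_sundial hP hF hS i 1))
  refine sundial_notMem hP hF hS i zero_ne_one ?_
  rw [← h]
  exact mem_sundial hP hF hS i 0

include hℛ

/-- Of two consecutive lines one is transversal and the other in the ruling, so they differ, and
they share an end by construction. -/
theorem config_zig_chain : IsChain (config J V W).zig := by
  refine ⟨fun i j hij => ?_, fun i j hij => ?_⟩
  · rcases Nat.even_or_odd i.val with hi | hi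
    · have hj : Odd j.val := hij ▸ hi.add_one
      refine Line.finrank_inf_eq_one (ne_of_transversal_of_mem hℛ
        (config_zig_off hP hF hS i hi) (config_redLine_mem hP hS (.zig j hj)))
        (red_ne_zero hP (.zig j hj) _) ?_
        (mem_config_redLine hP hF hS (.zig j hj) true)
      have := mem_config_zig hP hF hS i 1
      rwa [zigEnd_one_of_even hj hij] at this
    · have hj : Even j.val := hij ▸ hi.add_one
      rw [inf_comm]
      refine Line.finrank_inf_eq_one (ne_of_transversal_of_mem hℛ
        (config_zig_off hP hF hS j hj) (config_redLine_mem hP hS (.zig i hi)))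
        (red_ne_zero hP (.zig i hi) _) ?_
        (mem_config_redLine hP hF hS (.zig i hi) false)
      have := mem_config_zig hP hF hS j 0
      rwa [zigEnd_zero_of_even hi hij] at this
  · exact disjoint_of_goodPair hP hF hS (goodPair_zigEnd i) (goodPair_zigEnd j)
      (zigEnd_ne (.inl hij)) (zigEnd_ne (.inl hij)) (zigEnd_ne (.inl hij))
      (zigEnd_ne (.inl hij)) (block_zigEnd _ _)

theorem config_cut_chain {i : Fin s} (h : i.val < ls) : IsChain ((config J V W).cross i) := by
  refine isChain_two (Line.finrank_inf_eq_one (ne_of_transversal_of_mem hℛ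
    (config_cross_off hP hF hS i 0 (.inl rfl)) (config_redLine_mem hP hS (.cut i h)))
    (red_ne_zero hP (.cut i h) _) ?_
    (mem_config_redLine hP hF hS (.cut i h) true))
  have := mem_config_cross hP hF hS i 0 1
  rwa [crossEnd_zero_one h] at this

end Construction

end QuadricReduction

/-! ### The construction yields a specialization with the prescribed trace. -/

namespace QuadricReduction

variable {K : Type*} [Field K]

namespace Construction

variable {δ r s q z u k l ls t : ℕ}

local notation "Lab" => TraceLabel δ r s q z u k l ls t

variable {F : Coord K} {ℛ : Set (Line K)} {P : TraceLabel δ r s q z u k l ls t × Bool → Fin 4 → K}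
  {J : TraceLabel δ r s q z u k l ls t × Bool → TraceLabel δ r s q z u k l ls t × Bool → Line K}
  {V : TraceLabel δ r s q z u k l ls t × Bool → Pt K}
  {W : TraceLabel δ r s q z u k l ls t × Bool → TraceLabel δ r s q z u k l ls t × Bool → Pt K}

variable (hP : IsGeneral F ℛ TraceLabel.block P) (hF : F.IsHomogeneous 2)
  (hℛ : IsRuling F ℛ) (hS : Spans P J V W)
  (hquad : ∀ i : {i : Fin s // ls ≤ i.val},
    ¬ LinearIndependent K (fun m : Fin 4 => P (uncutLabel (i, m), false)) ∧
      ∀ m₀, LinearIndependent K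
        (fun m : {m : Fin 4 // m ≠ m₀} => P (uncutLabel (i, m.1), false)))

include hP hF hS

theorem config_uncut_eq {i : Fin s} (h : ls ≤ i.val) (j : Fin 2) :
    ((config J V W).cross i j).1 = Submodule.span K
      {P (.simple (.uncut i h j 0), false), P (.simple (.uncut i h j 1), false)} := by
  have := line_eq hP hF hS (goodPair_crossEnd i j)
  rw [crossEnd_of_le h, crossEnd_of_le h] at this
  simp only [config, crossEnd_of_le h]
  exact this

/-- The intersection point of an uncut cross is not on the quadric. -/
theorem config_uncut_not_vanishesOn {i : Fin s} (h : ls ≤ i.val)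
    (hi : Module.finrank K ↥(((config J V W).cross i 0).1 ⊓ ((config J V W).cross i 1).1) = 1) :
    ¬ VanishesOn F (((config J V W).cross i 0).1 ⊓ ((config J V W).cross i 1).1) := by
  intro hv
  have hbot : ((config J V W).cross i 0).1 ⊓ ((config J V W).cross i 1).1 ≠ ⊥ := fun h0 => by
    rw [h0, finrank_bot] at hi
    exact zero_ne_one hi
  obtain ⟨w, ⟨hw0, hw1⟩, hne⟩ := (Submodule.ne_bot_iff _).1 hbot
  have hFw := hv w ⟨hw0, hw1⟩
  have key : ∀ j, w ∈ ((config J V W).cross i j).1 →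
      ∃ (ε : Fin 2) (c : K), w = c • P (.simple (.uncut i h j ε), false) := fun j hw => by
    have hpol : polarForm F (P (.simple (.uncut i h j 0), false))
        (P (.simple (.uncut i h j 1), false)) ≠ 0 :=
      hP.polarForm_ne_zero _ _ (by simp) fun _ => rfl
    have h0 := mem_config_cross hP hF hS i j 0
    have h1 := mem_config_cross hP hF hS i j 1
    rw [crossEnd_of_le h] at h0 h1
    rcases Line.eq_or_eq_of_polarForm_ne_zero hF h0 h1 (hP.onQuadric _) (hP.onQuadric _)
      (linearIndependent_of_polarForm_ne_zero hF (hP.onQuadric _) (hP.onQuadric _) hpol) hpol hw hFw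
      with ⟨c, hc⟩ | ⟨c, hc⟩
    · exact ⟨0, c, hc⟩
    · exact ⟨1, c, hc⟩
  -- A node on the quadric would be proportional to an end of each of the two lines. These ends have
  -- nonzero polar form, whereas B(w, w) = 0.
  obtain ⟨ε, c, hc⟩ := key 0 hw0
  obtain ⟨ε', c', hc'⟩ := key 1 hw1
  have hpol : polarForm F (P (.simple (.uncut i h 0 ε), false))
      (P (.simple (.uncut i h 1 ε'), false)) ≠ 0 :=
    hP.polarForm_ne_zero _ _ (by simp) fun _ => rfl
  have hcc : polarForm F w w = c * (c' * polarForm F (P (.simple (.uncut i h 0 ε), false))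
      (P (.simple (.uncut i h 1 ε'), false))) := by
    calc polarForm F w w = polarForm F (c • P (.simple (.uncut i h 0 ε), false))
          (c' • P (.simple (.uncut i h 1 ε'), false)) := by rw [← hc, ← hc']
      _ = _ := by
        rw [map_smul, polarForm_comm hF, map_smul, polarForm_comm hF]
        simp only [smul_eq_mul]
        ring
  rw [polarForm_self hF hFw] at hcc
  have hc0 : c ≠ 0 := by rintro rfl; exact hne (by rw [hc, zero_smul])
  have hc0' : c' ≠ 0 := by rintro rfl; exact hne (by rw [hc', zero_smul])
  exact mul_ne_zero hc0 (mul_ne_zero hc0' hpol) hcc.symm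

-- Here coplanarity of the quadruples is used: without it the two lines of an uncut cross would not
-- meet.
include hquad in
theorem config_uncut_finrank {i : Fin s} (h : ls ≤ i.val) :
    Module.finrank K ↥(((config J V W).cross i 0).1 ⊓ ((config J V W).cross i 1).1) = 1 :=
  finrank_inf_eq_one_of_coplanar (y := fun m => P (uncutLabel (⟨i, h⟩, m), false))
    (config_uncut_eq hP hF hS h 0) (config_uncut_eq hP hF hS h 1) (hquad ⟨i, h⟩).1
    (hquad ⟨i, h⟩).2

omit hP hF hS in
theorem config_point_on {i : Fin q} (h : i.val < t) :
    (config J V W).point i = V (.simple (.point i h), false) := by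
  simp [config, h]

/-- For a and b on the quadric F(a + b) = B(a, b), which is not zero in general position. -/
theorem config_point_off {i : Fin q} (h : t ≤ i.val) :
    ¬ VanishesOn F ((config J V W).point i).submodule := by
  intro hv
  have hli := linearIndependent_of_goodPair hP hF (goodPair_pointEnd i)
  have hsub : ((config J V W).point i).submodule = Submodule.span K
      {P (pointEnd i 0) + P (pointEnd i 1)} := by
    simp only [config, not_lt.2 h, dif_neg, not_false_eq_true]
    exact hS.add _ _ hli
  have h0 := hv _ (hsub ▸ Submodule.mem_span_singleton_self _)
  rw [eval_add_eq hF, hP.onQuadric, hP.onQuadric, zero_add, add_zero] at h0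
  refine hP.polarForm_ne_zero (pointEnd i 0) (pointEnd i 1) ?_ ?_ h0
  · simp [pointEnd, not_lt.2 h]
  · simp [pointEnd, not_lt.2 h]

include hℛ hquad

theorem config_isSpecialization :
    (config J V W).IsSpecialization F ℛ δ l ls t where
  proper :=
    { cross_chain := fun i => by
        rcases lt_or_ge i.val ls with h | h
        · exact config_cut_chain hP hF hℛ hS h
        · exact isChain_two (config_uncut_finrank hP hF hS hquad h)
      zig_chain := config_zig_chain hP hF hℛ hS
      disjoint := fun a b hab U hU U' hU' => disjoint_allPieces hP hF hS (a := .old a) (b := .old b)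
        (fun h => hab (SpecPart.old.inj h)) hU hU' }
  sundial_chain := config_sundial_chain hP hF hS
  zz_chain := config_zz_chain hP hF hS
  disjoint := fun a b hab U hU U' hU' => disjoint_allPieces hP hF hS hab hU hU'
  fat_on := fun h => by
    have h0 : 0 < δ := by omega
    have := mem_ruling (J := J) hP hS (x := .fatLine ⟨0, h0⟩) rfl
    simpa [config, fatEnd, h0] using this
  fat_off := fun h => by
    refine transversal_of_goodPair hP hF hS goodPair_fatEnd ?_
    simp [fatEnd, h]
  line_on := fun i h => config_redLine_mem hP hS (.line i h)
  line_off := fun i h => by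
    refine transversal_of_goodPair hP hF hS (goodPair_lineEnd i) ?_
    simp [lineEnd, not_lt.2 h]
  cross_off_zero := fun i => config_cross_off hP hF hS i 0 (.inl rfl)
  cross_on := fun i h => config_redLine_mem hP hS (.cut i h)
  cross_off := fun i h => ⟨config_cross_off hP hF hS i 1 (.inr h),
    config_uncut_not_vanishesOn hP hF hS h (config_uncut_finrank hP hF hS hquad h)⟩
  zig_on := fun i h => config_redLine_mem hP hS (.zig i h)
  zig_off := fun i h => config_zig_off hP hF hS i h
  point_on := fun i h => by
    rw [config_point_on h]
    exact vanishesOn_point hP hF hS _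
  point_off := fun i h => config_point_off hP hF hS h
  sundial_off := fun i j => transversal_of_goodPair hP hF hS (goodPair_sundialEnd i j)
    (by simp [sundialEnd])
  sundial_node := fun i => by
    rw [inf_eq_span_singleton ((config_sundial_chain hP hF hS i).1 0 1 rfl) (ne_zero hP hF _)
      (node_mem_sundial hP hF hS i 0) (node_mem_sundial hP hF hS i 1)]
    exact vanishesOn_span_singleton hF (hP.onQuadric _)
  zz_off := config_zz_off hP hF hS
  zz_node := fun i j hij => by
    have h1 := mem_zz_right hP hF hS i
    rw [hij] at h1
    rw [inf_eq_span_singleton ((config_zz_chain hP hF hS).1 i j hij) (zzPt_ne_zero hP hF _) h1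
      (mem_zz_left hP hF hS j)]
    exact vanishesOn_span_singleton hF (hP.onQuadric _)

omit hquad

theorem config_isSimpleEnum : (config J V W).IsSimpleEnum F
    (fun x : SimpleIdx r s q z u l ls t => V (.simple x, false)) where
  onQuadric := fun x => vanishesOn_point hP hF hS _
  line := fun i h ε => by
    rw [point_le_iff hP hF hS]
    simpa [lineEnd, not_lt.2 h] using mem_config_line hP hF hS i ε
  line_ne := fun i h => point_ne hP hF hS (by simp)
  cut := fun i h => by
    rw [point_le_iff hP hF hS, ← crossEnd_zero_zero h]
    exact mem_config_cross hP hF hS i 0 0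
  cut_not := fun i h => by
    rw [point_le_iff hP hF hS]
    exact notMem_of_mem_ruling hP hF hℛ (x := (.simple (.cut i h), false))
      (y := (.red (.cut i h), true)) (by simp) (fun _ => rfl) (config_redLine_mem hP hS (.cut i h))
      (mem_config_redLine hP hF hS (.cut i h) true)
  uncut := fun i h j ε => by
    rw [point_le_iff hP hF hS, ← crossEnd_of_le h]
    exact mem_config_cross hP hF hS i j ε
  uncut_ne := fun i h j => point_ne hP hF hS (by simp)
  point := fun i h => (config_point_on h).symm
  zigStart := fun h => by
    rw [point_le_iff hP hF hS, ← zigEnd_zero_start h]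
    exact mem_config_zig hP hF hS _ 0
  zigStart_not := fun h j hj => by
    rw [point_le_iff hP hF hS]
    exact notMem_of_mem_ruling hP hF hℛ (x := (.simple (.zigStart h), false))
      (y := (.red (.zig j hj), true)) (by simp) (fun _ => rfl) (config_redLine_mem hP hS (.zig j hj))
      (mem_config_redLine hP hF hS (.zig j hj) true)
  zigEnd := fun h j hj => by
    rw [point_le_iff hP hF hS, ← zigEnd_one_last h hj]
    exact mem_config_zig hP hF hS _ 1
  zigEnd_not := fun h j hj => by
    rw [point_le_iff hP hF hS]
    exact notMem_of_mem_ruling hP hF hℛ (x := (.simple (.zigEnd h), false))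
      (y := (.red (.zig j hj), true)) (by simp) (fun _ => rfl) (config_redLine_mem hP hS (.zig j hj))
      (mem_config_redLine hP hF hS (.zig j hj) true)
  zig_ne := fun h h' => point_ne hP hF hS (by simp)
  sundial := fun i j => by
    rw [point_le_iff hP hF hS]
    exact mem_sundial hP hF hS i j
  sundial_not := fun i j j' hjj => by
    rw [point_le_iff hP hF hS]
    exact sundial_notMem hP hF hS i hjj
  zz_zero := by
    rw [point_le_iff hP hF hS, ← zzPt_zero]
    exact mem_zz_left hP hF hS 0
  zz_one := by
    rw [point_le_iff hP hF hS, ← zzPt_last]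
    exact mem_zz_right hP hF hS (Fin.last k)
  zz_not := fun ε => by
    rintro ⟨i, j, hij, hle⟩
    rw [point_le_iff hP hF hS] at hle
    fin_cases ε
    · have h2 := hle.2
      simp only [Fin.zero_eta, ← zzPt_zero] at h2
      exact zzPt_notMem hP hF hS 0 (by omega) j (by omega) (by omega) h2
    · have h1 := hle.1
      simp only [Fin.mk_one, ← zzPt_last] at h1
      exact zzPt_notMem hP hF hS (k + 1) (by omega) i (by omega) (by omega) h1
  zz_ne := point_ne hP hF hS (by simp)

omit hℛ in
theorem config_isNodeEnum : (config J V W).IsNodeEnum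
    (fun x : Fin u ⊕ Fin k => V (.double x, false)) := by
  refine ⟨fun i => ?_, fun i => ?_⟩
  · rw [point_le_iff hP hF hS]
    exact ⟨node_mem_sundial hP hF hS i 0, node_mem_sundial hP hF hS i 1⟩
  · rw [point_le_iff hP hF hS, ← zzPt_succ]
    exact ⟨mem_zz_right hP hF hS i.castSucc, mem_zz_left hP hF hS i.succ⟩

end Construction

end QuadricReduction

/-! ### Generality of the trace. -/

namespace QuadricReduction

variable {K : Type*} [Field K]

theorem exists_perm_comp_eq {α β : Type*} [Finite β] {f g : α → β} (hf : Function.Injective f)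
    (hg : Function.Injective g) : ∃ π : Equiv.Perm β, ∀ a, π (f a) = g a := by
  classical
  cases nonempty_fintype β
  let e : {x // x ∈ Set.range f} ≃ {x // x ∈ Set.range g} :=
    (Equiv.ofInjective f hf).symm.trans (Equiv.ofInjective g hg)
  refine ⟨e.extendSubtype, fun a => ?_⟩
  rw [Equiv.extendSubtype_apply_of_mem e _ ⟨a, rfl⟩]
  have h : (Equiv.ofInjective f hf).symm ⟨f a, ⟨a, rfl⟩⟩ = a :=
    (Equiv.ofInjective f hf).symm_apply_apply a
  simp [e, h]

variable {δ r s q z u k l ls t : ℕ}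

theorem uncutLabel_injective :
    Function.Injective
      (Construction.uncutLabel : _ → TraceLabel δ r s q z u k l ls t) := by
  rintro ⟨⟨i, hi⟩, m⟩ ⟨⟨j, hj⟩, m'⟩ h
  simp only [Construction.uncutLabel, TraceLabel.simple.injEq, SimpleIdx.uncut.injEq] at h
  obtain ⟨rfl, h1, h2⟩ := h
  have := Construction.fourEquiv.injective (Prod.ext h1 h2)
  rw [this]

theorem TraceLabel.block_eq_some_iff_uncutLabel {x : TraceLabel δ r s q z u k l ls t}
    {i : {i : Fin s // ls ≤ i.val}} :
    x.block = some i ↔ ∃ m, Construction.uncutLabel (i, m) = x := by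
  rw [TraceLabel.block_eq_some]
  constructor
  · rintro ⟨j, ε, rfl⟩
    exact ⟨Construction.fourEquiv.symm (j, ε), by simp [Construction.uncutLabel]⟩
  · rintro ⟨m, rfl⟩
    exact ⟨_, _, rfl⟩

/-- Any numbering of the simple points can be corrected by a permutation so that the points of each
uncut cross get the prescribed numbers. -/
theorem SimpleIdx.exists_equiv_of_embedding {p : ℕ} (hls : ls ≤ s) (ht : t ≤ q)
    (hp : p = (r - l) * 2 + (ls + ((s - ls) * 4 + (t + (min z 1 + (z % 2 + (u * 2 + 2)))))))
    (quad : Fin (s - ls) × Fin 4 ↪ Fin p) :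
    ∃ σ : SimpleIdx r s q z u l ls t ≃ Fin p, ∀ (i : {i : Fin s // ls ≤ i.val}) (m : Fin 4),
      σ (.uncut i.1 i.2 (Construction.fourEquiv m).1 (Construction.fourEquiv m).2) =
        quad (finGeEquiv s ls i, m) := by
  obtain ⟨σ⟩ := SimpleIdx.exists_equiv (r := r) (q := q) (z := z) (u := u) (l := l) hls ht hp
  have hinj : Function.Injective fun x : {i : Fin s // ls ≤ i.val} × Fin 4 =>
      σ (.uncut x.1.1 x.1.2 (Construction.fourEquiv x.2).1 (Construction.fourEquiv x.2).2) :=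
    fun x y h => uncutLabel_injective (δ := 0) (k := 0)
      (congrArg TraceLabel.simple (σ.injective h))
  obtain ⟨π, hπ⟩ := exists_perm_comp_eq hinj (g := fun x => quad (finGeEquiv s ls x.1, x.2))
    fun x y h => by
      have := quad.injective h
      simp only [Prod.mk.injEq, EmbeddingLike.apply_eq_iff_eq] at this
      exact Prod.ext this.1 this.2
  exact ⟨σ.trans π, fun i m => hπ (i, m)⟩

instance : Finite (TraceLabel δ r s q z u k l ls t) := by
  have : Finite (SimpleIdx r s q z u l ls t) := .of_equiv _ SimpleIdx.equivSum.symm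
  have : Finite (RedIdx r s z l ls) := .of_equiv _ RedIdx.equivSum.symm
  let f : TraceLabel δ r s q z u k l ls t → Fin δ ⊕ RedIdx r s z l ls ⊕
      SimpleIdx r s q z u l ls t ⊕ (Fin u ⊕ Fin k) ⊕ Fin (2 - 2 * δ) ⊕ Fin q × Fin 2
    | .fatLine i => .inl i
    | .red x => .inr (.inl x)
    | .simple x => .inr (.inr (.inl x))
    | .double x => .inr (.inr (.inr (.inl x)))
    | .multiple i => .inr (.inr (.inr (.inr (.inl i))))
    | .extra i ε => .inr (.inr (.inr (.inr (.inr (i, ε)))))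
  refine .of_injective f fun x y h => ?_
  cases x <;> cases y <;> simp_all [f]

section Label

variable {n p e : ℕ} (σ : SimpleIdx r s q z u l ls t ≃ Fin p) (ρ : RedIdx r s z l ls ≃ Fin n)
  (τ : Fin u ⊕ Fin k ≃ Fin e)

/-- The label of a line or point of the trace. -/
def TraceLabel.ofPart :
    TracePart δ n p e (2 - 2 * δ) → TraceLabel δ r s q z u k l ls t
  | .fatLine i => .fatLine i
  | .redLine i => .red (ρ.symm i)
  | .simple i => .simple (σ.symm i)
  | .double i => .double (τ.symm i)
  | .multiple i => .multiple i

/-- Vectors for the lines and points of the trace, extended by zero to the auxiliary points. -/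
def TraceLabel.extend (v : TracePart δ n p e (2 - 2 * δ) → Fin 4 → K) :
    TraceLabel δ r s q z u k l ls t → Fin 4 → K
  | .fatLine i => v (.fatLine i)
  | .red x => v (.redLine (ρ x))
  | .simple x => v (.simple (σ x))
  | .double x => v (.double (τ x))
  | .multiple i => v (.multiple i)
  -- The zero vector satisfies F = 0, which is all that the realization asks of an auxiliary label.
  -- General position then replaces it by a nonzero vector.
  | .extra _ _ => 0

theorem TraceLabel.extend_ofPart (v : TracePart δ n p e (2 - 2 * δ) → Fin 4 → K)
    (a : TracePart δ n p e (2 - 2 * δ)) :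
    TraceLabel.extend σ ρ τ v (TraceLabel.ofPart σ ρ τ a) = v a := by
  cases a <;> simp [TraceLabel.ofPart, TraceLabel.extend]

end Label

namespace Construction

open MvPolynomial

variable {n p e : ℕ} {F : Coord K} {ℛ : Set (Line K)}
  {P : TraceLabel δ r s q z u k l ls t × Bool → Fin 4 → K}
  {J : TraceLabel δ r s q z u k l ls t × Bool → TraceLabel δ r s q z u k l ls t × Bool → Line K}
  {V : TraceLabel δ r s q z u k l ls t × Bool → Pt K}
  {W : TraceLabel δ r s q z u k l ls t × Bool → TraceLabel δ r s q z u k l ls t × Bool → Pt K}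

/-- The lines and points of the trace of the constructed specialization. -/
noncomputable def traceData (σ : SimpleIdx r s q z u l ls t ≃ Fin p)
    (ρ : RedIdx r s z l ls ≃ Fin n) (τ : Fin u ⊕ Fin k ≃ Fin e)
    (J : TraceLabel δ r s q z u k l ls t × Bool → TraceLabel δ r s q z u k l ls t × Bool → Line K)
    (V : TraceLabel δ r s q z u k l ls t × Bool → Pt K)
    (W : TraceLabel δ r s q z u k l ls t × Bool → TraceLabel δ r s q z u k l ls t × Bool → Pt K) :
    TraceData K δ n p e (2 - 2 * δ) where
  fatLine _ := (config J V W).fat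
  redLine i := (config J V W).redLine (ρ.symm i)
  simple i := V (.simple (σ.symm i), false)
  double i := V (.double (τ.symm i), false)
  multiple i := V (.multiple i, false)

variable (σ : SimpleIdx r s q z u l ls t ≃ Fin p) (ρ : RedIdx r s z l ls ≃ Fin n)
  (τ : Fin u ⊕ Fin k ≃ Fin e)

variable (hP : IsGeneral F ℛ TraceLabel.block P) (hF : F.IsHomogeneous 2)
  (hℛ : IsRuling F ℛ) (hS : Spans P J V W)

include hP hF hS

theorem traceData_isRepresentedBy (hδ : δ = 0 ∨ δ = 1) : (traceData σ ρ τ J V W).IsRepresentedBy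
    fun a => P (TraceLabel.ofPart σ ρ τ a, false) := by
  intro a
  refine ⟨ne_zero hP hF _, ?_⟩
  have hpt : ∀ x, P (x, false) ∈ (V (x, false)).submodule := fun x => by
    rw [point_eq hP hF hS]
    exact Submodule.mem_span_singleton_self _
  cases a with
  | fatLine i =>
    have hi : i = ⟨0, i.pos⟩ := Fin.ext (by have := i.2; simp only; omega)
    have := mem_config_fat hP hF hS 0
    rwa [fatEnd, dif_pos i.pos, ← hi] at this
  | redLine i => exact mem_config_redLine hP hF hS _ false
  | simple i => exact hpt _
  | double i => exact hpt _
  | multiple i => exact hpt _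

include hℛ in
theorem traceData_isTrace (hδ : δ = 0 ∨ δ = 1)
    (hZ : (config J V W).IsSpecialization F ℛ δ l ls t) :
    (config J V W).IsTrace F l ls t (traceData σ ρ τ J V W) := by
  refine hZ.isTrace hF hℛ hδ σ ρ τ (fun _ => rfl) (fun x => ?_) ?_ ?_ (fun i => ⟨?_, ?_⟩)
    fun i j hij => ?_
  · simp [traceData]
  · have : (traceData σ ρ τ J V W).simple ∘ σ = fun x => V (.simple x, false) := by
      ext x; simp [traceData]
    rw [this]
    exact config_isSimpleEnum hP hF hℛ hS
  · have : (traceData σ ρ τ J V W).double ∘ τ = fun x => V (.double x, false) := by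
      ext x; simp [traceData]
    rw [this]
    exact config_isNodeEnum hP hF hS
  · have hδ0 : ¬ 0 < δ := by have := i.2; omega
    have := mem_config_fat hP hF hS ⟨i.1, by omega⟩
    rw [fatEnd, dif_neg hδ0] at this
    exact (point_le_iff hP hF hS _).2 this
  · exact vanishesOn_point hP hF hS _
  · by_contra hne
    exact point_ne hP hF hS (x := .multiple i) (y := .multiple j) (by simpa using hne) hij

end Construction

open MvPolynomial in
/-- Every nonempty open set of configurations of lines and points on the quadric contains one that
is the trace of a specialization. -/
theorem exists_isSpecialization_eval_ne_zero [IsAlgClosed K] {F : Coord K} {ℛ : Set (Line K)}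
    (hF : IsSmoothQuadric F) (hℛ : IsRuling F ℛ) (hδ : δ = 0 ∨ δ = 1) {n p e : ℕ} (hl : l ≤ r)
    (hls : ls ≤ s) (ht : t ≤ q)
    (hp : p = (r - l) * 2 + (ls + ((s - ls) * 4 + (t + (min z 1 + (z % 2 + (u * 2 + 2)))))))
    (hn : n = l + ls + z / 2) (he : e = u + k) (m : ℕ) (quad : Fin (s - ls) × Fin 4 ↪ Fin p)
    {G : MvPolynomial (TracePart δ n p e (2 - 2 * δ) × Fin 4) K}
    {v₀ : TracePart δ n p e (2 - 2 * δ) → Fin 4 → K} (hv₀ : TraceData.IsParameter F quad v₀)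
    (hG : eval (fun x => v₀ x.1 x.2) G ≠ 0) :
    ∃ (v : TracePart δ n p e (2 - 2 * δ) → Fin 4 → K) (Z : SpecConfig K r s q z u (k + 1))
      (T : TraceData K δ n p e (2 - 2 * δ)),
      TraceData.IsParameter F quad v ∧ eval (fun x => v x.1 x.2) G ≠ 0 ∧
        Z.IsSpecialization F ℛ δ l ls t ∧ T.Proper F ℛ ∧ T.IsRepresentedBy v ∧
        SameSubscheme (traceIdeal F (Z.specIdeal m)) (T.sumIdeal F m) := by
  obtain ⟨σ, hσ⟩ := SimpleIdx.exists_equiv_of_embedding (z := z) (u := u) hls ht hp quad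
  obtain ⟨ρ⟩ := RedIdx.exists_equiv (z := z) hl hls hn
  subst he
  let τ : Fin u ⊕ Fin k ≃ Fin (u + k) := finSumFinEquiv
  have hrename : ∀ w : TraceLabel δ r s q z u k l ls t → Fin 4 → K,
      eval (fun x => w x.1 x.2) (rename (Prod.map (TraceLabel.ofPart σ ρ τ) id) G) =
        eval (fun x => w (TraceLabel.ofPart σ ρ τ x.1) x.2) G := fun w => by
    rw [eval_rename]
    rfl
  let quad' : {i : Fin s // ls ≤ i.val} × Fin 4 ↪ TraceLabel δ r s q z u k l ls t :=
    ⟨Construction.uncutLabel, uncutLabel_injective⟩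
  have hquad' : ∀ i m, TraceLabel.extend σ ρ τ v₀ (quad' (i, m)) =
      v₀ (.simple (quad (finGeEquiv s ls i, m))) := fun i m => by
    rw [← hσ]
    rfl
  have hquad : ∀ j m, TraceLabel.ofPart σ ρ τ
      (.simple (quad (j, m)) : TracePart δ n p (u + k) (2 - 2 * δ)) =
        quad' ((finGeEquiv s ls).symm j, m) := fun j m => by
    have h := hσ ((finGeEquiv s ls).symm j) m
    rw [Equiv.apply_symm_apply] at h
    rw [TraceLabel.ofPart, ← h, Equiv.symm_apply_apply]
    rfl
  -- The polynomial G involves only the labels of the trace. Renaming its variables turns it into a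
  -- condition on all labels.
  obtain ⟨P, hP, hPq, hPG⟩ := exists_isGeneral hF hℛ (quad := quad')
    (v₀ := TraceLabel.extend σ ρ τ v₀) (G := rename (Prod.map (TraceLabel.ofPart σ ρ τ) id) G)
    (fun _ _ => TraceLabel.block_eq_some_iff_uncutLabel)
    (fun x => by
      cases x with
      | extra i ε =>
        have h0 : (TraceLabel.extend σ ρ τ v₀ (.extra i ε) : Fin 4 → K) = 0 := rfl
        rw [h0, eval_zero, constantCoeff_eq]
        exact hF.1.coeff_eq_zero (by simp)
      | _ => exact (hv₀.1 _).2)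
    (fun j => by simpa only [hquad'] using hv₀.2 (finGeEquiv s ls j))
    (by rw [hrename]; simpa only [TraceLabel.extend_ofPart] using hG)
  obtain ⟨L₀, -⟩ := exists_two_lines hF hℛ
  obtain ⟨J, V, W, hS⟩ := Construction.exists_spans L₀ P
  have hZ := Construction.config_isSpecialization hP hF.1 hℛ hS hPq
  have hT := Construction.traceData_isTrace σ ρ τ hP hF.1 hℛ hS hδ hZ
  refine ⟨_, _, _, ⟨fun a => ⟨Construction.ne_zero hP hF.1 _, hP.onQuadric _⟩, fun j => ?_⟩, ?_, hZ,
    hT.proper hZ hℛ hδ, Construction.traceData_isRepresentedBy σ ρ τ hP hF.1 hS hδ,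
    hT.sameSubscheme hZ hF.1 hℛ hδ m⟩
  · simp only [hquad]
    exact hPq _
  · rwa [hrename fun x => P (x, false)] at hPG

end QuadricReduction
-- Residual scheme, trace and generality together.
theorem mainTheorem4 {K : Type*} [Field K] [IsAlgClosed K]
    (F : Coord K) (hF : IsSmoothQuadric F) (ℛ : Set (Line K)) (hℛ : IsRuling F ℛ)
    (m r s q z δ l ls lz t ts tz : ℕ)
    (hδ : δ = 0 ∨ δ = 1) (hδm : δ ≤ m) (hlz : lz = z / 2)
    (hr : l + 2 * ts + (tz + 1) ≤ r) (hls : ls ≤ s) (ht : t ≤ q) :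
    ∃ p : ℕ,
      (p : ℤ) = 2 * r - 2 * l - 2 * lz - 3 * ls - 2 * ts - 2 * tz + t + 4 * s + z
        + (if z = 0 then 0 else 1) ∧
      -- residual scheme and trace of every specialization
      (∀ Z : SpecConfig K (r - 2 * ts - (tz + 1)) s q z ts (tz + 1),
        Z.IsSpecialization F ℛ δ l ls t →
          (∃ C : Config K (r - l + ls + (z - lz) - 2 * ts - (tz + 1)) (s - ls + ts) (q - t)
              (tz + 1),
            C.Proper ∧ Z.IsRemainder l ls t C ∧
              residualIdeal F (Z.specIdeal m) = C.ideal (m - δ)) ∧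
          (∃ T : TraceData K δ (l + ls + lz) p (ts + tz) (2 - 2 * δ),
            T.Proper F ℛ ∧
              SameSubscheme (traceIdeal F (Z.specIdeal m)) (T.sumIdeal F m))) ∧
      -- the lines and points of the trace are general: every nonempty Zariski open set of
      -- configurations contains one that comes from a specialization
      (∀ quad : Fin (s - ls) × Fin 4 ↪ Fin p,
        ∀ G : MvPolynomial (TracePart δ (l + ls + lz) p (ts + tz) (2 - 2 * δ) × Fin 4) K,
          (∃ v : TracePart δ (l + ls + lz) p (ts + tz) (2 - 2 * δ) → Fin 4 → K,
            TraceData.IsParameter F quad v ∧ MvPolynomial.eval (fun x => v x.1 x.2) G ≠ 0) →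
          ∃ (v : TracePart δ (l + ls + lz) p (ts + tz) (2 - 2 * δ) → Fin 4 → K)
            (Z : SpecConfig K (r - 2 * ts - (tz + 1)) s q z ts (tz + 1))
            (T : TraceData K δ (l + ls + lz) p (ts + tz) (2 - 2 * δ)),
            TraceData.IsParameter F quad v ∧ MvPolynomial.eval (fun x => v x.1 x.2) G ≠ 0 ∧
              Z.IsSpecialization F ℛ δ l ls t ∧ T.Proper F ℛ ∧ T.IsRepresentedBy v ∧
              SameSubscheme (traceIdeal F (Z.specIdeal m)) (T.sumIdeal F m)) := by
  have hu : (if z = 0 then (0 : ℤ) else 1) = (min z 1 : ℕ) := by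
    split
    · simp [*]
    · rw [min_eq_right (by omega)]; rfl
  have hK : Infinite K := IsAlgClosed.instInfinite
  subst hlz
  have hl : l ≤ r - 2 * ts - (tz + 1) := by omega
  -- The value of p is fixed by unification: it is the sum that counts the labels of the simple
  -- points, hence a natural number.
  refine ⟨_, ?_, fun Z hZ => ⟨?_, ?_⟩, fun quad G ⟨v₀, hv₀, hG⟩ =>
    exists_isSpecialization_eval_ne_zero (z := z) (u := ts) (k := tz) hF hℛ hδ hl hls ht rfl rfl
      rfl m quad hv₀ hG⟩
  · rw [hu]
    omega
  · exact hZ.exists_residual hF hℛ hδ hδm hls (by omega) rfl rfl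
  · obtain ⟨σ⟩ := SimpleIdx.exists_equiv (r := r - 2 * ts - (tz + 1)) (q := q) (z := z) (u := ts)
      (l := l) hls ht rfl
    obtain ⟨ρ⟩ := RedIdx.exists_equiv (z := z) hl hls rfl
    obtain ⟨T, hT⟩ := hZ.exists_isTrace hF.1 hℛ hδ σ ρ finSumFinEquiv
    exact ⟨T, hT.proper hZ hℛ hδ, hT.sameSubscheme hZ hF.1 hℛ hδ m⟩
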